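/- Let $\Omega\subset\mathbb{R}^2$ be a bounded open set, $T>0$, $Q=\Omega\times\,]0,T[$, $Y=(-\tfrac12,\tfrac12)^2$, $Z=(-\tfrac12,\tfrac12)$. Let $a_{ij}\in L^\infty(\mathbb{R}^2;\mathbb{R})$ ($1\le i,j\le 2$) satisfy $a_{ij}=a_{ji}$ and, for some constant $\alpha>0$, $\sum_{i,j}a_{ij}(y)\zeta_j\zeta_i\ge\alpha|\zeta|^2$ for all $\zeta\in\mathbb{R}^2$ and almost all $y\in\mathbb{R}^2$, and let $\mathbf f\in L^2(0,T;H^{-1}(\Omega;\mathbb{R})^2)$. Put $V=\{\mathbf u\in H^1_0(\Omega;\mathbb{R})^2:\operatorname{div}\mathbf u=0\}$, with dual $V'$, and $\mathcal W(0,T)=\{\mathbf u\in L^2(0,T;V):\mathbf u'\in L^2(0,T;V')\}$, where $\mathbf u'$ is the distributional time derivative and $V$ is embedded in $V'$ through the inner product of $L^2(\Omega)^2$; every $\mathbf u\in\mathcal W(0,T)$ has a representative in $\mathcal C([0,T];L^2(\Omega)^2)$, through which $\mathbf u(0)$ is defined. Let $H^1_\#(Y)$ be the space of $Y$-periodic real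 functions in $H^1_{loc}(\mathbb{R}^2)$ with mean zero over $Y$, $V_Y=\{\mathbf w\in H^1_\#(Y)^2:\operatorname{div}_y\mathbf w=0\}$, $L^2_{per}(Z;V_Y)$ the space of $Z$-periodic functions in $L^2_{loc}(\mathbb{R};V_Y)$, and $$\mathbb F^1_0=L^2(0,T;V)\times L^2\big(Q;L^2_{per}(Z;V_Y)\big).$$ For $\mathbf u,\mathbf v,\mathbf w\in V$ let $$b(\mathbf u,\mathbf v,\mathbf w)=\sum_{k,j=1}^2\int_\Omega u^j\frac{\partial v^k}{\partial x_j}w^k\,dx,$$ and for $\mathbf u=(\mathbf u_0,\mathbf u_1)$, $\mathbf v=(\mathbf v_0,\mathbf v_1)$ in $V\times L^2(\Omega;L^2_{per}(Z;V_Y))$ let $$\widehat a_\Omega(\mathbf u,\mathbf v)=\sum_{i,j,k=1}^2\iiint_{\Omega\times Y\times Z}a_{ij}(y)\Big(\frac{\partial u_0^k}{\partial x_j}+\frac{\partial u_1^k}{\partial y_j}\Big)\Big(\frac{\partial v_0^k}{\partial x_i}+\frac{\partial v_1^k}{\partial y_i}\Big)\,dx\,dy\,d\tau.$$ Then there is at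 most one $\mathbf u=(\mathbf u_0,\mathbf u_1)\in\mathbb F^1_0$ such that $\mathbf u_0\in\mathcal W(0,T)$, $\mathbf u_0(0)=0$ and $$\int_0^T(\mathbf u_0'(t),\mathbf v_0(t))\,dt+\int_0^T\widehat a_\Omega(\mathbf u(t),\mathbf v(t))\,dt+\int_0^Tb(\mathbf u_0(t),\mathbf u_0(t),\mathbf v_0(t))\,dt=\int_0^T(\mathbf f(t),\mathbf v_0(t))\,dt$$ for all $\mathbf v=(\mathbf v_0,\mathbf v_1)\in\mathbb F^1_0$, where $(\cdot,\cdot)$ denotes the duality pairings of $V'$ with $V$ and of $H^{-1}(\Omega)^2$ with $H^1_0(\Omega)^2$. -/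

import Mathlib

open MeasureTheory Set
open scoped ContDiff

noncomputable section

namespace TwoScale

/-! ## Test functions and weak gradients -/

/-- The numerical space `ℝ^N` with its Euclidean structure and Lebesgue measure. -/
abbrev Euc (N : ℕ) : Type := EuclideanSpace ℝ (Fin N)

/-- `φ ∈ 𝒟(U; ℝ)`: smooth, with compact support contained in `U`. -/
def IsTestFunction {E : Type*} [NormedAddCommGroup E] [NormedSpace ℝ E]
    (U : Set E) (φ : E → ℝ) : Prop :=
  ContDiff ℝ ∞ φ ∧ HasCompactSupport φ ∧ tsupport φ ⊆ U

/-- The classical partial derivative `∂φ/∂x_i`. -/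
def pd {N : ℕ} (i : Fin N) (φ : Euc N → ℝ) (x : Euc N) : ℝ :=
  fderiv ℝ φ x (EuclideanSpace.single i (1 : ℝ))

/-- `u ∈ L¹_loc(ℝ^N)` has the weak gradient `g ∈ L¹_loc(ℝ^N)^N` on the whole space. -/
def HasWeakGrad {N : ℕ} (u : Euc N → ℝ) (g : Euc N → Euc N) : Prop :=
  LocallyIntegrable u ∧ LocallyIntegrable g ∧
    ∀ φ : Euc N → ℝ, IsTestFunction univ φ → ∀ i : Fin N,
      ∫ x, u x * pd i φ x = - ∫ x, g x i * φ x

/-! ## The space `H¹₀(Ω; ℝ)` and its divergence-free vector fields -/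

/-- Pairs (function, candidate gradient) in `L²(μ) × L²(μ)^N`, with the `H¹` norm
`(‖u‖² + ‖g‖²)^{1/2}`. -/
abbrev Jet {N : ℕ} (μ : Measure (Euc N)) : Type :=
  WithLp 2 (Lp ℝ 2 μ × Lp (Euc N) 2 μ)

/-- The graph `{(φ, ∇φ) : φ ∈ 𝒟(Ω; ℝ)}` in `L²(Ω) × L²(Ω)^N`. -/
def testGraph {N : ℕ} (Ω : Set (Euc N)) : Submodule ℝ (Jet (volume.restrict Ω)) where
  carrier := {p | ∃ φ : Euc N → ℝ, IsTestFunction Ω φ ∧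
    (∀ᵐ x ∂volume.restrict Ω, p.fst x = φ x) ∧
    (∀ᵐ x ∂volume.restrict Ω, ∀ i, p.snd x i = pd i φ x)}
  zero_mem' := by
    refine ⟨fun _ => 0, ⟨contDiff_const, HasCompactSupport.zero, ?_⟩, ?_, ?_⟩
    · have h : tsupport (fun _ : Euc N => (0 : ℝ)) = ∅ := by
        rw [tsupport_eq_empty_iff]; rfl
      simp [h]
    · filter_upwards [Lp.coeFn_zero ℝ 2 (volume.restrict Ω)] with x hx
      simpa using hx
    · filter_upwards [Lp.coeFn_zero (Euc N) 2 (volume.restrict Ω)] with x hx i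
      have : ((0 : Jet (volume.restrict Ω)).snd : Euc N → Euc N) x = 0 := by simpa using hx
      rw [this]
      simp [pd]
  add_mem' := by
    rintro p q ⟨φ, hφ, hp, hp'⟩ ⟨ψ, hψ, hq, hq'⟩
    refine ⟨φ + ψ, ⟨hφ.1.add hψ.1, hφ.2.1.add hψ.2.1, ?_⟩, ?_, ?_⟩
    · exact (tsupport_add φ ψ).trans (union_subset hφ.2.2 hψ.2.2)
    · filter_upwards [hp, hq, Lp.coeFn_add p.fst q.fst] with x h1 h2 h3
      have : ((p + q).fst : Euc N → ℝ) x = p.fst x + q.fst x := by simpa using h3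
      rw [this, h1, h2, Pi.add_apply]
    · filter_upwards [hp', hq', Lp.coeFn_add p.snd q.snd] with x h1 h2 h3 i
      have : ((p + q).snd : Euc N → Euc N) x = p.snd x + q.snd x := by simpa using h3
      have hd1 : DifferentiableAt ℝ φ x := (hφ.1.differentiable (by simp)) x
      have hd2 : DifferentiableAt ℝ ψ x := (hψ.1.differentiable (by simp)) x
      rw [this, PiLp.add_apply, h1, h2]
      simp [pd, fderiv_add hd1 hd2]
  smul_mem' := by
    rintro c p ⟨φ, hφ, hp, hp'⟩
    refine ⟨c • φ, ⟨contDiff_const.smul hφ.1, hφ.2.1.smul_left, ?_⟩, ?_, ?_⟩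
    · exact (tsupport_smul_subset_right (fun _ => c) φ).trans hφ.2.2
    · filter_upwards [hp, Lp.coeFn_smul c p.fst] with x h1 h3
      have : ((c • p).fst : Euc N → ℝ) x = c • p.fst x := by simpa using h3
      rw [this, h1, Pi.smul_apply]
    · filter_upwards [hp', Lp.coeFn_smul c p.snd] with x h1 h3 i
      have : ((c • p).snd : Euc N → Euc N) x = c • p.snd x := by simpa using h3
      have hd1 : DifferentiableAt ℝ φ x := (hφ.1.differentiable (by simp)) x
      rw [this, PiLp.smul_apply, h1]
      simp [pd, fderiv_const_smul hd1]

/-- `H¹₀(Ω; ℝ)`, the closure of `𝒟(Ω; ℝ)` in the `H¹(Ω)` norm. An element is a function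
together with its weak gradient (a limit of pairs `(φ, ∇φ)` is a function with its weak
gradient, which the function determines). -/
def H10 {N : ℕ} (Ω : Set (Euc N)) : Type := (testGraph Ω).topologicalClosure

instance {N : ℕ} (Ω : Set (Euc N)) : NormedAddCommGroup (H10 Ω) :=
  inferInstanceAs (NormedAddCommGroup (testGraph Ω).topologicalClosure)

instance {N : ℕ} (Ω : Set (Euc N)) : InnerProductSpace ℝ (H10 Ω) :=
  inferInstanceAs (InnerProductSpace ℝ (testGraph Ω).topologicalClosure)

/-- The function underlying an element of `H¹₀(Ω)`. -/
def H10.val {N : ℕ} {Ω : Set (Euc N)} (u : H10 Ω) : Lp ℝ 2 (volume.restrict Ω) :=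
  (Subtype.val u).fst

/-- The gradient of an element of `H¹₀(Ω)`. -/
def H10.grad {N : ℕ} {Ω : Set (Euc N)} (u : H10 Ω) : Lp (Euc N) 2 (volume.restrict Ω) :=
  (Subtype.val u).snd

/-- `H¹₀(Ω; ℝ)^N`. -/
abbrev H10N {N : ℕ} (Ω : Set (Euc N)) : Type := PiLp 2 (fun _ : Fin N => H10 Ω)

/-- `H⁻¹(Ω; ℝ)^N`, where `H⁻¹(Ω; ℝ)` is the topological dual of `H¹₀(Ω; ℝ)`. -/
abbrev HNeg1N {N : ℕ} (Ω : Set (Euc N)) : Type :=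
  PiLp 2 (fun _ : Fin N => StrongDual ℝ (H10 Ω))

/-- `{u ∈ H¹₀(Ω; ℝ)^N : div u = 0}` as a subspace. -/
def divFree {N : ℕ} (Ω : Set (Euc N)) : Submodule ℝ (H10N Ω) where
  carrier := {u | ∀ᵐ x ∂volume.restrict Ω, ∑ i, (u i).grad x i = 0}
  zero_mem' := by
    filter_upwards [Lp.coeFn_zero (Euc N) 2 (volume.restrict Ω)] with x hx
    refine Finset.sum_eq_zero fun i _ => ?_
    have : ((((0 : H10N Ω) i).grad : Lp (Euc N) 2 _) : Euc N → Euc N) x = 0 := by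
      exact hx
    rw [this]; rfl
  add_mem' := by
    intro u v hu hv
    have h : ∀ᵐ x ∂volume.restrict Ω, ∀ i,
        (((u i).grad + (v i).grad : Lp (Euc N) 2 (volume.restrict Ω)) : Euc N → Euc N) x
          = (u i).grad x + (v i).grad x :=
      ae_all_iff.2 fun i => Lp.coeFn_add _ _
    filter_upwards [hu, hv, h] with x h1 h2 h3
    calc ∑ i, ((u + v) i).grad x i = ∑ i, ((u i).grad x i + (v i).grad x i) := by
          refine Finset.sum_congr rfl fun i _ => ?_
          rw [← PiLp.add_apply, ← h3 i]; rfl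
      _ = 0 := by rw [Finset.sum_add_distrib, h1, h2, add_zero]
  smul_mem' := by
    intro c u hu
    have h : ∀ᵐ x ∂volume.restrict Ω, ∀ i,
        ((c • (u i).grad : Lp (Euc N) 2 (volume.restrict Ω)) : Euc N → Euc N) x
          = c • (u i).grad x :=
      ae_all_iff.2 fun i => Lp.coeFn_smul _ _
    filter_upwards [hu, h] with x h1 h3
    calc ∑ i, ((c • u) i).grad x i = ∑ i, c • (u i).grad x i := by
          refine Finset.sum_congr rfl fun i _ => ?_
          rw [← PiLp.smul_apply, ← h3 i]; rfl
      _ = 0 := by rw [← Finset.smul_sum, h1, smul_zero]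

/-- The space `V = {u ∈ H¹₀(Ω; ℝ)^N : div u = 0}`. -/
def V {N : ℕ} (Ω : Set (Euc N)) : Type := divFree Ω

instance {N : ℕ} (Ω : Set (Euc N)) : NormedAddCommGroup (V Ω) :=
  inferInstanceAs (NormedAddCommGroup (divFree Ω))

instance {N : ℕ} (Ω : Set (Euc N)) : InnerProductSpace ℝ (V Ω) :=
  inferInstanceAs (InnerProductSpace ℝ (divFree Ω))

/-- The `k`-th component of `u ∈ V` as an element of `H¹₀(Ω)`. -/
def V.comp {N : ℕ} {Ω : Set (Euc N)} (u : V Ω) (k : Fin N) : H10 Ω :=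
  (Subtype.val u : H10N Ω) k

/-- The `k`-th component `u^k ∈ L²(Ω)` of `u ∈ V`. -/
def V.val {N : ℕ} {Ω : Set (Euc N)} (u : V Ω) (k : Fin N) : Lp ℝ 2 (volume.restrict Ω) :=
  (u.comp k).val

/-- The gradient `∇u^k ∈ L²(Ω)^N` of the `k`-th component of `u ∈ V`. -/
def V.grad {N : ℕ} {Ω : Set (Euc N)} (u : V Ω) (k : Fin N) :
    Lp (Euc N) 2 (volume.restrict Ω) :=
  (u.comp k).grad

/-! ## The periodic spaces -/

/-- The reference cell `Y = (-1/2, 1/2)^N`. -/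
def Y (N : ℕ) : Set (Euc N) := {y | ∀ i, y i ∈ Ioo (-1 / 2 : ℝ) (1 / 2)}

/-- The reference interval `Z = (-1/2, 1/2)`. -/
def Z : Set ℝ := Ioo (-1 / 2 : ℝ) (1 / 2)

/-- `Y`-periodicity: `F (y + k) = F y` for almost all `y`, for each `k ∈ ℤ^N`. -/
def IsPeriodic {N : ℕ} {β : Type*} (F : Euc N → β) : Prop :=
  ∀ k : Fin N → ℤ, ∀ᵐ y : Euc N, F (y + WithLp.toLp 2 (fun i => (k i : ℝ))) = F y

/-- The `Y`-periodic functions `u ∈ H¹_loc(ℝ^N)` with `∫_Y u = 0`, as a subspace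
of `L²(Y) × L²(Y)^N`: it is realised by the restrictions to `Y` of `u` and of its weak gradient on `ℝ^N`; a
periodic function that is square integrable on `Y` is so on every bounded set. -/
def periodicGraph (N : ℕ) : Submodule ℝ (Jet (volume.restrict (Y N))) where
  carrier := {p | (∃ (U : Euc N → ℝ) (G : Euc N → Euc N),
      IsPeriodic U ∧ IsPeriodic G ∧ HasWeakGrad U G ∧
      (∀ᵐ y ∂volume.restrict (Y N), p.fst y = U y) ∧
      (∀ᵐ y ∂volume.restrict (Y N), p.snd y = G y)) ∧
    ∫ y in Y N, p.fst y = 0}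
  zero_mem' := by
    refine ⟨⟨fun _ => 0, fun _ => 0, fun k => by simp, fun k => by simp,
      ⟨locallyIntegrable_const _, locallyIntegrable_const _, by simp⟩, ?_, ?_⟩, ?_⟩
    · filter_upwards [Lp.coeFn_zero ℝ 2 (volume.restrict (Y N))] with x hx
      simpa using hx
    · filter_upwards [Lp.coeFn_zero (Euc N) 2 (volume.restrict (Y N))] with x hx
      simpa using hx
    · have h : ∀ᵐ y ∂volume.restrict (Y N),
          (((0 : Jet (volume.restrict (Y N))).fst : Lp ℝ 2 _) : Euc N → ℝ) y = 0 := by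
        filter_upwards [Lp.coeFn_zero ℝ 2 (volume.restrict (Y N))] with x hx
        simpa using hx
      rw [integral_congr_ae h]; simp
  add_mem' := by
    rintro p q ⟨⟨U, G, hU, hG, hw, h1, h2⟩, hm⟩ ⟨⟨U', G', hU', hG', hw', h1', h2'⟩, hm'⟩
    have hf : ∀ᵐ y ∂volume.restrict (Y N), (p + q).fst y = p.fst y + q.fst y := by
      filter_upwards [Lp.coeFn_add p.fst q.fst] with x h3
      simpa using h3
    have hs : ∀ᵐ y ∂volume.restrict (Y N), (p + q).snd y = p.snd y + q.snd y := by
      filter_upwards [Lp.coeFn_add p.snd q.snd] with x h3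
      simpa using h3
    refine ⟨⟨fun y => U y + U' y, fun y => G y + G' y, fun k => ?_, fun k => ?_,
      ⟨hw.1.add hw'.1, hw.2.1.add hw'.2.1, fun φ hφ i => ?_⟩, ?_, ?_⟩, ?_⟩
    · filter_upwards [hU k, hU' k] with y a b
      rw [a, b]
    · filter_upwards [hG k, hG' k] with y a b
      rw [a, b]
    · have cpd : Continuous (pd i φ) :=
        (hφ.1.continuous_fderiv (by simp)).clm_apply continuous_const
      have spd : HasCompactSupport (pd i φ) := hφ.2.1.fderiv_apply (𝕜 := ℝ) _
      have e : ∀ W : Euc N → ℝ, LocallyIntegrable W →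
          Integrable (fun x => W x * pd i φ x) := fun W hW => by
        simpa [mul_comm] using hW.integrable_smul_left_of_hasCompactSupport cpd spd
      have e2 : ∀ W : Euc N → Euc N, LocallyIntegrable W →
          Integrable (fun x => W x i * φ x) := fun W hW => by
        have := (EuclideanSpace.proj (𝕜 := ℝ) i).integrable_comp
          (hW.integrable_smul_left_of_hasCompactSupport hφ.1.continuous hφ.2.1)
        simpa [mul_comm] using this
      calc ∫ x, (U x + U' x) * pd i φ x
          = ∫ x, (U x * pd i φ x + U' x * pd i φ x) := by simp only [add_mul]
        _ = - ∫ x, (G x i * φ x + G' x i * φ x) := by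
            rw [integral_add (e U hw.1) (e U' hw'.1), hw.2.2 φ hφ i, hw'.2.2 φ hφ i,
              integral_add (e2 G hw.2.1) (e2 G' hw'.2.1)]
            ring
        _ = - ∫ x, (G x + G' x) i * φ x := by simp only [PiLp.add_apply, add_mul]
    · filter_upwards [hf, h1, h1'] with y a b c
      rw [a, b, c]
    · filter_upwards [hs, h2, h2'] with y a b c
      rw [a, b, c]
    · have fin : IsFiniteMeasure (volume.restrict (Y N)) := by
        refine ⟨?_⟩
        rw [Measure.restrict_apply_univ]
        refine (Bornology.IsBounded.subset
          (Metric.isBounded_ball (x := (0 : Euc N)) (r := (N : ℝ) + 1)) ?_).measure_lt_top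
        intro y hy
        rw [mem_ball_zero_iff]
        calc ‖y‖ ≤ ∑ i, ‖EuclideanSpace.single i (y i)‖ := by
              conv_lhs => rw [← (EuclideanSpace.basisFun (Fin N) ℝ).sum_repr y]
              refine (norm_sum_le _ _).trans_eq (Finset.sum_congr rfl fun i _ => ?_)
              simp [norm_smul]
          _ ≤ ∑ _i : Fin N, (1 : ℝ) := by
              refine Finset.sum_le_sum fun i _ => ?_
              have := hy i
              simp only [mem_Ioo] at this
              rw [PiLp.norm_single, Real.norm_eq_abs, abs_le]
              constructor <;> linarith [this.1, this.2]
          _ < N + 1 := by simp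
      have i1 : Integrable (fun y => p.fst y) (volume.restrict (Y N)) :=
        (Lp.memLp p.fst).integrable (by norm_num)
      have i2 : Integrable (fun y => q.fst y) (volume.restrict (Y N)) :=
        (Lp.memLp q.fst).integrable (by norm_num)
      rw [integral_congr_ae hf, integral_add i1 i2, hm, hm', add_zero]
  smul_mem' := by
    rintro c p ⟨⟨U, G, hU, hG, hw, h1, h2⟩, hm⟩
    have hf : ∀ᵐ y ∂volume.restrict (Y N), (c • p).fst y = c * p.fst y := by
      filter_upwards [Lp.coeFn_smul c p.fst] with x h3
      simpa using h3
    have hs : ∀ᵐ y ∂volume.restrict (Y N), (c • p).snd y = c • p.snd y := by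
      filter_upwards [Lp.coeFn_smul c p.snd] with x h3
      simpa using h3
    refine ⟨⟨fun y => c * U y, fun y => c • G y, fun k => ?_, fun k => ?_,
      ⟨hw.1.smul c, hw.2.1.smul c, fun φ hφ i => ?_⟩, ?_, ?_⟩, ?_⟩
    · filter_upwards [hU k] with y a
      rw [a]
    · filter_upwards [hG k] with y a
      rw [a]
    · simp only [PiLp.smul_apply, smul_eq_mul, mul_assoc, integral_const_mul, hw.2.2 φ hφ i]
      ring
    · filter_upwards [hf, h1] with y a b
      rw [a, b]
    · filter_upwards [hs, h2] with y a b
      rw [a, b]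
    · rw [integral_congr_ae hf, integral_const_mul, hm, mul_zero]

/-- `H¹_#(Y; ℝ)`: the `Y`-periodic functions in `H¹_loc(ℝ^N)` with mean zero on `Y`. -/
def H1per (N : ℕ) : Type := periodicGraph N

instance (N : ℕ) : NormedAddCommGroup (H1per N) :=
  inferInstanceAs (NormedAddCommGroup (periodicGraph N))

instance (N : ℕ) : InnerProductSpace ℝ (H1per N) :=
  inferInstanceAs (InnerProductSpace ℝ (periodicGraph N))

/-- The gradient on `Y` of an element of `H¹_#(Y)`. -/
def H1per.grad {N : ℕ} (u : H1per N) : Lp (Euc N) 2 (volume.restrict (Y N)) :=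
  (Subtype.val u).snd

/-- `{w ∈ H¹_#(Y; ℝ)^N : div_y w = 0}` as a subspace. -/
def divFreePer (N : ℕ) : Submodule ℝ (PiLp 2 (fun _ : Fin N => H1per N)) where
  carrier := {w | ∀ᵐ y ∂volume.restrict (Y N), ∑ i, (w i).grad y i = 0}
  zero_mem' := by
    filter_upwards [Lp.coeFn_zero (Euc N) 2 (volume.restrict (Y N))] with x hx
    refine Finset.sum_eq_zero fun i _ => ?_
    have : ((((0 : PiLp 2 (fun _ : Fin N => H1per N)) i).grad : Lp (Euc N) 2 _) :
        Euc N → Euc N) x = 0 := by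
      exact hx
    rw [this]; rfl
  add_mem' := by
    intro u v hu hv
    have h : ∀ᵐ x ∂volume.restrict (Y N), ∀ i,
        (((u i).grad + (v i).grad : Lp (Euc N) 2 (volume.restrict (Y N))) : Euc N → Euc N) x
          = (u i).grad x + (v i).grad x :=
      ae_all_iff.2 fun i => Lp.coeFn_add _ _
    filter_upwards [hu, hv, h] with x h1 h2 h3
    calc ∑ i, ((u + v) i).grad x i = ∑ i, ((u i).grad x i + (v i).grad x i) := by
          refine Finset.sum_congr rfl fun i _ => ?_
          rw [← PiLp.add_apply, ← h3 i]; rfl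
      _ = 0 := by rw [Finset.sum_add_distrib, h1, h2, add_zero]
  smul_mem' := by
    intro c u hu
    have h : ∀ᵐ x ∂volume.restrict (Y N), ∀ i,
        ((c • (u i).grad : Lp (Euc N) 2 (volume.restrict (Y N))) : Euc N → Euc N) x
          = c • (u i).grad x :=
      ae_all_iff.2 fun i => Lp.coeFn_smul _ _
    filter_upwards [hu, h] with x h1 h3
    calc ∑ i, ((c • u) i).grad x i = ∑ i, c • (u i).grad x i := by
          refine Finset.sum_congr rfl fun i _ => ?_
          rw [← PiLp.smul_apply, ← h3 i]; rfl
      _ = 0 := by rw [← Finset.smul_sum, h1, smul_zero]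

/-- The space `V_Y = {w ∈ H¹_#(Y; ℝ)^N : div_y w = 0}`. -/
def VY (N : ℕ) : Type := divFreePer N

instance (N : ℕ) : NormedAddCommGroup (VY N) :=
  inferInstanceAs (NormedAddCommGroup (divFreePer N))

instance (N : ℕ) : InnerProductSpace ℝ (VY N) :=
  inferInstanceAs (InnerProductSpace ℝ (divFreePer N))

/-- The gradient `∇_y w^k` of the `k`-th component of `w ∈ V_Y`. -/
def VY.grad {N : ℕ} (w : VY N) (k : Fin N) : Lp (Euc N) 2 (volume.restrict (Y N)) :=
  H1per.grad ((Subtype.val w : PiLp 2 (fun _ : Fin N => H1per N)) k)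

/-- `L²_per(Z; V_Y)`: a `Z`-periodic function of `τ ∈ ℝ` is given by its restriction to the
period `Z`. -/
abbrev L2perZ (N : ℕ) : Type := Lp (VY N) 2 (volume.restrict Z)

/-! ## Function spaces in time and the two-scale space -/

/-- Lebesgue measure on `]0,T[`. -/
abbrev timeMeas (T : ℝ) : Measure ℝ := volume.restrict (Ioo 0 T)

/-- `𝔽₀¹ = L²(0,T; V) × L²(Q; L²_per(Z; V_Y))` with `Q = Ω × ]0,T[`. -/
abbrev F01 {N : ℕ} (Ω : Set (Euc N)) (T : ℝ) : Type :=
  Lp (V Ω) 2 (timeMeas T) × Lp (L2perZ N) 2 (volume.restrict (Ω ×ˢ Ioo 0 T))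

/-- The inner product `∑_k ∫_Ω u^k v^k dx` of `L²(Ω)^N`. -/
def innerL2 {N : ℕ} {Ω : Set (Euc N)} (u v : V Ω) : ℝ :=
  ∑ k, ∫ x in Ω, u.val k x * v.val k x

/-- `u' = g` in the sense of `V'`-valued distributions on `]0,T[`, where `u(t) ∈ V` is
identified with the functional `v ↦ ∫_Ω u(t)·v dx` on `V`. -/
def IsTimeDeriv {N : ℕ} {Ω : Set (Euc N)} {T : ℝ}
    (u : Lp (V Ω) 2 (timeMeas T)) (g : Lp (StrongDual ℝ (V Ω)) 2 (timeMeas T)) : Prop :=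
  ∀ φ : ℝ → ℝ, IsTestFunction (Ioo 0 T) φ → ∀ v : V Ω,
    ∫ t in Ioo 0 T, innerL2 (u t) v * deriv φ t = - ∫ t in Ioo 0 T, g t v * φ t

/-- `u(0) = 0`: the representative of `u` that is continuous on `[0,T]` with values in
`L²(Ω)^N` vanishes at `0`. -/
def InitZero {N : ℕ} {Ω : Set (Euc N)} {T : ℝ} (u : Lp (V Ω) 2 (timeMeas T)) : Prop :=
  ∃ w : ℝ → Fin N → Lp ℝ 2 (volume.restrict Ω),
    ContinuousOn w (Icc 0 T) ∧ (∀ᵐ t ∂timeMeas T, w t = (u t).val) ∧ w 0 = 0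

/-! ## The forms and the variational problem -/

/-- The trilinear form `b(u,v,w) = ∑_{k,j} ∫_Ω u^j (∂v^k/∂x_j) w^k dx`. -/
def b {N : ℕ} {Ω : Set (Euc N)} (u v w : V Ω) : ℝ :=
  ∑ k, ∑ j, ∫ x in Ω, u.val j x * v.grad k x j * w.val k x

/-- The form `â_Ω((u₀,u₁),(v₀,v₁))`, the sum over `i,j,k` of
`∫∫∫_{Ω×Y×Z} a_ij(y) (∂u₀^k/∂x_j + ∂u₁^k/∂y_j) (∂v₀^k/∂x_i + ∂v₁^k/∂y_i) dx dy dτ`.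
The integral is iterated, so that it does not depend on the representatives of the classes. -/
def aHat {N : ℕ} {Ω : Set (Euc N)} (a : Fin N → Fin N → Euc N → ℝ)
    (u₀ : V Ω) (u₁ : Euc N → L2perZ N) (v₀ : V Ω) (v₁ : Euc N → L2perZ N) : ℝ :=
  ∑ i, ∑ j, ∑ k, ∫ x in Ω, ∫ τ in Z, ∫ y in Y N,
    a i j y * (u₀.grad k x j + (u₁ x τ).grad k y j)
      * (v₀.grad k x i + (v₁ x τ).grad k y i)

/-- The duality pairing `∑_k ⟨f^k, v^k⟩` of `H⁻¹(Ω)^N` with `V ⊆ H¹₀(Ω)^N`. -/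
def pairing {N : ℕ} {Ω : Set (Euc N)} (f : HNeg1N Ω) (v : V Ω) : ℝ :=
  ∑ k, f k (v.comp k)

/-- `u = (u₀,u₁) ∈ 𝔽₀¹` solves the two-scale variational problem: `u₀ ∈ 𝒲(0,T)`, that is,
`u₀` has a distributional derivative `u₀' ∈ L²(0,T; V')`; `u₀(0) = 0`; and for all
`v = (v₀,v₁) ∈ 𝔽₀¹`
`∫₀ᵀ (u₀',v₀) dt + ∫₀ᵀ â_Ω(u(t),v(t)) dt + ∫₀ᵀ b(u₀,u₀,v₀) dt = ∫₀ᵀ (f,v₀) dt`. -/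
def IsSolution {N : ℕ} {Ω : Set (Euc N)} {T : ℝ} (a : Fin N → Fin N → Euc N → ℝ)
    (f : Lp (HNeg1N Ω) 2 (timeMeas T)) (u : F01 Ω T) : Prop :=
  ∃ u₀' : Lp (StrongDual ℝ (V Ω)) 2 (timeMeas T),
    IsTimeDeriv u.1 u₀' ∧ InitZero u.1 ∧
    ∀ v : F01 Ω T,
      (∫ t in Ioo 0 T, u₀' t (v.1 t))
        + (∫ t in Ioo 0 T,
            aHat a (u.1 t) (fun x => u.2 (x, t)) (v.1 t) (fun x => v.2 (x, t)))
        + (∫ t in Ioo 0 T, b (u.1 t) (u.1 t) (v.1 t))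
      = ∫ t in Ioo 0 T, pairing (f t) (v.1 t)

end TwoScale

end

namespace TwoScale

/-! Let z = (z₀, z₁) be the difference of two solutions u and w. Testing both equations with z cut
off to ]0,s[ and subtracting gives ∫₀ˢ (z₀',z₀) + ∫₀ˢ â_Ω(z,z) + ∫₀ˢ b(z₀,u₀,z₀) = 0. The convective
terms combine in this way because b(w₀,z₀,z₀) = 0 for divergence-free w₀ (`b_antisymm`, `b_sub_b`).

The first term is |z₀(s)|²/2 by the energy identity `norm_sq_eq_integral_of_weak_deriv`. The second
is coercive: the gradient of a periodic function has mean zero on Y, so ∇z₀, which is constant in y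
and τ, is orthogonal to ∇_y z₁, and ellipticity gives â_Ω(z,z) ≥ α(|Y×Z| ‖∇z₀‖² + ‖∇_y z₁‖²)
(`twoScaleForm_coercive`). For the third, Ladyzhenskaya's inequality ‖φ‖₄² ≤ C ‖φ‖₂ ‖∇φ‖₂, proper to
the plane, yields |b(z₀,u₀,z₀)| ≤ K |z₀| ‖∇z₀‖ ‖∇u₀‖ (`exists_abs_b_le`). Young's inequality absorbs
‖∇z₀‖ into the coercive term and leaves |z₀(s)|² ≤ ∫₀ˢ k |z₀|², where k is a multiple of ‖∇u₀‖² and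
hence integrable on ]0,T[. Grönwall's lemma (`eq_zero_of_le_setIntegral_mul`) gives z₀ = 0.

The balance then reduces to ∫₀ˢ â_Ω(z,z) = 0, so ∇_y z₁ = 0, and a periodic function with mean zero
and vanishing gradient is zero.

The iterated integral `aHat` is controlled through the bounded bilinear form `twoScaleForm`. The two
agree for almost every t once u₁ is read as a function of t with values in L²(Ω; L²_per(Z; V_Y))
(`exists_curry_memLp`). -/

open Filter Topology
open scoped Convolution

/-! ### Mollified indicators and weak derivatives in time -/

/-- Smooth bumps around the origin, shrinking to it. -/
noncomputable def shrinkingBump {G : Type*} [NormedAddCommGroup G] (n : ℕ) :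
    ContDiffBump (0 : G) where
  rIn := 1 / ((n : ℝ) + 1)
  rOut := 2 / ((n : ℝ) + 1)
  rIn_pos := by positivity
  rIn_lt_rOut := by gcongr; norm_num

lemma tendsto_shrinkingBump_rOut {G : Type*} [NormedAddCommGroup G] :
    Tendsto (fun n => (shrinkingBump (G := G) n).rOut) atTop (𝓝 0) := by
  have h := (tendsto_one_div_add_atTop_nhds_zero_nat (𝕜 := ℝ)).const_mul 2
  simpa [shrinkingBump, div_eq_mul_inv] using h

lemma integral_bump_sub_mul_tendsto {y : ℝ → ℝ} (hy : Continuous y) (s : ℝ) :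
    Tendsto (fun n => ∫ r, y r * (shrinkingBump (G := ℝ) n).normed volume (r - s)) atTop
      (𝓝 (y s)) := by
  have h := ContDiffBump.convolution_tendsto_right_of_continuous
    (μ := volume) (tendsto_shrinkingBump_rOut (G := ℝ)) hy s
  refine h.congr fun n => ?_
  rw [convolution_eq_swap]
  refine integral_congr_ae (.of_forall fun r => ?_)
  simp only [ContinuousLinearMap.lsmul_apply, smul_eq_mul]
  rw [mul_comm, ← ContDiffBump.normed_neg, neg_sub]

/-- The smooth plateau `r ↦ ∫_{r-t}^{r-s} ρ`, a mollified indicator of `]s,t[`. -/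
noncomputable def plateau (ρ : ContDiffBump (0 : ℝ)) (s t r : ℝ) : ℝ :=
  ∫ x in (r - t)..(r - s), ρ.normed volume x

/-- The derivative is a bump at s minus a bump at t, so testing a weak derivative with the plateau
samples the function at the two endpoints. -/
lemma hasDerivAt_plateau (ρ : ContDiffBump (0 : ℝ)) (s t r : ℝ) :
    HasDerivAt (plateau ρ s t) (ρ.normed volume (r - s) - ρ.normed volume (r - t)) r := by
  have hc : Continuous (ρ.normed volume) := ρ.continuous_normed
  have e : plateau ρ s t = fun r => (∫ x in (0 : ℝ)..(r - s), ρ.normed volume x)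
      - ∫ x in (0 : ℝ)..(r - t), ρ.normed volume x := by
    funext r
    rw [plateau, intervalIntegral.integral_interval_sub_left] <;>
      exact hc.intervalIntegrable _ _
  have d : ∀ z, HasDerivAt (fun w => ∫ x in (0 : ℝ)..w, ρ.normed volume x)
      (ρ.normed volume z) z := fun z =>
    intervalIntegral.integral_hasDerivAt_right (hc.intervalIntegrable _ _)
      hc.aestronglyMeasurable.stronglyMeasurableAtFilter hc.continuousAt
  rw [e]
  exact ((d (r - s)).comp_sub_const r s).sub ((d (r - t)).comp_sub_const r t)

lemma contDiff_plateau (ρ : ContDiffBump (0 : ℝ)) (s t : ℝ) :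
    ContDiff ℝ ∞ (plateau ρ s t) := by
  rw [contDiff_infty_iff_deriv]
  refine ⟨fun r => (hasDerivAt_plateau ρ s t r).differentiableAt, ?_⟩
  rw [funext fun r => (hasDerivAt_plateau ρ s t r).deriv]
  exact (ρ.contDiff_normed.comp (contDiff_id.sub contDiff_const)).sub
    (ρ.contDiff_normed.comp (contDiff_id.sub contDiff_const))

lemma normed_eq_zero {G : Type*} [NormedAddCommGroup G] [NormedSpace ℝ G] [MeasurableSpace G]
    [HasContDiffBump G] {μ : Measure G}
    (ρ : ContDiffBump (0 : G)) {x : G} (hx : ρ.rOut ≤ ‖x‖) : ρ.normed μ x = 0 := by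
  rw [ContDiffBump.normed_def, ρ.zero_of_le_dist (by simpa using hx), zero_div]

lemma plateau_eq_zero (ρ : ContDiffBump (0 : ℝ)) {s t r : ℝ} (hst : s ≤ t)
    (h : r + ρ.rOut ≤ s ∨ t + ρ.rOut ≤ r) : plateau ρ s t r = 0 := by
  refine (intervalIntegral.integral_congr (g := fun _ => 0) fun x hx => ?_).trans
    intervalIntegral.integral_zero
  rw [uIcc_of_le (by linarith)] at hx
  refine normed_eq_zero ρ ?_
  rw [Real.norm_eq_abs]
  rcases h with h | h
  · exact le_trans (by linarith [hx.2]) (neg_le_abs x)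
  · exact le_trans (by linarith [hx.1]) (le_abs_self x)

lemma plateau_eq_one (ρ : ContDiffBump (0 : ℝ)) {s t r : ℝ}
    (h1 : s + ρ.rOut ≤ r) (h2 : r + ρ.rOut < t) : plateau ρ s t r = 1 := by
  have hp := ρ.rOut_pos
  rw [plateau, intervalIntegral.integral_of_le (by linarith), ← ρ.integral_normed (μ := volume)]
  refine setIntegral_eq_integral_of_forall_compl_eq_zero fun x hx => ?_
  refine normed_eq_zero ρ ?_
  rw [Real.norm_eq_abs]
  by_cases h : r - t < x
  · have : r - s < x := by
      by_contra h'
      exact hx ⟨h, not_lt.1 h'⟩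
    exact le_trans (by linarith) (le_abs_self x)
  · exact le_trans (by linarith) (neg_le_abs x)

lemma abs_plateau_le (ρ : ContDiffBump (0 : ℝ)) {s t : ℝ} (hst : s ≤ t) (r : ℝ) :
    |plateau ρ s t r| ≤ 1 := by
  rw [plateau, intervalIntegral.integral_of_le (by linarith),
    abs_of_nonneg (setIntegral_nonneg measurableSet_Ioc fun x _ => ρ.nonneg_normed x),
    ← ρ.integral_normed (μ := volume)]
  exact setIntegral_le_integral ρ.integrable_normed (.of_forall ρ.nonneg_normed)

lemma isTestFunction_plateau (ρ : ContDiffBump (0 : ℝ)) {T s t : ℝ} (hst : s ≤ t)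
    (hs : ρ.rOut < s) (ht : t + ρ.rOut < T) :
    IsTestFunction (Ioo 0 T) (plateau ρ s t) := by
  have hsub : tsupport (plateau ρ s t) ⊆ Icc (s - ρ.rOut) (t + ρ.rOut) := by
    refine closure_minimal (fun r hr => ?_) isClosed_Icc
    by_contra h
    refine hr (plateau_eq_zero ρ hst ?_)
    rw [mem_Icc, not_and_or, not_le, not_le] at h
    rcases h with h | h
    · left; linarith
    · right; linarith
  exact ⟨contDiff_plateau ρ s t, isCompact_Icc.of_isClosed_subset (isClosed_tsupport _) hsub,
    hsub.trans fun x hx => ⟨by linarith [hx.1], by linarith [hx.2]⟩⟩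

/-- A continuous function with an integrable distributional derivative is its primitive. -/
lemma sub_eq_integral_of_weak_deriv {T : ℝ} {y h : ℝ → ℝ}
    (hy : ContinuousOn y (Icc 0 T)) (hh : IntegrableOn h (Ioo 0 T))
    (hw : ∀ φ, IsTestFunction (Ioo 0 T) φ →
      ∫ t in Ioo 0 T, y t * deriv φ t = - ∫ t in Ioo 0 T, h t * φ t)
    {s t : ℝ} (hs : 0 < s) (hst : s ≤ t) (ht : t < T) :
    y t - y s = ∫ r in s..t, h r := by
  have hT : 0 ≤ T := by linarith
  -- The extension is constant on either side of [0,T], hence continuous on ℝ, as convolution with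
  -- the bumps requires.
  set Y := IccExtend hT ((Icc 0 T).domRestrict y) with hY
  have cY : Continuous Y := continuous_IccExtend_iff.2 hy.domRestrict
  have eY : ∀ r ∈ Icc 0 T, Y r = y r := fun r hr => by
    rw [hY, IccExtend_of_mem hT _ hr]; rfl
  let ρ : ℕ → ContDiffBump (0 : ℝ) := shrinkingBump
  have hρ : Tendsto (fun n => (ρ n).rOut) atTop (𝓝 0) := tendsto_shrinkingBump_rOut
  have small : ∀ δ > 0, ∀ᶠ n in atTop, (ρ n).rOut < δ := fun δ hδ => hρ.eventually_lt_const hδ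
  have A : Tendsto (fun n => ∫ r, Y r * ((ρ n).normed volume (r - s))) atTop (𝓝 (Y s)) :=
    integral_bump_sub_mul_tendsto cY s
  have B : Tendsto (fun n => ∫ r, Y r * ((ρ n).normed volume (r - t))) atTop (𝓝 (Y t)) :=
    integral_bump_sub_mul_tendsto cY t
  have C : Tendsto (fun n => ∫ r in Ioo 0 T, h r * plateau (ρ n) s t r) atTop
      (𝓝 (∫ r in Ioo 0 T, (Ioo s t).indicator h r)) := by
    refine tendsto_integral_of_dominated_convergence (fun r => ‖h r‖) (fun n => ?_) hh.norm
      (fun n => .of_forall fun r => ?_) ?_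
    · exact hh.aestronglyMeasurable.mul (contDiff_plateau _ _ _).continuous.aestronglyMeasurable
    · rw [norm_mul]
      exact mul_le_of_le_one_right (norm_nonneg _) (abs_plateau_le _ hst r)
    -- At r = s and r = t the plateaus need not converge to the indicator; these two points are
    -- negligible.
    · have h0 : ∀ᵐ r ∂volume.restrict (Ioo 0 T), r ≠ s ∧ r ≠ t :=
        ae_restrict_of_ae ((Measure.ae_ne volume s).and (Measure.ae_ne volume t))
      filter_upwards [h0] with r hr
      refine tendsto_const_nhds.congr' ?_
      by_cases hm : r ∈ Ioo s t
      · filter_upwards [small (r - s) (by linarith [hm.1]), small (t - r) (by linarith [hm.2])]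
          with n h1 h2
        rw [indicator_of_mem hm, plateau_eq_one _ (by linarith) (by linarith), mul_one]
      · rw [indicator_of_notMem hm]
        rcases lt_or_gt_of_ne hr.1 with h1 | h1
        · filter_upwards [small (s - r) (by linarith)] with n h2
          rw [plateau_eq_zero _ hst (Or.inl (by linarith)), mul_zero]
        · have h3 : t < r := lt_of_le_of_ne (by
            by_contra h4
            exact hm ⟨h1, not_le.1 h4⟩) (Ne.symm hr.2)
          filter_upwards [small (r - t) (by linarith)] with n h2
          rw [plateau_eq_zero _ hst (Or.inr (by linarith)), mul_zero]
  -- The plateau is an admissible test function once the bump radius is below both s and T - t. Its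
  -- derivative vanishes off ]0,T[, so replacing y by its extension and integrating over ℝ changes
  -- nothing.
  have D : ∀ᶠ n in atTop, (∫ r, Y r * ((ρ n).normed volume (r - s)))
      - (∫ r, Y r * ((ρ n).normed volume (r - t)))
      = - ∫ r in Ioo 0 T, h r * plateau (ρ n) s t r := by
    filter_upwards [small s hs, small (T - t) (by linarith)] with n h1 h2
    have i : ∀ c : ℝ, Integrable fun r => Y r * ((ρ n).normed volume (r - c)) := fun c => by
      refine Continuous.integrable_of_hasCompactSupport
        (cY.mul ((ρ n).continuous_normed.comp (continuous_id.sub continuous_const))) ?_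
      refine HasCompactSupport.mul_left ?_
      exact (ρ n).hasCompactSupport_normed.comp_homeomorph (Homeomorph.subRight c)
    have ht := isTestFunction_plateau (ρ n) hst h1 (by linarith : t + (ρ n).rOut < T)
    rw [← hw _ ht, ← integral_sub (i s) (i t)]
    have ed : ∀ r, deriv (plateau (ρ n) s t) r
        = (ρ n).normed volume (r - s) - (ρ n).normed volume (r - t) :=
      fun r => (hasDerivAt_plateau _ s t r).deriv
    rw [← setIntegral_eq_integral_of_forall_compl_eq_zero (s := Ioo 0 T)]
    · refine setIntegral_congr_fun measurableSet_Ioo fun r hr => ?_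
      rw [ed, eY r ⟨hr.1.le, hr.2.le⟩]
      ring
    · intro r hr
      rw [← mul_sub, ← ed, show deriv (plateau (ρ n) s t) r = 0 from ?_, mul_zero]
      by_contra h3
      exact hr (ht.2.2 (support_deriv_subset h3))
  have E := tendsto_nhds_unique ((A.sub B).congr' D) C.neg
  rw [eY s ⟨hs.le, by linarith⟩, eY t ⟨by linarith, ht.le⟩,
    setIntegral_indicator measurableSet_Ioo,
    inter_eq_self_of_subset_right (Ioo_subset_Ioo hs.le ht.le), ← integral_Ioc_eq_integral_Ioo,
    ← intervalIntegral.integral_of_le hst] at E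
  linarith

/-! ### The energy identity for functions with a derivative in the dual space -/

section Energy

variable {E H : Type*} [NormedAddCommGroup E] [NormedSpace ℝ E]
  [NormedAddCommGroup H] [InnerProductSpace ℝ H]

/-- Translations act continuously on L² and the pairing L² × L² → L¹ is continuous. The two shifts
are independent because the energy identity moves G and U by different amounts. -/
lemma continuous_setIntegral_translate (G : Lp (StrongDual ℝ E) 2 (volume : Measure ℝ))
    (U : Lp E 2 (volume : Measure ℝ)) (S : Set ℝ) :
    Continuous fun c : ℝ × ℝ => ∫ t in S, G (c.1 + t) (U (c.2 + t)) := by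
  have : Fact ((2 : ENNReal) ≠ ⊤) := ⟨by norm_num⟩
  let B : StrongDual ℝ E →L[ℝ] E →L[ℝ] ℝ := .id ℝ (StrongDual ℝ E)
  let Pr := B.lpPairing (volume.restrict S) 2 2
  have key : ∀ c : ℝ × ℝ, ∫ t in S, G (c.1 + t) (U (c.2 + t))
      = Pr (LpToLpRestrictCLM ℝ (StrongDual ℝ E) ℝ volume 2 S (DomAddAct.mk c.1 +ᵥ G))
          (LpToLpRestrictCLM ℝ E ℝ volume 2 S (DomAddAct.mk c.2 +ᵥ U)) := by
    intro c
    rw [ContinuousLinearMap.lpPairing_eq_integral]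
    refine integral_congr_ae ?_
    filter_upwards [LpToLpRestrictCLM_coeFn ℝ S (DomAddAct.mk c.1 +ᵥ G),
      LpToLpRestrictCLM_coeFn ℝ S (DomAddAct.mk c.2 +ᵥ U),
      ae_restrict_of_ae (DomAddAct.vadd_Lp_ae_eq (DomAddAct.mk c.1) G),
      ae_restrict_of_ae (DomAddAct.vadd_Lp_ae_eq (DomAddAct.mk c.2) U)] with t h1 h2 h3 h4
    rw [h1, h2, h3, h4]
    rfl
  simp_rw [key]
  have c1 : Continuous fun c : ℝ × ℝ => DomAddAct.mk c.1 +ᵥ G :=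
    (DomAddAct.continuous_mk.comp continuous_fst).vadd continuous_const
  have c2 : Continuous fun c : ℝ × ℝ => DomAddAct.mk c.2 +ᵥ U :=
    (DomAddAct.continuous_mk.comp continuous_snd).vadd continuous_const
  exact (Pr.continuous.comp ((ContinuousLinearMap.continuous _).comp c1)).clm_apply
    ((ContinuousLinearMap.continuous _).comp c2)

lemma integrable_apply_translate (G : Lp (StrongDual ℝ E) 2 (volume : Measure ℝ))
    (U : Lp E 2 (volume : Measure ℝ)) (c d : ℝ) :
    Integrable fun t => G (c + t) (U (d + t)) := by
  let B : StrongDual ℝ E →L[ℝ] E →L[ℝ] ℝ := .id ℝ (StrongDual ℝ E)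
  exact memLp_one_iff_integrable.1 <| B.memLp_of_bilin 1
    ((Lp.memLp G).comp_measurePreserving (measurePreserving_add_left volume c))
    ((Lp.memLp U).comp_measurePreserving (measurePreserving_add_left volume d))

/-- Joint integrability in (t, θ) licenses Fubini below. The bound by ‖G‖² + ‖U‖² is uniform in θ
since the integral over ℝ is translation invariant, and R has finite measure. -/
lemma integrable_prod_apply_translate (G : Lp (StrongDual ℝ E) 2 (volume : Measure ℝ))
    (U : Lp E 2 (volume : Measure ℝ)) (S R : Set ℝ) (hR : volume R ≠ ⊤) (h d : ℝ) :
    Integrable (fun p : ℝ × ℝ => G (h * p.2 + p.1) (U (d + p.1)))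
      ((volume.restrict S).prod (volume.restrict R)) := by
  let B : StrongDual ℝ E →L[ℝ] E →L[ℝ] ℝ := .id ℝ (StrongDual ℝ E)
  have : IsFiniteMeasure (volume.restrict R) := ⟨by
    rw [Measure.restrict_apply_univ]; exact hR.lt_top⟩
  have m1 : StronglyMeasurable fun p : ℝ × ℝ => G (h * p.2 + p.1) :=
    (Lp.stronglyMeasurable G).comp_measurable (by fun_prop)
  have m2 : StronglyMeasurable fun p : ℝ × ℝ => U (d + p.1) :=
    (Lp.stronglyMeasurable U).comp_measurable (by fun_prop)
  have m : AEStronglyMeasurable (fun p : ℝ × ℝ => G (h * p.2 + p.1) (U (d + p.1)))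
      ((volume.restrict S).prod (volume.restrict R)) :=
    B.aestronglyMeasurable_comp₂ m1.aestronglyMeasurable m2.aestronglyMeasurable
  have iG : Integrable fun t => ‖G t‖ ^ 2 := (Lp.memLp G).integrable_norm_pow (by norm_num)
  have iU : Integrable fun t => ‖U t‖ ^ 2 := (Lp.memLp U).integrable_norm_pow (by norm_num)
  rw [integrable_prod_iff' m]
  refine ⟨.of_forall fun θ => (integrable_apply_translate G U (h * θ) d).integrableOn, ?_⟩
  refine Integrable.of_bound (C := (∫ t, ‖G t‖ ^ 2) + ∫ t, ‖U t‖ ^ 2)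
    m.norm.prod_swap.integral_prod_right' (.of_forall fun θ => ?_)
  rw [Real.norm_of_nonneg (integral_nonneg fun t => norm_nonneg _)]
  have iG' : Integrable fun t => ‖G (h * θ + t)‖ ^ 2 := iG.comp_add_left _
  have iU' : Integrable fun t => ‖U (d + t)‖ ^ 2 := iU.comp_add_left _
  calc ∫ t in S, ‖G (h * θ + t) (U (d + t))‖
      ≤ ∫ t, ‖G (h * θ + t) (U (d + t))‖ :=
        setIntegral_le_integral (integrable_apply_translate G U _ _).norm
          (.of_forall fun _ => norm_nonneg _)
    _ ≤ ∫ t, (‖G (h * θ + t)‖ ^ 2 + ‖U (d + t)‖ ^ 2) := by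
        refine integral_mono (integrable_apply_translate G U _ _).norm (iG'.add iU') fun t => ?_
        have := (G (h * θ + t)).le_opNorm (U (d + t))
        simp only
        nlinarith [sq_nonneg (‖G (h * θ + t)‖ - ‖U (d + t)‖), norm_nonneg (G (h * θ + t)),
          norm_nonneg (U (d + t))]
    _ = _ := by
        rw [integral_add iG' iU', integral_add_left_eq_self (fun t => ‖G t‖ ^ 2),
          integral_add_left_eq_self (fun t => ‖U t‖ ^ 2)]

/-- The averaged difference quotient equals the slope of a primitive of y at b minus its slope at a.
-/
lemma tendsto_steklov_sub {y : ℝ → ℝ} (hy : Continuous y) (a b : ℝ) :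
    Tendsto (fun h : ℝ => h⁻¹ * ∫ t in a..b, (y (h + t) - y t)) (𝓝[>] 0) (𝓝 (y b - y a)) := by
  have d : ∀ z, HasDerivAt (fun w => ∫ x in (0 : ℝ)..w, y x) (y z) z := fun z =>
    intervalIntegral.integral_hasDerivAt_right (hy.intervalIntegrable _ _)
      hy.aestronglyMeasurable.stronglyMeasurableAtFilter hy.continuousAt
  refine ((d b).tendsto_slope_zero_right.sub (d a).tendsto_slope_zero_right).congr fun h => ?_
  have i := fun p q => hy.intervalIntegrable (μ := volume) p q
  have i1 := fun p q => (show Continuous fun t => y (h + t) by fun_prop).intervalIntegrable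
    (μ := volume) p q
  have e1 : ∫ t in a..b, y (h + t) = ∫ t in (h + a)..(h + b), y t :=
    intervalIntegral.integral_comp_add_left _ _
  rw [intervalIntegral.integral_sub (i1 _ _) (i _ _), e1,
    ← intervalIntegral.integral_interval_sub_left (i 0 (h + b)) (i 0 (h + a)),
    ← intervalIntegral.integral_interval_sub_left (i 0 b) (i 0 a), add_comm h, add_comm h]
  simp only [smul_eq_mul]
  ring

/-- The identity ‖w(t+h)‖² - ‖w(t)‖² = ⟨w(t+h) - w(t), w(t+h) + w(t)⟩ turns the increment into an
integral of G over [t,t+h] applied to U(t+h) + U(t). Averaging over t in [a,b], dividing by h and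
letting h decrease to 0, continuity of translations in L² gives the result without regularising u.
-/
lemma norm_sq_sub_eq_integral (ι : E →L[ℝ] H) {T : ℝ}
    (U : Lp E 2 (volume : Measure ℝ)) (G : Lp (StrongDual ℝ E) 2 (volume : Measure ℝ))
    {w : ℝ → H} (hw : ContinuousOn w (Icc 0 T))
    (hwU : ∀ᵐ t ∂volume.restrict (Ioo 0 T), w t = ι (U t))
    (hinc : ∀ s t, 0 < s → s ≤ t → t < T → ∀ v, inner ℝ (w t - w s) (ι v) = ∫ r in s..t, G r v)
    {a b : ℝ} (ha : 0 < a) (hab : a ≤ b) (hb : b < T) :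
    ‖w b‖ ^ 2 - ‖w a‖ ^ 2 = 2 * ∫ t in a..b, G t (U t) := by
  have hT : 0 ≤ T := by linarith
  set W := IccExtend hT ((Icc 0 T).domRestrict w) with hW
  have cW : Continuous W := continuous_IccExtend_iff.2 hw.domRestrict
  have eW : ∀ r ∈ Icc 0 T, W r = w r := fun r hr => by
    rw [hW, IccExtend_of_mem hT _ hr]; rfl
  have L := tendsto_steklov_sub (y := fun t => ‖W t‖ ^ 2) (cW.norm.pow 2) a b
  simp only [eW b ⟨by linarith, hb.le⟩, eW a ⟨ha.le, by linarith⟩] at L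
  set Ψ : ℝ × ℝ → ℝ := fun c => ∫ t in Ioc a b, G (c.1 + t) (U (c.2 + t)) with hΨ
  have cΨ : Continuous Ψ := continuous_setIntegral_translate G U (Ioc a b)
  -- At h = 0 both values of Ψ are the unshifted integral, whence the factor 2.
  have R : Tendsto (fun h : ℝ => ∫ θ in (0 : ℝ)..1, (Ψ (h * θ, h) + Ψ (h * θ, 0))) (𝓝[>] 0)
      (𝓝 (2 * ∫ t in a..b, G t (U t))) := by
    have c : Continuous fun h : ℝ => ∫ θ in (0 : ℝ)..1, (Ψ (h * θ, h) + Ψ (h * θ, 0)) := by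
      apply intervalIntegral.continuous_parametric_intervalIntegral_of_continuous'
      exact (cΨ.comp (by fun_prop)).add (cΨ.comp (by fun_prop))
    refine ((c.tendsto 0).mono_left nhdsWithin_le_nhds).trans_eq ?_
    congr 1
    simp only [hΨ, zero_mul, zero_add, intervalIntegral.integral_const,
      intervalIntegral.integral_of_le hab]
    simp only [sub_zero, smul_eq_mul]
    ring
  refine tendsto_nhds_unique L (R.congr' ?_)
  have hsmall : ∀ᶠ h : ℝ in 𝓝[>] 0, h < T - b :=
    nhdsWithin_le_nhds (eventually_lt_nhds (by linarith))
  filter_upwards [self_mem_nhdsWithin, hsmall] with h h0 h1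
  have h0 : 0 < h := h0
  have ae0 : ∀ᵐ t : ℝ, t ∈ Ioo 0 T → w t = ι (U t) := (ae_restrict_iff' measurableSet_Ioo).1 hwU
  have ae1 : ∀ᵐ t : ℝ, h + t ∈ Ioo 0 T → w (h + t) = ι (U (h + t)) :=
    (measurePreserving_add_left volume h).quasiMeasurePreserving.ae ae0
  have pt : ∀ᵐ t ∂volume.restrict (Ioc a b), ‖W (h + t)‖ ^ 2 - ‖W t‖ ^ 2
      = h * ∫ θ in Ioc (0 : ℝ) 1, (G (h * θ + t) (U (h + t)) + G (h * θ + t) (U (0 + t))) := by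
    filter_upwards [ae_restrict_of_ae ae0, ae_restrict_of_ae ae1,
      ae_restrict_mem measurableSet_Ioc] with t e0 e1 ht
    have m0 : t ∈ Ioo 0 T := ⟨by linarith [ht.1], by linarith [ht.2]⟩
    have m1 : h + t ∈ Ioo 0 T := ⟨by linarith [ht.1], by linarith [ht.2]⟩
    rw [eW _ ⟨m0.1.le, m0.2.le⟩, eW _ ⟨m1.1.le, m1.2.le⟩]
    have q := hinc t (h + t) m0.1 (by linarith) m1.2 (U (h + t) + U t)
    rw [map_add, ← e0 m0, ← e1 m1, inner_sub_left, inner_add_right, inner_add_right,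
      real_inner_self_eq_norm_sq, real_inner_self_eq_norm_sq, real_inner_comm] at q
    rw [← intervalIntegral.integral_of_le zero_le_one]
    simp_rw [zero_add, ← map_add]
    -- The substitution r = hθ + t replaces the moving interval by ]0,1[, on which the order of
    -- integration can be exchanged.
    have := intervalIntegral.smul_integral_comp_mul_add (a := 0) (b := 1)
      (fun r => G r (U (h + t) + U t)) h t
    rw [smul_eq_mul] at this
    rw [this, mul_zero, mul_one, zero_add, ← q]
    ring
  rw [intervalIntegral.integral_of_le hab, integral_congr_ae pt, integral_const_mul,
    inv_mul_cancel_left₀ h0.ne', intervalIntegral.integral_of_le zero_le_one]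
  have fin : volume (Ioc (0 : ℝ) 1) ≠ ⊤ := by simp
  have I1 := integrable_prod_apply_translate G U (Ioc a b) (Ioc 0 1) fin h h
  have I2 := integrable_prod_apply_translate G U (Ioc a b) (Ioc 0 1) fin h 0
  rw [integral_integral_swap (I1.add I2)]
  refine integral_congr_ae (.of_forall fun θ => ?_)
  simp only [hΨ]
  rw [integral_add (integrable_apply_translate G U _ _).integrableOn
    (integrable_apply_translate G U _ _).integrableOn]

/-- Extension by zero; it provides functions on all of ℝ, where translations act. -/
lemma exists_Lp_ae_eq_on {α F : Type*} [MeasurableSpace α] {μ : Measure α}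
    [NormedAddCommGroup F] {f : α → F} {S : Set α} (hS : MeasurableSet S) {p : ENNReal}
    (hf : MemLp f p (μ.restrict S)) : ∃ F : Lp F p μ, ∀ᵐ t ∂μ.restrict S, F t = f t := by
  have hf' := (memLp_indicator_iff_restrict hS).2 hf
  refine ⟨hf'.toLp _, ?_⟩
  filter_upwards [ae_restrict_of_ae hf'.coeFn_toLp, ae_restrict_mem hS] with t h1 h2
  rw [h1, indicator_of_mem h2]

/-- The energy identity `|w(s)|² = 2 ∫₀ˢ ⟨u', u⟩` for a function with `u ∈ L²(0,T;E)`,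
`u' ∈ L²(0,T;E')`, whose continuous representative `w` in the pivot space vanishes at `0`. -/
theorem norm_sq_eq_integral_of_weak_deriv (ι : E →L[ℝ] H) {T : ℝ}
    {u : ℝ → E} {g : ℝ → StrongDual ℝ E} (hu : MemLp u 2 (volume.restrict (Ioo 0 T)))
    (hg : MemLp g 2 (volume.restrict (Ioo 0 T)))
    {w : ℝ → H} (hw : ContinuousOn w (Icc 0 T))
    (hwu : ∀ᵐ t ∂volume.restrict (Ioo 0 T), w t = ι (u t)) (hw0 : w 0 = 0)
    (hd : ∀ φ : ℝ → ℝ, IsTestFunction (Ioo 0 T) φ → ∀ v : E,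
      ∫ t in Ioo 0 T, inner ℝ (ι (u t)) (ι v) * deriv φ t = - ∫ t in Ioo 0 T, g t v * φ t)
    {s : ℝ} (hs : s ∈ Ioo 0 T) :
    ‖w s‖ ^ 2 = 2 * ∫ t in Ioo 0 s, g t (u t) := by
  obtain ⟨U, eU⟩ := exists_Lp_ae_eq_on measurableSet_Ioo hu
  obtain ⟨G, eG⟩ := exists_Lp_ae_eq_on measurableSet_Ioo hg
  have hinc : ∀ s t, 0 < s → s ≤ t → t < T → ∀ v,
      inner ℝ (w t - w s) (ι v) = ∫ r in s..t, G r v := by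
    intro s t hs hst ht v
    have fin : IsFiniteMeasure (volume.restrict (Ioo 0 T)) := by infer_instance
    have ig : IntegrableOn (fun t => g t v) (Ioo 0 T) :=
      (ContinuousLinearMap.apply ℝ ℝ v).integrable_comp (hg.integrable (by norm_num))
    -- For a fixed v the vector-valued derivative becomes a scalar weak derivative of a continuous
    -- function.
    have := sub_eq_integral_of_weak_deriv (y := fun t => inner ℝ (w t) (ι v))
      (hw.inner continuousOn_const) ig (fun φ hφ => ?_) hs hst ht
    · rw [inner_sub_left, this]
      have h3 := (ae_restrict_iff' measurableSet_Ioo).1 eG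
      refine intervalIntegral.integral_congr_ae ?_
      filter_upwards [h3] with r hr hm
      rw [uIoc_of_le hst] at hm
      rw [hr ⟨by linarith [hm.1], by linarith [hm.2]⟩]
    · rw [← hd φ hφ v]
      refine integral_congr_ae ?_
      filter_upwards [hwu] with t ht
      rw [ht]
  have key : ∀ a ∈ Ioo 0 s, ‖w s‖ ^ 2 - ‖w a‖ ^ 2 = 2 * ∫ t in a..s, G t (U t) := fun a ha =>
    norm_sq_sub_eq_integral ι U G hw (by
      filter_upwards [hwu, eU] with t h1 h2
      rw [h1, h2]) hinc ha.1 ha.2.le hs.2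
  have iGU : Integrable fun t => G t (U t) := by
    simpa using integrable_apply_translate G U 0 0
  -- The identity on [a,s] requires a > 0; the continuity of w at 0 and of the primitive of G(U)
  -- allows a to tend to 0 within ]0,s[.
  have t1 : Tendsto (fun a => ‖w s‖ ^ 2 - ‖w a‖ ^ 2) (𝓝[Ioo 0 s] 0) (𝓝 (‖w s‖ ^ 2 - ‖w 0‖ ^ 2)) := by
    refine tendsto_const_nhds.sub (Tendsto.pow (Tendsto.norm ?_) 2)
    exact (hw 0 ⟨le_rfl, hs.1.le.trans hs.2.le⟩).mono
      (Ioo_subset_Icc_self.trans (Icc_subset_Icc_right hs.2.le))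
  have t2 : Tendsto (fun a => 2 * ∫ t in a..s, G t (U t)) (𝓝[Ioo 0 s] 0)
      (𝓝 (2 * ∫ t in (0 : ℝ)..s, G t (U t))) := by
    have c := intervalIntegral.continuous_primitive (fun a b => iGU.intervalIntegrable) s
    refine Tendsto.const_mul 2 ?_
    simp_rw [intervalIntegral.integral_symm s]
    exact ((c.tendsto 0).mono_left nhdsWithin_le_nhds).neg
  have : (𝓝[Ioo 0 s] (0 : ℝ)).NeBot := left_nhdsWithin_Ioo_neBot hs.1
  have := tendsto_nhds_unique (t1.congr' (eventually_nhdsWithin_of_forall key)) t2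
  rw [hw0, norm_zero, zero_pow two_ne_zero, sub_zero] at this
  rw [this, intervalIntegral.integral_of_le hs.1.le, integral_Ioc_eq_integral_Ioo]
  congr 1
  have hsub : Ioo 0 s ⊆ Ioo 0 T := Ioo_subset_Ioo_right hs.2.le
  refine integral_congr_ae ?_
  filter_upwards [ae_restrict_of_ae_restrict_of_subset hsub eU,
    ae_restrict_of_ae_restrict_of_subset hsub eG] with t h1 h2
  rw [h1, h2]

end Energy

/-! ### From functions on a product to vector-valued functions -/

section Curry

/-- Balls form a basis, so in a second countable space they generate the Borel σ-algebra. For maps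
into L² this reduces measurability to that of distances, which are parameter integrals. -/
lemma stronglyMeasurable_of_measurable_edist {β M : Type*} [MeasurableSpace β]
    [PseudoMetricSpace M] [SecondCountableTopology M] {f : β → M}
    (h : ∀ c, Measurable fun t => edist (f t) c) : StronglyMeasurable f := by
  let _ : MeasurableSpace M := borel M
  have : BorelSpace M := ⟨rfl⟩
  have hB : TopologicalSpace.IsTopologicalBasis {s : Set M | ∃ x r, s = Metric.eball x r} := by
    refine TopologicalSpace.isTopologicalBasis_of_isOpen_of_nhds ?_ ?_
    · rintro _ ⟨x, r, rfl⟩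
      exact Metric.isOpen_eball
    · intro a u ha hu
      obtain ⟨ε, hε, hs⟩ := EMetric.isOpen_iff.1 hu a ha
      exact ⟨_, ⟨a, ε, rfl⟩, Metric.mem_eball_self hε, hs⟩
  have hm : @Measurable β M _ (borel M) f := by
    rw [hB.borel_eq_generateFrom]
    refine measurable_generateFrom ?_
    rintro _ ⟨x, r, rfl⟩
    exact measurableSet_lt (h x) measurable_const
  exact hm.stronglyMeasurable

variable {α β X : Type*} [MeasurableSpace α] [MeasurableSpace β] [NormedAddCommGroup X]
  {μ : Measure α} {ν : Measure β} [SFinite μ] [SFinite ν]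

/-- Square integrable functions of two variables are square integrable functions of the second
variable with values in the square integrable functions of the first. -/
lemma exists_curry_memLp [SecondCountableTopology (Lp X 2 μ)] (F : Lp X 2 (μ.prod ν)) :
    ∃ C : β → Lp X 2 μ, MemLp C 2 ν ∧ ∀ᵐ t ∂ν, ∀ᵐ x ∂μ, C t x = F (x, t) := by
  classical
  have hF := Lp.stronglyMeasurable F
  have hFt : ∀ t, StronglyMeasurable fun x => F (x, t) := fun t =>
    hF.comp_measurable (measurable_id.prodMk measurable_const)
  have hn : ∀ f : α → X, eLpNorm f 2 μ = (∫⁻ x, ‖f x‖ₑ ^ (2 : ℝ) ∂μ) ^ (1 / 2 : ℝ) := fun f => by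
    rw [eLpNorm_eq_lintegral_rpow_enorm_toReal (by norm_num) (by norm_num)]; norm_num
  have hmeas : ∀ c : α → X, StronglyMeasurable c →
      Measurable fun t => eLpNorm (fun x => F (x, t) - c x) 2 μ := fun c hc => by
    simp_rw [hn]
    refine Measurable.pow_const ?_ _
    exact Measurable.lintegral_prod_left'
      (f := fun p : α × β => ‖F (p.1, p.2) - c p.1‖ₑ ^ (2 : ℝ))
      ((hF.sub (hc.comp_measurable measurable_fst)).enorm.pow_const _)
  have hm0 : Measurable fun t => eLpNorm (fun x => F (x, t)) 2 μ := by
    simpa using hmeas 0 stronglyMeasurable_zero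
  -- Only for t in S does the slice define an element of L². By Tonelli the complement is null, and
  -- the curried map is set to 0 there.
  set S := {t | eLpNorm (fun x => F (x, t)) 2 μ < ⊤} with hS
  have mS : MeasurableSet S := hm0 measurableSet_Iio
  have hsq : ∫⁻ t, ∫⁻ x, ‖F (x, t)‖ₑ ^ (2 : ℝ) ∂μ ∂ν < ⊤ := by
    have h := (Lp.memLp F).eLpNorm_lt_top
    rw [eLpNorm_eq_lintegral_rpow_enorm_toReal (by norm_num) (by norm_num),
      ENNReal.rpow_lt_top_iff_of_pos (by norm_num),
      lintegral_prod_symm' _ (hF.enorm.pow_const _)] at h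
    simpa using h
  have aeS : ∀ᵐ t ∂ν, t ∈ S := by
    have h := ae_lt_top (Measurable.lintegral_prod_left'
      (f := fun p : α × β => ‖F p‖ₑ ^ (2 : ℝ)) (hF.enorm.pow_const _)) hsq.ne
    filter_upwards [h] with t ht
    rw [hS, mem_ofPred_eq, hn, ENNReal.rpow_lt_top_iff_of_pos (by norm_num)]
    exact ht
  set C : β → Lp X 2 μ := fun t =>
    if h : t ∈ S then MemLp.toLp (fun x => F (x, t)) ⟨(hFt t).aestronglyMeasurable, h⟩ else 0
    with hC
  have eC : ∀ t ∈ S, ∀ᵐ x ∂μ, C t x = F (x, t) := fun t ht => by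
    simp only [hC, dif_pos ht]
    exact MemLp.coeFn_toLp _
  have mC : StronglyMeasurable C := by
    refine stronglyMeasurable_of_measurable_edist fun c => ?_
    have e : (fun t => edist (C t) c)
        = S.piecewise (fun t => eLpNorm (fun x => F (x, t) - c x) 2 μ) (fun _ => edist 0 c) := by
      funext t
      by_cases ht : t ∈ S
      · rw [piecewise_eq_of_mem _ _ _ ht, Lp.edist_def]
        refine eLpNorm_congr_ae ?_
        filter_upwards [eC t ht] with x hx
        rw [Pi.sub_apply, hx]
      · rw [piecewise_eq_of_notMem _ _ _ ht]
        simp only [hC, dif_neg ht]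
    rw [e]
    exact (hmeas c (Lp.stronglyMeasurable c)).piecewise mS measurable_const
  refine ⟨C, ⟨mC.aestronglyMeasurable, ?_⟩, aeS.mono eC⟩
  rw [eLpNorm_eq_lintegral_rpow_enorm_toReal (by norm_num) (by norm_num),
      ENNReal.rpow_lt_top_iff_of_pos (by norm_num)]
  refine lt_of_eq_of_lt (lintegral_congr_ae ?_) hsq
  filter_upwards [aeS] with t ht
  rw [Lp.enorm_def, eLpNorm_congr_ae (eC t ht), hn, ← ENNReal.rpow_mul]
  norm_num

end Curry

/-! ### Periodic functions and their weak gradients -/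

section Periodic

open scoped Pointwise

variable {N : ℕ}

/-- The lattice vector with integer coordinates `k`. -/
noncomputable def latticeVec (k : Fin N → ℤ) : Euc N := WithLp.toLp 2 (fun i => (k i : ℝ))

lemma latticeVec_add (k m : Fin N → ℤ) : latticeVec (k + m) = latticeVec k + latticeVec m := by
  ext i; simp [latticeVec]

/-- An almost everywhere periodic function coincides almost everywhere with a periodic one. -/
lemma IsPeriodic.exists_ae_eq {β : Type*} [Inhabited β] {F : Euc N → β} (hF : IsPeriodic F) :
    ∃ F' : Euc N → β, F' =ᵐ[volume] F ∧ ∀ k y, F' (y + latticeVec k) = F' y := by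
  classical
  -- The lattice is countable, so all the periodicity conditions hold together almost everywhere, on
  -- a set that is itself invariant under the lattice.
  set A : Set (Euc N) := {y | ∀ k, F (y + latticeVec k) = F y} with hA
  have aeA : ∀ᵐ y : Euc N, y ∈ A := ae_all_iff.2 hF
  have shift : ∀ k y, y ∈ A → y + latticeVec k ∈ A := fun k y hy m => by
    rw [add_assoc, ← latticeVec_add, hy, hy]
  refine ⟨fun y => if y ∈ A then F y else default, ?_, fun k y => ?_⟩
  · filter_upwards [aeA] with y hy
    exact if_pos hy
  · by_cases hy : y ∈ A
    · simp only [if_pos hy, if_pos (shift k y hy), hy k]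
    · have : y + latticeVec k ∉ A := fun h => hy <| by
        have := shift (-k) _ h
        rwa [add_assoc, ← latticeVec_add, add_neg_cancel,
          show latticeVec (0 : Fin N → ℤ) = 0 by ext i; simp [latticeVec], add_zero] at this
      simp only [if_neg hy, if_neg this]

lemma isOpen_cell : IsOpen (Y N) := by
  have : Y N = ⋂ i, {y : Euc N | y i ∈ Ioo (-1 / 2 : ℝ) (1 / 2)} := by ext; simp [Y]
  rw [this]
  exact isOpen_iInter_of_finite fun i =>
    isOpen_Ioo.preimage (EuclideanSpace.proj (𝕜 := ℝ) i).continuous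

lemma measurableSet_cell : MeasurableSet (Y N) := isOpen_cell.measurableSet

lemma norm_le_of_mem_cell {y : Euc N} (hy : y ∈ Y N) : ‖y‖ ≤ N := by
  calc ‖y‖ ≤ ∑ i, ‖EuclideanSpace.single i (y i)‖ := by
        conv_lhs => rw [← (EuclideanSpace.basisFun (Fin N) ℝ).sum_repr y]
        refine (norm_sum_le _ _).trans_eq (Finset.sum_congr rfl fun i _ => ?_)
        simp [norm_smul]
    _ ≤ ∑ _i : Fin N, (1 : ℝ) := by
        refine Finset.sum_le_sum fun i _ => ?_
        have := hy i
        rw [PiLp.norm_single, Real.norm_eq_abs, abs_le]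
        constructor <;> linarith [this.1, this.2]
    _ = N := by simp

instance : IsFiniteMeasure (volume.restrict (Y N)) := ⟨by
  rw [Measure.restrict_apply_univ]
  refine (Metric.isBounded_closedBall (x := (0 : Euc N)) (r := N)).subset
    (fun y hy => ?_) |>.measure_lt_top
  simpa using norm_le_of_mem_cell hy⟩

lemma volume_cell_pos : 0 < volume (Y N) :=
  isOpen_cell.measure_pos _ ⟨0, fun i => by norm_num⟩

/-- The fundamental domain `[0,1)^N` of the lattice `ℤ^N`. -/
noncomputable abbrev unitCube (N : ℕ) : Set (Euc N) :=
  ZSpan.fundamentalDomain (EuclideanSpace.basisFun (Fin N) ℝ).toBasis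

lemma mem_unitCube {y : Euc N} : y ∈ unitCube N ↔ ∀ i, y i ∈ Ico (0 : ℝ) 1 := by
  simp [unitCube, ZSpan.mem_fundamentalDomain]

/-- The open centred cell differs from a translate of the half-open fundamental domain only by
faces, which are null. -/
lemma cell_ae_eq : Y N =ᵐ[volume]
    (fun y : Euc N => y + WithLp.toLp 2 (fun _ => (1 / 2 : ℝ))) ⁻¹' unitCube N := by
  have h : (univ.pi fun _ : Fin N => Ioo (-1 / 2 : ℝ) (1 / 2)) =ᵐ[volume]
      univ.pi fun _ : Fin N => Ico (-1 / 2 : ℝ) (1 / 2) :=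
    Measure.univ_pi_Ioo_ae_eq_Icc.trans Measure.univ_pi_Ico_ae_eq_Icc.symm
  have h2 := (PiLp.volume_preserving_ofLp (Fin N)).quasiMeasurePreserving.preimage_ae_eq h
  have e1 : Y N = WithLp.ofLp ⁻¹' univ.pi fun _ : Fin N => Ioo (-1 / 2 : ℝ) (1 / 2) := by
    ext y
    simp only [Y, mem_ofPred_eq, mem_preimage, mem_univ_pi]
  have e2 : (fun y : Euc N => y + WithLp.toLp 2 (fun _ => (1 / 2 : ℝ))) ⁻¹' unitCube N
      = WithLp.ofLp ⁻¹' univ.pi fun _ : Fin N => Ico (-1 / 2 : ℝ) (1 / 2) := by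
    ext y
    simp only [mem_preimage, mem_unitCube, mem_univ_pi, mem_Ico, PiLp.add_apply]
    refine forall_congr' fun i => ?_
    constructor <;> rintro ⟨h1, h2⟩ <;> constructor <;> linarith
  rw [e1, e2]
  exact h2

instance : Countable
    (Submodule.span ℤ (range (EuclideanSpace.basisFun (Fin N) ℝ).toBasis)).toAddSubgroup :=
  inferInstanceAs
    (Countable (Submodule.span ℤ (range (EuclideanSpace.basisFun (Fin N) ℝ).toBasis)))

lemma exists_latticeVec_eq {x : Euc N}
    (hx : x ∈ Submodule.span ℤ (range (EuclideanSpace.basisFun (Fin N) ℝ).toBasis)) :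
    ∃ k, x = latticeVec k := by
  rw [Module.Basis.mem_span_iff_repr_mem] at hx
  choose k hk using hx
  refine ⟨k, ?_⟩
  ext i
  have := hk i
  simp only [OrthonormalBasis.coe_toBasis_repr_apply, EuclideanSpace.basisFun_repr] at this
  simp [latticeVec, ← this]

/-- The integral of a periodic function over a translate of the cell. -/
lemma setIntegral_cell_add {F : Euc N → ℝ} (hF : ∀ k y, F (y + latticeVec k) = F y) (s : Euc N) :
    ∫ y in Y N, F (y + s) = ∫ y in Y N, F y := by
  have emb : ∀ c : Euc N, MeasurableEmbedding fun y : Euc N => y + c := fun c =>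
    (MeasurableEquiv.addRight c).measurableEmbedding
  have key : ∀ s : Euc N, ∫ y in Y N, F (y + s) = ∫ y in unitCube N, F y := by
    intro s
    set h : Euc N := WithLp.toLp 2 (fun _ => (1 / 2 : ℝ)) with hh
    have D := ZSpan.isAddFundamentalDomain' (EuclideanSpace.basisFun (Fin N) ℝ).toBasis
      (volume : Measure (Euc N))
    -- Every translate of a fundamental domain is again one, and a lattice-invariant function has
    -- the same integral over any two of them.
    have D' := D.vadd_of_comm (s - h)
    have inv : ∀ (g : (Submodule.span ℤ
        (range (EuclideanSpace.basisFun (Fin N) ℝ).toBasis)).toAddSubgroup)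
        (x : Euc N), F (g +ᵥ x) = F x := fun g x => by
      obtain ⟨k, hk⟩ := exists_latticeVec_eq g.2
      rw [AddSubgroup.vadd_def, vadd_eq_add, add_comm, hk, hF]
    rw [D.setIntegral_eq D' inv, setIntegral_congr_set cell_ae_eq]
    have e1 : (fun y : Euc N => y + h) ⁻¹' unitCube N
        = (fun y => y + s) ⁻¹' ((s - h) +ᵥ unitCube N) := by
      ext y
      simp only [mem_preimage, mem_vadd_set_iff_neg_vadd_mem, vadd_eq_add]
      rw [show -(s - h) + (y + s) = y + h by abel]
    rw [e1, (measurePreserving_add_right volume s).setIntegral_preimage_emb (emb s)]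
  rw [key s]
  simpa using (key 0).symm

/-- The set where F is nonzero is lattice-invariant and is null on the cell, a fundamental domain up
to a null set. -/
lemma ae_eq_zero_of_periodic {β : Type*} [Zero β] {F : Euc N → β}
    (hF : ∀ k y, F (y + latticeVec k) = F y)
    (h0 : ∀ᵐ y ∂volume.restrict (Y N), F y = 0) : ∀ᵐ y, F y = 0 := by
  have D := (ZSpan.isAddFundamentalDomain' (EuclideanSpace.basisFun (Fin N) ℝ).toBasis
      (volume : Measure (Euc N))).vadd_of_comm (-WithLp.toLp 2 (fun _ => (1 / 2 : ℝ)) : Euc N)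
  refine D.measure_zero_of_invariant {y | ¬ F y = 0} (fun g => ?_) ?_
  · ext y
    obtain ⟨k, hk⟩ := exists_latticeVec_eq (-g).2
    rw [mem_vadd_set_iff_neg_vadd_mem, AddSubgroup.vadd_def, vadd_eq_add, add_comm, hk]
    simp only [mem_ofPred_eq, hF]
  · have e : (-WithLp.toLp 2 (fun _ => (1 / 2 : ℝ)) : Euc N) +ᵥ unitCube N
        = (fun y : Euc N => y + WithLp.toLp 2 (fun _ => (1 / 2 : ℝ))) ⁻¹' unitCube N := by
      ext y
      simp only [mem_preimage, mem_vadd_set_iff_neg_vadd_mem, vadd_eq_add, neg_neg, add_comm]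
    rw [measure_congr ((ae_eq_refl _).inter (e ▸ cell_ae_eq.symm))]
    have := (ae_restrict_iff' measurableSet_cell).1 h0
    rw [ae_iff] at this
    refine measure_mono_null (fun y hy => ?_) this
    exact fun h => hy.1 (h hy.2)

/-- After Fubini the inner integral over the shifted cell does not depend on s. Since ψ has compact
support and the cell is bounded, only the values of F on a ball enter; truncation there supplies the
integrability that Fubini requires. -/
lemma integral_cell_integral_translate {F ψ : Euc N → ℝ} (hF : LocallyIntegrable F)
    (hper : ∀ k y, F (y + latticeVec k) = F y) (hψ : Continuous ψ) (hc : HasCompactSupport ψ) :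
    ∫ y in Y N, ∫ s, F (y + s) * ψ s = (∫ s, ψ s) * ∫ y in Y N, F y := by
  obtain ⟨R, hR⟩ := hc.isCompact.isBounded.subset_closedBall (0 : Euc N)
  set B := Metric.closedBall (0 : Euc N) (N + R) with hB
  have iB : Integrable (B.indicator F) :=
    (hF.integrableOn_isCompact (isCompact_closedBall _ _)).integrable_indicator
      Metric.isClosed_closedBall.measurableSet
  have e : ∀ y ∈ Y N, ∀ s, F (y + s) * ψ s = B.indicator F (y + s) * ψ s := fun y hy s => by
    by_cases hs : ψ s = 0
    · simp [hs]
    · rw [indicator_of_mem]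
      have h1 := hR (subset_tsupport _ hs)
      rw [mem_closedBall_zero_iff] at h1 ⊢
      exact (norm_add_le _ _).trans (add_le_add (norm_le_of_mem_cell hy) h1)
  have i0 : Integrable (fun p : Euc N × Euc N => B.indicator F (p.1 + p.2) * ψ p.2)
      (volume.prod volume) :=
    (measurePreserving_add_prod volume volume).integrable_comp_of_integrable
      (iB.mul_prod (hψ.integrable_of_hasCompactSupport hc))
  have i1 : Integrable (fun p : Euc N × Euc N => B.indicator F (p.1 + p.2) * ψ p.2)
      ((volume.restrict (Y N)).prod volume) :=
    i0.mono_measure (Measure.prod_mono Measure.restrict_le_self le_rfl)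
  calc ∫ y in Y N, ∫ s, F (y + s) * ψ s
      = ∫ y in Y N, ∫ s, B.indicator F (y + s) * ψ s :=
        setIntegral_congr_fun measurableSet_cell fun y hy => by simp only [e y hy]
    _ = ∫ s, ∫ y in Y N, B.indicator F (y + s) * ψ s := integral_integral_swap i1
    _ = ∫ s, ∫ y in Y N, F (y + s) * ψ s := by
        congr 1; funext s
        exact setIntegral_congr_fun measurableSet_cell fun y hy => (e y hy s).symm
    _ = ∫ s, ψ s * ∫ y in Y N, F y := by
        congr 1; funext s
        rw [integral_mul_const, setIntegral_cell_add hper, mul_comm]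
    _ = _ := integral_mul_const _ _

lemma integral_pd_eq_zero {ρ : Euc N → ℝ} (h : IsTestFunction univ ρ) (i : Fin N) :
    ∫ x, pd i ρ x = 0 := by
  have c : Continuous (pd i ρ) :=
    (h.1.continuous_fderiv (by simp)).clm_apply continuous_const
  have s : HasCompactSupport (pd i ρ) := h.2.1.fderiv_apply (𝕜 := ℝ) _
  have := integral_mul_fderiv_eq_neg_fderiv_mul_of_integrable (μ := (volume : Measure (Euc N)))
    (f := fun _ => (1 : ℝ)) (g := ρ) (v := EuclideanSpace.single i (1 : ℝ))
    (by simp) (by simp only [one_mul]; exact c.integrable_of_hasCompactSupport s)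
    (by simpa using h.1.continuous.integrable_of_hasCompactSupport h.2.1)
    (fun x _ => differentiableAt_const _) (fun x _ => (h.1.differentiable (by simp)) x)
  simpa [pd] using this

lemma HasWeakGrad.congr {U U' : Euc N → ℝ} {G G' : Euc N → Euc N} (h : HasWeakGrad U G)
    (hU : U' =ᵐ[volume] U) (hG : G' =ᵐ[volume] G) : HasWeakGrad U' G' := by
  refine ⟨h.1.congr hU.symm, h.2.1.congr hG.symm, fun φ hφ i => ?_⟩
  have e1 : ∫ x, U' x * pd i φ x = ∫ x, U x * pd i φ x :=
    integral_congr_ae (by filter_upwards [hU] with x hx; rw [hx])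
  have e2 : ∫ x, G' x i * φ x = ∫ x, G x i * φ x :=
    integral_congr_ae (by filter_upwards [hG] with x hx; rw [hx])
  rw [e1, e2, h.2.2 φ hφ i]

lemma isTestFunction_comp_sub {ρ : Euc N → ℝ} (h : IsTestFunction univ ρ) (y : Euc N) :
    IsTestFunction univ fun x => ρ (x - y) :=
  ⟨h.1.comp (contDiff_id.sub contDiff_const),
    h.2.1.comp_homeomorph (Homeomorph.subRight y), subset_univ _⟩

lemma isTestFunction_normed (ρ : ContDiffBump (0 : Euc N)) :
    IsTestFunction univ (ρ.normed volume) :=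
  ⟨ρ.contDiff_normed, ρ.hasCompactSupport_normed, subset_univ _⟩

/-- The weak gradient of a periodic function has mean zero over a period. -/
lemma HasWeakGrad.integral_cell_eq_zero {U : Euc N → ℝ} {G : Euc N → Euc N}
    (h : HasWeakGrad U G) (hU : IsPeriodic U) (hG : IsPeriodic G) (i : Fin N) :
    ∫ y in Y N, G y i = 0 := by
  obtain ⟨U', eU, pU⟩ := hU.exists_ae_eq
  obtain ⟨G', eG, pG⟩ := hG.exists_ae_eq
  have h' := h.congr eU eG
  have e : ∫ y in Y N, G y i = ∫ y in Y N, G' y i :=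
    integral_congr_ae (by filter_upwards [ae_restrict_of_ae eG] with y hy; rw [hy])
  rw [e]
  set ρ := (shrinkingBump (G := Euc N) 0).normed volume with hρ
  have tρ : IsTestFunction univ ρ := isTestFunction_normed _
  have lG : LocallyIntegrable fun y => G' y i := fun x =>
    (EuclideanSpace.proj (𝕜 := ℝ) i).integrableAtFilter_comp (h'.2.1 x)
  have cpd : Continuous (pd i ρ) :=
    (tρ.1.continuous_fderiv (by simp)).clm_apply continuous_const
  have spd : HasCompactSupport (pd i ρ) := tρ.2.1.fderiv_apply (𝕜 := ℝ) _
  -- Averaging the weak gradient identity tested with ρ(· - y) over y in the cell gives (∫ ∂ᵢρ)(∫_Y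
  -- U) = -(∫ ρ)(∫_Y Gᵢ). Here ∫ ∂ᵢρ = 0 and ∫ ρ = 1.
  have A := integral_cell_integral_translate h'.1 pU cpd spd
  have B := integral_cell_integral_translate lG (fun k y => by rw [pG]) tρ.1.continuous tρ.2.1
  have C : ∀ y, ∫ s, U' (y + s) * pd i ρ s = - ∫ s, G' (y + s) i * ρ s := fun y => by
    have := h'.2.2 _ (isTestFunction_comp_sub tρ y) i
    have e1 : ∀ x, pd i (fun x => ρ (x - y)) x = pd i ρ (x - y) := fun x => by
      simp only [pd, fderiv_comp_sub]
    simp_rw [e1] at this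
    rw [← integral_add_left_eq_self (fun x => U' x * pd i ρ (x - y)) y,
      ← integral_add_left_eq_self (fun x => G' x i * ρ (x - y)) y] at this
    simpa only [add_sub_cancel_left] using this
  simp_rw [C, integral_neg, B, integral_pd_eq_zero tρ i, zero_mul] at A
  rw [hρ, ContDiffBump.integral_normed, one_mul] at A
  linarith

/-- A function with vanishing weak gradient is constant. -/
lemma HasWeakGrad.exists_ae_eq_const {U : Euc N → ℝ} {G : Euc N → Euc N}
    (h : HasWeakGrad U G) (hG : ∀ᵐ x, G x = 0) : ∃ c, ∀ᵐ x, U x = c := by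
  let ρ : ℕ → ContDiffBump (0 : Euc N) := shrinkingBump
  let f : ℕ → Euc N → ℝ := fun n =>
    (U ⋆[ContinuousLinearMap.lsmul ℝ ℝ, volume] (ρ n).normed volume)
  have lim : ∀ᵐ x, Tendsto (fun n => f n x) atTop (𝓝 (U x)) := by
    -- The outer radius is twice the inner one; such a bounded ratio makes the mollifications
    -- converge at almost every point.
    have := ContDiffBump.ae_convolution_tendsto_right_of_locallyIntegrable (φ := ρ) (K := 2)
      tendsto_shrinkingBump_rOut (.of_forall fun n => (by
        simp only [ρ, shrinkingBump]; rw [mul_one_div])) h.1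
    filter_upwards [this] with x hx
    refine hx.congr fun n => ?_
    simp only [f]
    rw [convolution_lsmul_swap, convolution_lsmul]
    simp only [smul_eq_mul, mul_comm]
  have der : ∀ n x, HasFDerivAt (f n) (0 : Euc N →L[ℝ] ℝ) x := fun n x => by
    have tρ : IsTestFunction univ ((ρ n).normed volume) := isTestFunction_normed _
    have hd := tρ.2.1.hasFDerivAt_convolution_right (ContinuousLinearMap.lsmul ℝ ℝ)
      h.1 (tρ.1.of_le (by simp)) x
    -- The derivative falls on the mollifier. Up to sign it is the derivative of t ↦ ρ(x - t), a
    -- test function, so the weak gradient identity replaces U by G = 0.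
    have cz : (U ⋆[(ContinuousLinearMap.lsmul ℝ ℝ).precompR (Euc N), volume]
        fderiv ℝ ((ρ n).normed volume)) x = 0 := by
      rw [← ContinuousLinearMap.coe_inj]
      refine (EuclideanSpace.basisFun (Fin N) ℝ).toBasis.ext fun i => ?_
      rw [ContinuousLinearMap.coe_coe]
      rw [convolution_precompR_apply _ h.1 (tρ.2.1.fderiv ℝ) (tρ.1.continuous_fderiv (by simp)),
        convolution_lsmul]
      have tφ : IsTestFunction univ fun t => (ρ n).normed volume (x - t) :=
        ⟨tρ.1.comp (contDiff_const.sub contDiff_id),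
          tρ.2.1.comp_homeomorph (Homeomorph.subLeft x), subset_univ _⟩
      have h2 := h.2.2 _ tφ i
      have e1 : ∀ t, pd i (fun t => (ρ n).normed volume (x - t)) t
          = - pd i ((ρ n).normed volume) (x - t) := fun t => by
        have d : HasFDerivAt (fun t => (ρ n).normed volume (x - t)) _ t :=
          ((tρ.1.differentiable (by simp)) (x - t)).hasFDerivAt.comp t
            ((hasFDerivAt_id t).const_sub x)
        simp only [pd]
        rw [d.fderiv]
        simp
      have e2 : ∫ t, G t i * (ρ n).normed volume (x - t) = 0 := by
        refine integral_eq_zero_of_ae ?_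
        filter_upwards [hG] with t ht
        simp [ht]
      simp_rw [e1, mul_neg, integral_neg, e2, neg_zero, neg_eq_zero] at h2
      simpa [pd] using h2
    rwa [cz] at hd
  have cst : ∀ n x, f n x = f n 0 := fun n x =>
    is_const_of_fderiv_eq_zero (fun x => (der n x).differentiableAt) (fun x => (der n x).fderiv) x 0
  -- Each mollification is constant, so convergence at one point fixes the limit at all points of
  -- convergence.
  have : ∃ x : Euc N, Tendsto (fun n => f n x) atTop (𝓝 (U x)) := lim.exists
  obtain ⟨x₀, h0⟩ := this
  refine ⟨U x₀, lim.mono fun x hx => tendsto_nhds_unique hx (h0.congr fun n => ?_)⟩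
  rw [cst, ← cst n x]

end Periodic

/-! ### The space V_Y: mean-zero gradients, injectivity of the gradient, separability -/

section CellSpace

variable {N : ℕ}

/-- The gradient of a component as a continuous linear map on `H¹_#(Y)`. -/
noncomputable def H1per.gradL : H1per N →L[ℝ] Lp (Euc N) 2 (volume.restrict (Y N)) :=
  (WithLp.sndL 2 ℝ (Lp ℝ 2 (volume.restrict (Y N))) (Lp (Euc N) 2 (volume.restrict (Y N)))).comp
    (periodicGraph N).subtypeL

/-- The gradient `w ↦ ∇_y w^k` as a continuous linear map on `V_Y`. -/
noncomputable def VY.gradL (k : Fin N) : VY N →L[ℝ] Lp (Euc N) 2 (volume.restrict (Y N)) :=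
  H1per.gradL.comp ((PiLp.proj 2 (fun _ : Fin N => H1per N) k).comp (divFreePer N).subtypeL)

lemma VY.gradL_apply (k : Fin N) (w : VY N) : VY.gradL k w = w.grad k := rfl

lemma VY.integral_grad_eq_zero (w : VY N) (k i : Fin N) :
    ∫ y in Y N, w.grad k y i = 0 := by
  obtain ⟨⟨U, G, hU, hG, hw, -, h2⟩, -⟩ := ((Subtype.val w : PiLp 2 (fun _ => H1per N)) k).2
  rw [← hw.integral_cell_eq_zero hU hG i]
  refine integral_congr_ae ?_
  filter_upwards [h2] with y hy
  rw [← hy]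
  rfl

/-- Periodicity spreads the vanishing of the gradient from the cell to the whole space; the function
is then constant, and its mean over a cell of positive measure makes the constant zero. -/
lemma H1per.eq_zero_of_grad_eq_zero (u : H1per N) (h : u.grad = 0) : u = 0 := by
  obtain ⟨⟨U, G, hU, hG, hw, h1, h2⟩, hm⟩ := u.2
  obtain ⟨G', eG, pG⟩ := hG.exists_ae_eq
  have h3 : ∀ᵐ y ∂volume.restrict (Y N), u.grad y = 0 := by
    rw [h]; exact Lp.coeFn_zero _ _ _
  have g0 : ∀ᵐ y ∂volume.restrict (Y N), G' y = 0 := by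
    filter_upwards [h2, h3, ae_restrict_of_ae eG] with y a b c
    rw [c, ← a]
    exact b
  obtain ⟨c, hc⟩ := (hw.congr (ae_eq_refl _) eG).exists_ae_eq_const (ae_eq_zero_of_periodic pG g0)
  have f1 : ∀ᵐ y ∂volume.restrict (Y N), u.1.fst y = c := by
    filter_upwards [h1, ae_restrict_of_ae hc] with y a b
    rw [a, b]
  have hc0 : c = 0 := by
    rw [integral_congr_ae f1, integral_const, smul_eq_mul, mul_eq_zero] at hm
    refine hm.resolve_left ?_
    rw [measureReal_restrict_apply_univ, measureReal_def]
    refine (ENNReal.toReal_pos volume_cell_pos.ne' ?_).ne'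
    rw [← Measure.restrict_apply_univ]
    exact measure_ne_top _ _
  have hfst : u.1.fst = 0 := by
    refine Lp.ext ?_
    filter_upwards [f1, Lp.coeFn_zero ℝ 2 (volume.restrict (Y N))] with y a b
    rw [a, b, hc0]; rfl
  refine Subtype.ext (WithLp.ofLp_injective 2 (Prod.ext hfst h))

lemma VY.eq_zero_of_grad_eq_zero (w : VY N) (h : ∀ k, w.grad k = 0) : w = 0 :=
  Subtype.ext <| PiLp.ext fun k => H1per.eq_zero_of_grad_eq_zero _ (h k)

/-- Separability passes from L² through products, subspaces and Bochner spaces up to L²(Ω; L²_per(Z;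
V_Y)), where `exists_curry_memLp` uses it. -/
instance (μ : Measure (Euc N)) [SFinite μ] : SecondCountableTopology (Jet μ) :=
  have : Fact ((2 : ENNReal) ≠ ⊤) := ⟨by norm_num⟩
  (WithLp.prodContinuousLinearEquiv 2 ℝ (Lp ℝ 2 μ)
    (Lp (Euc N) 2 μ)).toHomeomorph.secondCountableTopology

instance : SecondCountableTopology (H1per N) :=
  inferInstanceAs (SecondCountableTopology (periodicGraph N))

instance : SecondCountableTopology (PiLp 2 (fun _ : Fin N => H1per N)) :=
  (PiLp.continuousLinearEquiv 2 ℝ (fun _ : Fin N => H1per N)).toHomeomorph.secondCountableTopology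

instance : SecondCountableTopology (VY N) :=
  inferInstanceAs (SecondCountableTopology (divFreePer N))

instance : SecondCountableTopology (L2perZ N) :=
  have : Fact ((2 : ENNReal) ≠ ⊤) := ⟨by norm_num⟩
  inferInstance

instance (Ω : Set (Euc N)) : SecondCountableTopology (Lp (L2perZ N) 2 (volume.restrict Ω)) :=
  have : Fact ((2 : ENNReal) ≠ ⊤) := ⟨by norm_num⟩
  inferInstance

end CellSpace

/-! ### Fibrewise coercivity and orthogonality in Bochner L² spaces -/

section L2Lemmas

variable {α X X' : Type*} [MeasurableSpace α] {μ : Measure α}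

lemma L2_norm_sq_eq [NormedAddCommGroup X] (F : Lp X 2 μ) :
    ‖F‖ ^ 2 = ∫ x, ‖F x‖ ^ 2 ∂μ := by
  have h0 : 0 ≤ ∫ x, ‖F x‖ ^ 2 ∂μ := integral_nonneg fun x => sq_nonneg _
  rw [Lp.norm_def, (Lp.memLp F).eLpNorm_eq_integral_rpow_norm two_ne_zero (by norm_num)]
  simp only [ENNReal.toReal_ofNat, Real.rpow_ofNat]
  rw [ENNReal.toReal_ofReal (by positivity), ← Real.rpow_natCast, ← Real.rpow_mul h0]
  norm_num

lemma L2_integrable_norm_sq [NormedAddCommGroup X] (F : Lp X 2 μ) :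
    Integrable (fun x => ‖F x‖ ^ 2) μ :=
  (Lp.memLp F).integrable_norm_pow (by norm_num)

lemma integrable_bilin [NormedAddCommGroup X] [NormedSpace ℝ X] [NormedAddCommGroup X']
    [NormedSpace ℝ X'] (B : X →L[ℝ] X' →L[ℝ] ℝ) {f : α → X} {g : α → X'}
    (hf : MemLp f 2 μ) (hg : MemLp g 2 μ) : Integrable (fun x => B (f x) (g x)) μ :=
  memLp_one_iff_integrable.1 (B.memLp_of_bilin 1 hf hg)

lemma lpPairing_sum [NormedAddCommGroup X] [NormedSpace ℝ X] [NormedAddCommGroup X']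
    [NormedSpace ℝ X'] {ι : Type*} (s : Finset ι) (B : ι → X →L[ℝ] X' →L[ℝ] ℝ) :
    (∑ i ∈ s, B i).lpPairing μ 2 2 = ∑ i ∈ s, (B i).lpPairing μ 2 2 := by
  ext f g
  simp only [sum_apply, ContinuousLinearMap.lpPairing_eq_integral]
  rw [integral_finsetSum]
  exact fun i _ => integrable_bilin (B i) (Lp.memLp f) (Lp.memLp g)

/-- A pointwise coercivity bound integrates to one with the same constant. Applied over Z and then
over Ω, it lifts ellipticity from the cell. -/
lemma lpPairing_coercive [NormedAddCommGroup X] [NormedSpace ℝ X]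
    {B : X →L[ℝ] X →L[ℝ] ℝ} {c : ℝ} (h : ∀ x, c * ‖x‖ ^ 2 ≤ B x x) (F : Lp X 2 μ) :
    c * ‖F‖ ^ 2 ≤ B.lpPairing μ 2 2 F F := by
  rw [ContinuousLinearMap.lpPairing_eq_integral, L2_norm_sq_eq, ← integral_const_mul]
  exact integral_mono ((L2_integrable_norm_sq F).const_mul c)
    (integrable_bilin B (Lp.memLp F) (Lp.memLp F)) fun x => h _

/-- Orthogonality is stated as a Pythagorean identity between norms, so it lifts fibre by fibre
through spaces that carry only a norm, such as `PeriodField`. -/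
lemma norm_sq_compLpL_add {E W : Type*} [NormedAddCommGroup E] [NormedSpace ℝ E]
    [NormedAddCommGroup W] [NormedSpace ℝ W] [NormedAddCommGroup X] [NormedSpace ℝ X]
    {A : E →L[ℝ] X} {B : W →L[ℝ] X} {m : ℝ}
    (h : ∀ x w, ‖A x + B w‖ ^ 2 = m * ‖x‖ ^ 2 + ‖B w‖ ^ 2) (F : Lp E 2 μ) (G : Lp W 2 μ) :
    ‖A.compLpL 2 μ F + B.compLpL 2 μ G‖ ^ 2 = m * ‖F‖ ^ 2 + ‖B.compLpL 2 μ G‖ ^ 2 := by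
  rw [L2_norm_sq_eq, L2_norm_sq_eq, L2_norm_sq_eq, ← integral_const_mul,
    ← integral_add ((L2_integrable_norm_sq F).const_mul m) (L2_integrable_norm_sq _)]
  refine integral_congr_ae ?_
  filter_upwards [A.coeFn_compLpL F, B.coeFn_compLpL G,
    Lp.coeFn_add (A.compLpL 2 μ F) (B.compLpL 2 μ G)] with x h1 h2 h3
  rw [h3, Pi.add_apply, h1, h2, h]

/-- The same lifting when the first summand is constant over the fibre, which multiplies m by the
total mass. -/
lemma norm_sq_constL_add {E W : Type*} [NormedAddCommGroup E] [NormedSpace ℝ E]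
    [NormedAddCommGroup W] [NormedSpace ℝ W] [NormedAddCommGroup X] [NormedSpace ℝ X]
    [IsFiniteMeasure μ] {A : E →L[ℝ] X} {B : W →L[ℝ] X} {m : ℝ}
    (h : ∀ x w, ‖A x + B w‖ ^ 2 = m * ‖x‖ ^ 2 + ‖B w‖ ^ 2) (x : E) (G : Lp W 2 μ) :
    ‖Lp.constL 2 μ ℝ (A x) + B.compLpL 2 μ G‖ ^ 2
      = (μ.real univ * m) * ‖x‖ ^ 2 + ‖B.compLpL 2 μ G‖ ^ 2 := by
  have e : (μ.real univ * m) * ‖x‖ ^ 2 = ∫ _, m * ‖x‖ ^ 2 ∂μ := by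
    rw [integral_const, smul_eq_mul, mul_assoc]
  rw [L2_norm_sq_eq, L2_norm_sq_eq, e,
    ← integral_add (integrable_const _) (L2_integrable_norm_sq _)]
  refine integral_congr_ae ?_
  filter_upwards [Lp.coeFn_const 2 μ (A x), B.coeFn_compLpL G,
    Lp.coeFn_add (Lp.constL 2 μ ℝ (A x)) (B.compLpL 2 μ G)] with t h1 h2 h3
  rw [h3, Pi.add_apply, show (Lp.constL 2 μ ℝ (A x) : Lp X 2 μ) = Lp.const 2 μ (A x) from rfl,
    h1, h2, Function.const_apply, h]

end L2Lemmas

/-! ### The two-scale form as a bounded coercive bilinear form -/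

section Form

variable {N : ℕ}

instance : IsFiniteMeasure (volume.restrict Z) := by
  unfold Z; infer_instance

/-- The coordinate map `F ↦ F_i` on square integrable vector fields. -/
noncomputable def coordL (μ : Measure (Euc N)) (i : Fin N) : Lp (Euc N) 2 μ →L[ℝ] Lp ℝ 2 μ :=
  (EuclideanSpace.proj (𝕜 := ℝ) i).compLpL 2 μ

lemma coordL_ae (μ : Measure (Euc N)) (i : Fin N) (F : Lp (Euc N) 2 μ) :
    ∀ᵐ y ∂μ, coordL μ i F y = F y i :=
  (EuclideanSpace.proj (𝕜 := ℝ) i).coeFn_compLpL F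

/-- The bilinear form `(F, G) ↦ ∫_Y a F_j G_i`. -/
noncomputable def entryForm (a : Lp ℝ ⊤ (volume.restrict (Y N))) (i j : Fin N) :
    Lp (Euc N) 2 (volume.restrict (Y N)) →L[ℝ] Lp (Euc N) 2 (volume.restrict (Y N)) →L[ℝ] ℝ :=
  ((ContinuousLinearMap.mul ℝ ℝ).lpPairing (volume.restrict (Y N)) 2 2).bilinearComp
    (((ContinuousLinearMap.mul ℝ ℝ).holderL (volume.restrict (Y N)) ⊤ 2 2 a).comp (coordL _ j))
    (coordL _ i)

lemma entryForm_apply (a : Lp ℝ ⊤ (volume.restrict (Y N))) (i j : Fin N)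
    (F G : Lp (Euc N) 2 (volume.restrict (Y N))) :
    entryForm a i j F G = ∫ y in Y N, a y * F y j * G y i := by
  simp only [entryForm, ContinuousLinearMap.bilinearComp_apply,
    ContinuousLinearMap.lpPairing_eq_integral, ContinuousLinearMap.comp_apply]
  refine integral_congr_ae ?_
  filter_upwards [coordL_ae _ j F, coordL_ae _ i G,
    (ContinuousLinearMap.mul ℝ ℝ).coeFn_holder (r := 2) a (coordL _ j F)] with y h1 h2 h3
  rw [ContinuousLinearMap.holderL_apply_apply, h3, h2]
  simp only [ContinuousLinearMap.mul_apply']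
  rw [h1]

lemma integrable_entryForm (a : Lp ℝ ⊤ (volume.restrict (Y N))) (i j : Fin N)
    (F G : Lp (Euc N) 2 (volume.restrict (Y N))) :
    Integrable (fun y => a y * F y j * G y i) (volume.restrict (Y N)) := by
  refine (integrable_bilin (ContinuousLinearMap.mul ℝ ℝ)
    (Lp.memLp ((ContinuousLinearMap.mul ℝ ℝ).holderL (volume.restrict (Y N)) ⊤ 2 2 a
      (coordL _ j F))) (Lp.memLp (coordL _ i G))).congr ?_
  filter_upwards [coordL_ae _ j F, coordL_ae _ i G,
    (ContinuousLinearMap.mul ℝ ℝ).coeFn_holder (r := 2) a (coordL _ j F)] with y h1 h2 h3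
  rw [ContinuousLinearMap.holderL_apply_apply, h3, h2]
  simp only [ContinuousLinearMap.mul_apply']
  rw [h1]

/-- The bilinear form `(F, G) ↦ ∑_{i,j} ∫_Y a_ij F_j G_i`. -/
noncomputable def cellForm (a : Fin N → Fin N → Lp ℝ ⊤ (volume.restrict (Y N))) :
    Lp (Euc N) 2 (volume.restrict (Y N)) →L[ℝ] Lp (Euc N) 2 (volume.restrict (Y N)) →L[ℝ] ℝ :=
  ∑ i, ∑ j, entryForm (a i j) i j

lemma cellForm_coercive {a : Fin N → Fin N → Lp ℝ ⊤ (volume.restrict (Y N))} {c : ℝ}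
    (hell : ∀ᵐ y ∂volume.restrict (Y N), ∀ ζ : Euc N,
      c * ‖ζ‖ ^ 2 ≤ ∑ i, ∑ j, a i j y * ζ j * ζ i)
    (F : Lp (Euc N) 2 (volume.restrict (Y N))) : c * ‖F‖ ^ 2 ≤ cellForm a F F := by
  simp only [cellForm, sum_apply, entryForm_apply]
  have hi := fun i j => integrable_entryForm (a i j) i j F F
  simp_rw [← integral_finsetSum _ fun j _ => hi _ j]
  rw [← integral_finsetSum _ fun i _ => integrable_finsetSum _ fun j _ => hi i j,
    L2_norm_sq_eq, ← integral_const_mul]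
  refine integral_mono_ae ((L2_integrable_norm_sq F).const_mul c)
    (integrable_finsetSum _ fun i _ => integrable_finsetSum _ fun j _ => hi i j) ?_
  filter_upwards [hell] with y hy
  exact hy _

/-- Square integrable vector fields on `Y × Z`. -/
def PeriodField (N : ℕ) : Type := Lp (Lp (Euc N) 2 (volume.restrict (Y N))) 2 (volume.restrict Z)

noncomputable instance : NormedAddCommGroup (PeriodField N) :=
  inferInstanceAs (NormedAddCommGroup
    (Lp (Lp (Euc N) 2 (volume.restrict (Y N))) 2 (volume.restrict Z)))

noncomputable instance : NormedSpace ℝ (PeriodField N) :=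
  inferInstanceAs (NormedSpace ℝ
    (Lp (Lp (Euc N) 2 (volume.restrict (Y N))) 2 (volume.restrict Z)))

/-- The slice of a vector field on `Y × Z` at a point of `Z`. -/
noncomputable def PeriodField.slice (F : PeriodField N) (τ : ℝ) :
    Lp (Euc N) 2 (volume.restrict (Y N)) :=
  (show Lp (Lp (Euc N) 2 (volume.restrict (Y N))) 2 (volume.restrict Z) from F) τ

/-- Constant vector fields on `Y × Z`. -/
noncomputable def constYZ (N : ℕ) : Euc N →L[ℝ] PeriodField N :=
  ((Lp.constL 2 (volume.restrict Z) ℝ).comp (Lp.constL 2 (volume.restrict (Y N)) ℝ) :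
    Euc N →L[ℝ] Lp (Lp (Euc N) 2 (volume.restrict (Y N))) 2 (volume.restrict Z))

/-- The map `w ↦ ∇_y w^k` on `L²_per(Z; V_Y)`. -/
noncomputable def L2perZ.gradL (k : Fin N) : L2perZ N →L[ℝ] PeriodField N :=
  ((VY.gradL k).compLpL 2 (volume.restrict Z) :
    L2perZ N →L[ℝ] Lp (Lp (Euc N) 2 (volume.restrict (Y N))) 2 (volume.restrict Z))

/-- The bilinear form `(F, G) ↦ ∑_{i,j} ∫_Z ∫_Y a_ij F_j G_i`. -/
noncomputable def periodForm (a : Fin N → Fin N → Lp ℝ ⊤ (volume.restrict (Y N))) :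
    PeriodField N →L[ℝ] PeriodField N →L[ℝ] ℝ :=
  ((cellForm a).lpPairing (volume.restrict Z) 2 2 :
    Lp (Lp (Euc N) 2 (volume.restrict (Y N))) 2 (volume.restrict Z) →L[ℝ]
      Lp (Lp (Euc N) 2 (volume.restrict (Y N))) 2 (volume.restrict Z) →L[ℝ] ℝ)

lemma periodForm_coercive {a : Fin N → Fin N → Lp ℝ ⊤ (volume.restrict (Y N))} {c : ℝ}
    (hell : ∀ᵐ y ∂volume.restrict (Y N), ∀ ζ : Euc N,
      c * ‖ζ‖ ^ 2 ≤ ∑ i, ∑ j, a i j y * ζ j * ζ i)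
    (F : PeriodField N) : c * ‖F‖ ^ 2 ≤ periodForm a F F :=
  lpPairing_coercive (cellForm_coercive hell)
    (show Lp (Lp (Euc N) 2 (volume.restrict (Y N))) 2 (volume.restrict Z) from F)

/-- The bilinear form `(F, G) ↦ ∫_Z ∫_Y a F_j G_i`. -/
noncomputable def periodEntryForm (a : Lp ℝ ⊤ (volume.restrict (Y N))) (i j : Fin N) :
    PeriodField N →L[ℝ] PeriodField N →L[ℝ] ℝ :=
  ((entryForm a i j).lpPairing (volume.restrict Z) 2 2 :
    Lp (Lp (Euc N) 2 (volume.restrict (Y N))) 2 (volume.restrict Z) →L[ℝ]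
      Lp (Lp (Euc N) 2 (volume.restrict (Y N))) 2 (volume.restrict Z) →L[ℝ] ℝ)

lemma periodEntryForm_apply (a : Lp ℝ ⊤ (volume.restrict (Y N))) (i j : Fin N)
    (F G : PeriodField N) : periodEntryForm a i j F G
      = ∫ τ in Z, ∫ y in Y N, a y * F.slice τ y j * G.slice τ y i := by
  refine ((entryForm a i j).lpPairing_eq_integral _ _).trans ?_
  simp only [entryForm_apply]
  rfl

lemma periodForm_eq_sum (a : Fin N → Fin N → Lp ℝ ⊤ (volume.restrict (Y N))) :
    periodForm a = ∑ i, ∑ j, periodEntryForm (a i j) i j := by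
  refine (lpPairing_sum _ _).trans ?_
  refine Finset.sum_congr rfl fun i _ => ?_
  exact lpPairing_sum _ _

/-- A constant field only sees the mean of the gradient, which periodicity makes zero. This removes
the cross term between the macroscopic and microscopic gradients. -/
lemma inner_constL_gradL (k : Fin N) (x : Euc N) (w : VY N) :
    inner ℝ (Lp.constL 2 (volume.restrict (Y N)) ℝ x) (VY.gradL k w) = 0 := by
  rw [L2.inner_def]
  have e : ∀ᵐ y ∂volume.restrict (Y N),
      inner ℝ ((Lp.constL 2 (volume.restrict (Y N)) ℝ x : Lp (Euc N) 2 _) y) (VY.gradL k w y)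
        = ∑ i, x i * w.grad k y i := by
    filter_upwards [Lp.coeFn_const 2 (volume.restrict (Y N)) x] with y hy
    rw [show (Lp.constL 2 (volume.restrict (Y N)) ℝ x : Lp (Euc N) 2 _) = Lp.const 2 _ x from rfl,
      hy, PiLp.inner_apply]
    refine Finset.sum_congr rfl fun i _ => ?_
    simp [VY.gradL_apply, mul_comm]
  rw [integral_congr_ae e, integral_finsetSum]
  · simp_rw [integral_const_mul, VY.integral_grad_eq_zero, mul_zero, Finset.sum_const_zero]
  · intro i _
    refine Integrable.const_mul ?_ _
    exact (EuclideanSpace.proj (𝕜 := ℝ) i).integrable_comp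
      ((Lp.memLp (w.grad k)).integrable (by norm_num))

lemma norm_sq_constL_add_gradL (k : Fin N) (x : Euc N) (w : VY N) :
    ‖Lp.constL 2 (volume.restrict (Y N)) ℝ x + VY.gradL k w‖ ^ 2
      = (volume.restrict (Y N)).real univ * ‖x‖ ^ 2 + ‖VY.gradL k w‖ ^ 2 := by
  have e : ‖Lp.constL 2 (volume.restrict (Y N)) ℝ x‖ ^ 2
      = (volume.restrict (Y N)).real univ * ‖x‖ ^ 2 := by
    have h := norm_sq_constL_add (μ := volume.restrict (Y N)) (A := .id ℝ (Euc N))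
      (B := (0 : Euc N →L[ℝ] Euc N)) (m := 1) (by simp) x 0
    simpa using h
  rw [norm_add_sq_real, inner_constL_gradL, e]
  ring

/-- The measure of `Y × Z`. -/
noncomputable def cellMass (N : ℕ) : ℝ :=
  (volume.restrict Z).real univ * (volume.restrict (Y N)).real univ

lemma cellMass_pos (N : ℕ) : 0 < cellMass N := by
  refine mul_pos ?_ ?_
  · rw [measureReal_restrict_apply_univ, Z, Real.volume_real_Ioo]
    norm_num
  · rw [measureReal_def]
    refine ENNReal.toReal_pos ?_ (measure_ne_top _ _)
    rw [Measure.restrict_apply_univ]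
    exact volume_cell_pos.ne'

/-- Constants are inserted once over Y and once over Z; the masses multiply to `cellMass`. -/
lemma norm_sq_constYZ_add_gradL (k : Fin N) (x : Euc N) (w : L2perZ N) :
    ‖constYZ N x + L2perZ.gradL k w‖ ^ 2 = cellMass N * ‖x‖ ^ 2 + ‖L2perZ.gradL k w‖ ^ 2 := by
  have h := norm_sq_constL_add (μ := volume.restrict Z)
    (A := (Lp.constL 2 (volume.restrict (Y N)) ℝ :
      Euc N →L[ℝ] Lp (Euc N) 2 (volume.restrict (Y N)))) (B := VY.gradL k)
    (m := (volume.restrict (Y N)).real univ)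
    (fun x w => norm_sq_constL_add_gradL k x w) x w
  have e1 : Lp.constL 2 (volume.restrict Z) ℝ (Lp.constL 2 (volume.restrict (Y N)) ℝ x)
    = constYZ N x := rfl
  have e2 : (VY.gradL k).compLpL 2 (volume.restrict Z) w = L2perZ.gradL k w := rfl
  rw [e1, e2] at h
  exact h

lemma slice_constYZ_add_gradL (k : Fin N) (x : Euc N) (w : L2perZ N) :
    ∀ᵐ τ ∂volume.restrict Z, ∀ᵐ y ∂volume.restrict (Y N),
      (constYZ N x + L2perZ.gradL k w).slice τ y = x + (w τ).grad k y := by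
  filter_upwards [Lp.coeFn_add (Lp.const 2 (volume.restrict Z)
      (Lp.const 2 (volume.restrict (Y N)) x)) ((VY.gradL k).compLpL 2 (volume.restrict Z) w),
    Lp.coeFn_const 2 (volume.restrict Z) (Lp.const 2 (volume.restrict (Y N)) x),
    (VY.gradL k).coeFn_compLpL w] with τ h1 h2 h3
  have e : (constYZ N x + L2perZ.gradL k w).slice τ
      = Lp.const 2 (volume.restrict (Y N)) x + VY.gradL k (w τ) := by
    refine Eq.trans h1 ?_
    rw [Pi.add_apply, h2, h3, Function.const_apply]
  rw [e]
  filter_upwards [Lp.coeFn_add (Lp.const 2 (volume.restrict (Y N)) x)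
    (VY.gradL k (w τ)), Lp.coeFn_const 2 (volume.restrict (Y N)) x] with y h1 h2
  rw [h1, Pi.add_apply, h2]
  rfl

variable {Ω : Set (Euc N)}

/-- The function underlying an element of `H¹₀(Ω)`, as a continuous linear map. -/
noncomputable def H10.valL : H10 Ω →L[ℝ] Lp ℝ 2 (volume.restrict Ω) :=
  (WithLp.fstL 2 ℝ (Lp ℝ 2 (volume.restrict Ω)) (Lp (Euc N) 2 (volume.restrict Ω))).comp
    (testGraph Ω).topologicalClosure.subtypeL

/-- The gradient of an element of `H¹₀(Ω)`, as a continuous linear map. -/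
noncomputable def H10.gradL : H10 Ω →L[ℝ] Lp (Euc N) 2 (volume.restrict Ω) :=
  (WithLp.sndL 2 ℝ (Lp ℝ 2 (volume.restrict Ω)) (Lp (Euc N) 2 (volume.restrict Ω))).comp
    (testGraph Ω).topologicalClosure.subtypeL

/-- The component `u ↦ u^k` as a continuous linear map on `V`. -/
noncomputable def V.compL (k : Fin N) : V Ω →L[ℝ] H10 Ω :=
  (PiLp.proj 2 (fun _ : Fin N => H10 Ω) k).comp (divFree Ω).subtypeL

/-- The map `u₁ ↦ ∇_y u₁^k` on `L²(Ω; L²_per(Z; V_Y))`. -/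
noncomputable def cellGradL (Ω : Set (Euc N)) (k : Fin N) :
    Lp (L2perZ N) 2 (volume.restrict Ω) →L[ℝ] Lp (PeriodField N) 2 (volume.restrict Ω) :=
  (L2perZ.gradL k).compLpL 2 (volume.restrict Ω)

/-- The map `(u₀, u₁) ↦ ∇u₀^k + ∇_y u₁^k`. -/
noncomputable def twoScaleGradL (Ω : Set (Euc N)) (k : Fin N) :
    V Ω × Lp (L2perZ N) 2 (volume.restrict Ω) →L[ℝ] Lp (PeriodField N) 2 (volume.restrict Ω) :=
  (((constYZ N).compLpL 2 (volume.restrict Ω)).comp (H10.gradL.comp (V.compL k))).coprod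
    (cellGradL Ω k)

/-- The form `â_Ω` as a continuous bilinear form on `V × L²(Ω; L²_per(Z; V_Y))`. -/
noncomputable def twoScaleForm (Ω : Set (Euc N))
    (a : Fin N → Fin N → Lp ℝ ⊤ (volume.restrict (Y N))) :
    (V Ω × Lp (L2perZ N) 2 (volume.restrict Ω)) →L[ℝ]
      (V Ω × Lp (L2perZ N) 2 (volume.restrict Ω)) →L[ℝ] ℝ :=
  ∑ k, (((periodForm a).lpPairing (volume.restrict Ω) 2 2).bilinearComp
    (twoScaleGradL Ω k) (twoScaleGradL Ω k))

lemma twoScaleGradL_apply (k : Fin N) (u₀ : V Ω) (u₁ : Lp (L2perZ N) 2 (volume.restrict Ω)) :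
    twoScaleGradL Ω k (u₀, u₁)
      = (constYZ N).compLpL 2 (volume.restrict Ω) (u₀.grad k) + cellGradL Ω k u₁ := rfl

lemma norm_sq_twoScaleGradL (k : Fin N) (u₀ : V Ω) (u₁ : Lp (L2perZ N) 2 (volume.restrict Ω)) :
    ‖twoScaleGradL Ω k (u₀, u₁)‖ ^ 2 = cellMass N * ‖u₀.grad k‖ ^ 2 + ‖cellGradL Ω k u₁‖ ^ 2 := by
  rw [twoScaleGradL_apply]
  exact norm_sq_compLpL_add (norm_sq_constYZ_add_gradL k) (u₀.grad k) u₁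

/-- Ellipticity bounds the form below by the norm of the total gradient, and orthogonality splits
that norm into its two scales. -/
lemma twoScaleForm_coercive {a : Fin N → Fin N → Lp ℝ ⊤ (volume.restrict (Y N))} {c : ℝ}
    (hell : ∀ᵐ y ∂volume.restrict (Y N), ∀ ζ : Euc N,
      c * ‖ζ‖ ^ 2 ≤ ∑ i, ∑ j, a i j y * ζ j * ζ i)
    (u₀ : V Ω) (u₁ : Lp (L2perZ N) 2 (volume.restrict Ω)) :
    c * ∑ k, (cellMass N * ‖u₀.grad k‖ ^ 2 + ‖cellGradL Ω k u₁‖ ^ 2)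
      ≤ twoScaleForm Ω a (u₀, u₁) (u₀, u₁) := by
  simp only [twoScaleForm, sum_apply, ContinuousLinearMap.bilinearComp_apply,
    Finset.mul_sum]
  refine Finset.sum_le_sum fun k _ => ?_
  rw [← norm_sq_twoScaleGradL]
  exact lpPairing_coercive (periodForm_coercive hell) _

lemma twoScaleGradL_ae (k : Fin N) (u₀ : V Ω) (u₁ : Lp (L2perZ N) 2 (volume.restrict Ω)) :
    ∀ᵐ x ∂volume.restrict Ω, twoScaleGradL Ω k (u₀, u₁) x
      = constYZ N (u₀.grad k x) + L2perZ.gradL k (u₁ x) := by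
  filter_upwards [Lp.coeFn_add ((constYZ N).compLpL 2 (volume.restrict Ω) (u₀.grad k))
    (cellGradL Ω k u₁), (constYZ N).coeFn_compLpL (u₀.grad k),
    (L2perZ.gradL k).coeFn_compLpL u₁] with x h1 h2 h3
  rw [twoScaleGradL_apply, h1, Pi.add_apply, h2, cellGradL, h3]

/-- Only almost everywhere representatives enter, so the iterated integral can be compared with the
form on classes at almost every time. -/
lemma aHat_eq_twoScaleForm {a : Fin N → Fin N → Euc N → ℝ}
    {A : Fin N → Fin N → Lp ℝ ⊤ (volume.restrict (Y N))}
    (hA : ∀ i j, ∀ᵐ y ∂volume.restrict (Y N), A i j y = a i j y)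
    (u₀ v₀ : V Ω) {u₁ v₁ : Euc N → L2perZ N} {U₁ V₁ : Lp (L2perZ N) 2 (volume.restrict Ω)}
    (hU : ∀ᵐ x ∂volume.restrict Ω, U₁ x = u₁ x) (hV : ∀ᵐ x ∂volume.restrict Ω, V₁ x = v₁ x) :
    aHat a u₀ u₁ v₀ v₁ = twoScaleForm Ω A (u₀, U₁) (v₀, V₁) := by
  simp only [twoScaleForm, periodForm_eq_sum, lpPairing_sum, sum_apply,
    ContinuousLinearMap.bilinearComp_apply, aHat]
  -- The component index k is moved outermost, the order used by `twoScaleForm`.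
  rw [Finset.sum_congr rfl fun i _ => Finset.sum_comm, Finset.sum_comm]
  refine Finset.sum_congr rfl fun k _ => Finset.sum_congr rfl fun i _ =>
    Finset.sum_congr rfl fun j _ => ?_
  rw [ContinuousLinearMap.lpPairing_eq_integral]
  refine integral_congr_ae ?_
  filter_upwards [hU, hV, twoScaleGradL_ae k u₀ U₁, twoScaleGradL_ae k v₀ V₁] with x h1 h2 h3 h4
  rw [periodEntryForm_apply, h3, h4]
  refine integral_congr_ae ?_
  filter_upwards [slice_constYZ_add_gradL k (u₀.grad k x) (U₁ x),
    slice_constYZ_add_gradL k (v₀.grad k x) (V₁ x)] with τ h5 h6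
  refine integral_congr_ae ?_
  filter_upwards [h5, h6, hA i j] with y h7 h8 h9
  rw [h7, h8, h9, h1, h2]
  rfl

end Form

/-! ### Ladyzhenskaya's inequality and the embedding of H¹₀ in L⁴ -/

section Ladyzhenskaya

variable {N : ℕ}

lemma continuous_pd {φ : Euc N → ℝ} (h : ContDiff ℝ ∞ φ) (i : Fin N) : Continuous (pd i φ) :=
  (h.continuous_fderiv (by simp)).clm_apply continuous_const

/-- The classical gradient. -/
noncomputable def gradVec (φ : Euc N → ℝ) (x : Euc N) : Euc N := WithLp.toLp 2 fun i => pd i φ x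

lemma continuous_gradVec {φ : Euc N → ℝ} (h : ContDiff ℝ ∞ φ) : Continuous (gradVec φ) :=
  (PiLp.continuous_toLp 2 _).comp (continuous_pi fun i => continuous_pd h i)

lemma norm_fderiv_le_gradVec (φ : Euc N → ℝ) (x : Euc N) : ‖fderiv ℝ φ x‖ ≤ ‖gradVec φ x‖ := by
  refine ContinuousLinearMap.opNorm_le_bound _ (norm_nonneg _) fun v => ?_
  have e : fderiv ℝ φ x v = inner ℝ (gradVec φ x) v := by
    conv_lhs => rw [← (EuclideanSpace.basisFun (Fin N) ℝ).sum_repr v, map_sum]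
    rw [PiLp.inner_apply]
    refine Finset.sum_congr rfl fun i _ => ?_
    simp [gradVec, pd]
  rw [e]
  exact norm_inner_le_norm _ _

lemma support_gradVec_subset {φ : Euc N → ℝ} : Function.support (gradVec φ) ⊆ tsupport φ := by
  intro x hx
  by_contra h
  refine hx ?_
  have h0 : fderiv ℝ φ x = 0 := by
    by_contra h2
    exact h (support_fderiv_subset ℝ h2)
  ext i
  simp [gradVec, pd, h0]

instance holderTriple_four : ENNReal.HolderTriple 4 4 2 := ⟨by
  rw [← two_mul, show (4 : ENNReal) = 2 * 2 by norm_num,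
    ENNReal.mul_inv (by norm_num) (by norm_num), ← mul_assoc,
    ENNReal.mul_inv_cancel (by norm_num) (by norm_num), one_mul]⟩

instance fact_one_le_four : Fact ((1 : ENNReal) ≤ 4) := ⟨by norm_num⟩

/-- Ladyzhenskaya's inequality for test functions in the plane. -/
lemma exists_eLpNorm_four_sq_le : ∃ c : NNReal, ∀ φ : Euc 2 → ℝ, ContDiff ℝ ∞ φ →
    HasCompactSupport φ →
    eLpNorm φ 4 volume ^ 2 ≤ c * (eLpNorm φ 2 volume * eLpNorm (gradVec φ) 2 volume) := by
  -- The Sobolev inequality from W^{1,1} to L² in the plane is applied to φ²: ‖φ‖₄² = ‖φ²‖₂ ≤ C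
  -- ‖∇(φ²)‖₁ ≤ 2C ‖φ‖₂ ‖∇φ‖₂, hence the factor 2.
  refine ⟨eLpNormLESNormFDerivOneConst (volume : Measure (Euc 2)) (2 : NNReal) * 2,
    fun φ h hc => ?_⟩
  have hd : ∀ x, HasFDerivAt (fun x => φ x ^ 2) ((2 * φ x) • fderiv ℝ φ x) x := fun x => by
    simpa using ((h.differentiable (by simp)) x).hasFDerivAt.pow 2
  have h1 : eLpNorm (fun x => φ x ^ 2) 2 volume = eLpNorm φ 4 volume ^ 2 := by
    have := eLpNorm_norm_rpow (p := 2) (μ := (volume : Measure (Euc 2))) φ (q := 2) (by norm_num)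
    rw [show (2 : ENNReal) * ENNReal.ofReal 2 = 4 by norm_num] at this
    simpa using this
  have conj : NNReal.HolderConjugate (Module.finrank ℝ (Euc 2) : NNReal) 2 := by
    rw [finrank_euclideanSpace, Fintype.card_fin]
    exact NNReal.HolderConjugate.two_two
  have hS : HasCompactSupport fun x => φ x ^ 2 := hc.comp_left (g := fun z : ℝ => z ^ 2) (by simp)
  have h2 := eLpNorm_le_eLpNorm_fderiv_one (volume : Measure (Euc 2)) (u := fun x => φ x ^ 2)
    ((h.pow 2).of_le (by simp)) hS conj
  have h3 : eLpNorm (fderiv ℝ fun x => φ x ^ 2) 1 volume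
      ≤ 2 * (eLpNorm φ 2 volume * eLpNorm (gradVec φ) 2 volume) := by
    have e : eLpNorm (fderiv ℝ fun x => φ x ^ 2) 1 volume
        ≤ eLpNorm ((2 : ℝ) • (φ • gradVec φ)) 1 volume := by
      refine eLpNorm_mono fun x => ?_
      rw [(hd x).fderiv, norm_smul, Pi.smul_apply, Pi.smul_apply', smul_smul, norm_smul]
      exact mul_le_mul_of_nonneg_left (norm_fderiv_le_gradVec φ x) (norm_nonneg _)
    refine e.trans ?_
    rw [eLpNorm_const_smul]
    refine mul_le_mul' (by simp [enorm_eq_nnnorm]) ?_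
    exact eLpNorm_smul_le_mul_eLpNorm (continuous_gradVec h).aestronglyMeasurable
      h.continuous.aestronglyMeasurable
  rw [← h1]
  calc eLpNorm (fun x => φ x ^ 2) 2 volume
      ≤ eLpNormLESNormFDerivOneConst (volume : Measure (Euc 2)) (2 : NNReal)
        * eLpNorm (fderiv ℝ fun x => φ x ^ 2) 1 volume := h2
    _ ≤ _ := by
      rw [ENNReal.coe_mul, mul_assoc]
      exact mul_le_mul' le_rfl h3

variable {Ω : Set (Euc N)}

/-- A closed property of elements of `H¹₀(Ω)` holds if it holds for test functions. -/
lemma H10.induction {P : H10 Ω → Prop} (hP : IsClosed {u | P u})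
    (h : ∀ (u : H10 Ω) (φ : Euc N → ℝ), IsTestFunction Ω φ →
      (∀ᵐ x ∂volume.restrict Ω, u.val x = φ x) →
      (∀ᵐ x ∂volume.restrict Ω, u.grad x = gradVec φ x) → P u) (u : H10 Ω) : P u := by
  obtain ⟨x, hx, hu⟩ := mem_closure_iff_seq_limit.1 u.2
  let y : ℕ → H10 Ω := fun n => ⟨x n, subset_closure (hx n)⟩
  have hy : Tendsto y atTop (𝓝 u) := tendsto_subtype_rng.2 hu
  refine hP.mem_of_tendsto hy (.of_forall fun n => ?_)
  obtain ⟨φ, hφ, h1, h2⟩ := hx n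
  exact h (y n) φ hφ h1 (h2.mono fun x hx => PiLp.ext hx)

/-- Test functions vanish outside Ω, so the constant of the whole plane serves for every Ω. The
inequality passes to the closure because the right side is continuous in H¹ and the L⁴ norm is lower
semicontinuous under L² convergence. -/
lemma exists_eLpNorm_four_le : ∃ c : ℝ, 0 ≤ c ∧ ∀ (Ω : Set (Euc 2)) (u : H10 Ω),
    eLpNorm u.val 4 (volume.restrict Ω) ≤ ENNReal.ofReal (Real.sqrt (c * (‖u.val‖ * ‖u.grad‖))) := by
  obtain ⟨c, hc⟩ := exists_eLpNorm_four_sq_le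
  refine ⟨c, c.2, fun Ω u => ?_⟩
  have cont : Continuous fun u : H10 Ω =>
      ENNReal.ofReal (Real.sqrt (c * (‖u.val‖ * ‖u.grad‖))) := by
    have c1 : Continuous fun u : H10 Ω => u.val := H10.valL.continuous
    have c2 : Continuous fun u : H10 Ω => u.grad := H10.gradL.continuous
    exact ENNReal.continuous_ofReal.comp
      (Real.continuous_sqrt.comp (continuous_const.mul (c1.norm.mul c2.norm)))
  refine H10.induction (P := fun u => eLpNorm u.val 4 (volume.restrict Ω)
    ≤ ENNReal.ofReal (Real.sqrt (c * (‖u.val‖ * ‖u.grad‖)))) ?_ ?_ u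
  · refine IsSeqClosed.isClosed fun x l hx hl => ?_
    change eLpNorm l.val 4 (volume.restrict Ω) ≤ _
    refine le_of_forall_gt_imp_ge_of_dense fun b hb => ?_
    have ev : ∀ᶠ n in atTop, eLpNorm (x n).val 4 (volume.restrict Ω) ≤ b := by
      filter_upwards [((cont.tendsto l).comp hl).eventually_lt_const hb] with n hn
      exact (hx n).trans hn.le
    have t : Tendsto (fun n => (x n).val) atTop (𝓝 l.val) := (H10.valL.continuous.tendsto l).comp hl
    exact eLpNorm_le_of_tendstoInMeasure ev (tendstoInMeasure_of_tendsto_Lp t)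
      fun n => Lp.aestronglyMeasurable _
  · intro u φ hφ h1 h2
    have n1 : eLpNorm φ 2 volume = ENNReal.ofReal ‖u.val‖ := by
      rw [← eLpNorm_restrict_eq_of_support_subset ((subset_tsupport φ).trans hφ.2.2),
        ← eLpNorm_congr_ae h1, ofReal_norm, Lp.enorm_def]
    have n2 : eLpNorm (gradVec φ) 2 volume = ENNReal.ofReal ‖u.grad‖ := by
      rw [← eLpNorm_restrict_eq_of_support_subset (support_gradVec_subset.trans hφ.2.2),
        ← eLpNorm_congr_ae h2, ofReal_norm, Lp.enorm_def]
    have h := hc φ hφ.1 hφ.2.1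
    rw [n1, n2, ← ENNReal.ofReal_mul (norm_nonneg _), ← ENNReal.ofReal_coe_nnreal,
      ← ENNReal.ofReal_mul c.coe_nonneg] at h
    have h3 : eLpNorm u.val 4 (volume.restrict Ω) ≤ eLpNorm φ 4 volume := by
      rw [eLpNorm_congr_ae h1]
      exact eLpNorm_mono_measure _ Measure.restrict_le_self
    refine h3.trans ?_
    have h4 : ENNReal.ofReal (c * (‖u.val‖ * ‖u.grad‖))
        = ENNReal.ofReal (Real.sqrt (c * (‖u.val‖ * ‖u.grad‖))) ^ 2 := by
      rw [← ENNReal.ofReal_pow (Real.sqrt_nonneg _), Real.sq_sqrt (by positivity)]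
    rw [h4] at h
    exact (ENNReal.pow_le_pow_left_iff two_ne_zero).1 h

lemma norm_val_le (u : H10 Ω) : ‖u.val‖ ≤ ‖u‖ := by
  have := WithLp.prod_norm_sq_eq_of_L2 u.1
  have h2 : ‖u.val‖ ^ 2 ≤ ‖u‖ ^ 2 := by
    change ‖u.1.fst‖ ^ 2 ≤ ‖u.1‖ ^ 2
    rw [this]; nlinarith [sq_nonneg ‖u.1.snd‖]
  exact (pow_le_pow_iff_left₀ (norm_nonneg _) (norm_nonneg _) two_ne_zero).1 h2

lemma norm_grad_le (u : H10 Ω) : ‖u.grad‖ ≤ ‖u‖ := by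
  have := WithLp.prod_norm_sq_eq_of_L2 u.1
  have h2 : ‖u.grad‖ ^ 2 ≤ ‖u‖ ^ 2 := by
    change ‖u.1.snd‖ ^ 2 ≤ ‖u.1‖ ^ 2
    rw [this]; nlinarith [sq_nonneg ‖u.1.fst‖]
  exact (pow_le_pow_iff_left₀ (norm_nonneg _) (norm_nonneg _) two_ne_zero).1 h2

lemma H10.memLp_four {Ω : Set (Euc 2)} (u : H10 Ω) : MemLp u.val 4 (volume.restrict Ω) := by
  obtain ⟨c, -, hc⟩ := exists_eLpNorm_four_le
  exact ⟨Lp.aestronglyMeasurable _, (hc Ω u).trans_lt ENNReal.ofReal_lt_top⟩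

/-- The constant in Ladyzhenskaya's inequality. -/
noncomputable def ladyConst : ℝ := exists_eLpNorm_four_le.choose

lemma ladyConst_nonneg : 0 ≤ ladyConst := exists_eLpNorm_four_le.choose_spec.1

lemma norm_toLp_four_le {Ω : Set (Euc 2)} (u : H10 Ω) :
    ‖u.memLp_four.toLp‖ ≤ Real.sqrt (ladyConst * (‖u.val‖ * ‖u.grad‖)) := by
  rw [Lp.norm_toLp]
  exact ENNReal.toReal_le_of_le_ofReal (Real.sqrt_nonneg _)
    (exists_eLpNorm_four_le.choose_spec.2 Ω u)

/-- The embedding of `H¹₀(Ω)` into `L⁴(Ω)`, for `Ω` in the plane. -/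
noncomputable def H10.toL4 {Ω : Set (Euc 2)} : H10 Ω →L[ℝ] Lp ℝ 4 (volume.restrict Ω) :=
  LinearMap.mkContinuous
    { toFun := fun u => u.memLp_four.toLp
      map_add' := fun u v => by
        rw [← MemLp.toLp_add]
        exact MemLp.toLp_congr _ _ (Lp.coeFn_add u.val v.val)
      map_smul' := fun r u => by
        rw [RingHom.id_apply, ← MemLp.toLp_const_smul]
        exact MemLp.toLp_congr _ _ (Lp.coeFn_smul r u.val) }
    (Real.sqrt ladyConst) fun u => by
      refine (norm_toLp_four_le u).trans ?_
      rw [Real.sqrt_mul ladyConst_nonneg]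
      refine mul_le_mul_of_nonneg_left ?_ (Real.sqrt_nonneg _)
      rw [Real.sqrt_le_left (norm_nonneg _), sq]
      exact mul_le_mul (norm_val_le u) (norm_grad_le u) (norm_nonneg _) (norm_nonneg _)

lemma H10.toL4_ae {Ω : Set (Euc 2)} (u : H10 Ω) :
    ∀ᵐ x ∂volume.restrict Ω, H10.toL4 u x = u.val x := u.memLp_four.coeFn_toLp

/-- Ladyzhenskaya's inequality. -/
lemma norm_toL4_sq_le {Ω : Set (Euc 2)} (u : H10 Ω) :
    ‖H10.toL4 u‖ ^ 2 ≤ ladyConst * (‖u.val‖ * ‖u.grad‖) := by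
  have h := pow_le_pow_left₀ (norm_nonneg _) (norm_toLp_four_le u) 2
  rwa [Real.sq_sqrt (mul_nonneg ladyConst_nonneg (by positivity))] at h

end Ladyzhenskaya

/-! ### The convective form: continuity and antisymmetry -/

section Trilinear

variable {Ω : Set (Euc 2)}

/-- The product `L⁴ × L⁴ → L²` composed with the embedding of `H¹₀(Ω)` in `L⁴(Ω)`. -/
noncomputable def prodL (Ω : Set (Euc 2)) : H10 Ω →L[ℝ] H10 Ω →L[ℝ] Lp ℝ 2 (volume.restrict Ω) :=
  ((ContinuousLinearMap.mul ℝ ℝ).holderL (volume.restrict Ω) 4 4 2).bilinearComp H10.toL4 H10.toL4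

lemma prodL_ae (p r : H10 Ω) :
    ∀ᵐ x ∂volume.restrict Ω, prodL Ω p r x = p.val x * r.val x := by
  filter_upwards [(ContinuousLinearMap.mul ℝ ℝ).coeFn_holder (r := 2) (H10.toL4 p) (H10.toL4 r),
    p.toL4_ae, r.toL4_ae] with x h1 h2 h3
  rw [← h2, ← h3]
  exact h1

/-- The form `(f, q) ↦ ∫_Ω f ∂_j q`. -/
noncomputable def derivPairing (Ω : Set (Euc 2)) (j : Fin 2) :
    Lp ℝ 2 (volume.restrict Ω) →L[ℝ] H10 Ω →L[ℝ] ℝ :=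
  ((ContinuousLinearMap.mul ℝ ℝ).lpPairing (volume.restrict Ω) 2 2).bilinearComp
    (.id ℝ _) ((coordL _ j).comp H10.gradL)

/-- The trilinear form `(p, q, r) ↦ ∫_Ω p (∂_j q) r`. -/
noncomputable def tri (j : Fin 2) (p q r : H10 Ω) : ℝ := derivPairing Ω j (prodL Ω p r) q

lemma tri_eq_integral (j : Fin 2) (p q r : H10 Ω) :
    tri j p q r = ∫ x in Ω, p.val x * q.grad x j * r.val x := by
  refine ((ContinuousLinearMap.mul ℝ ℝ).lpPairing_eq_integral _ _).trans ?_
  refine integral_congr_ae ?_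
  filter_upwards [prodL_ae p r, coordL_ae _ j q.grad] with x h1 h2
  have h3 : (coordL _ j).comp H10.gradL q x = q.grad x j := h2
  change prodL Ω p r x * (coordL _ j).comp H10.gradL q x = _
  rw [h1, h3]
  ring

lemma b_eq_sum_tri (u v w : V Ω) :
    b u v w = ∑ k, ∑ j, tri j (V.compL j u) (V.compL k v) (V.compL k w) := by
  simp only [b, tri_eq_integral]
  rfl

lemma exists_abs_tri_le (Ω : Set (Euc 2)) : ∃ K : ℝ, 0 ≤ K ∧ ∀ j (p q r : H10 Ω),
    |tri j p q r| ≤ K * (‖H10.toL4 p‖ * ‖H10.toL4 r‖ * ‖q.grad‖) := by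
  set P := (ContinuousLinearMap.mul ℝ ℝ).lpPairing (volume.restrict Ω) 2 2 with hP
  set M := (ContinuousLinearMap.mul ℝ ℝ).holderL (volume.restrict Ω) 4 4 2 with hM
  refine ⟨‖P‖ * ‖M‖ * ∑ j, ‖coordL (volume.restrict Ω) j‖, by positivity, fun j p q r => ?_⟩
  have e : tri j p q r = P (M (H10.toL4 p) (H10.toL4 r)) (coordL _ j q.grad) := rfl
  have h1 := P.le_opNorm₂ (M (H10.toL4 p) (H10.toL4 r)) (coordL _ j q.grad)
  have h2 := M.le_opNorm₂ (H10.toL4 p) (H10.toL4 r)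
  have h3 := (coordL (volume.restrict Ω) j).le_opNorm q.grad
  have h4 : ‖coordL (volume.restrict Ω) j‖ ≤ ∑ j, ‖coordL (volume.restrict Ω) j‖ :=
    Finset.single_le_sum (f := fun j => ‖coordL (volume.restrict Ω) j‖)
      (fun _ _ => norm_nonneg _) (Finset.mem_univ j)
  rw [e, ← Real.norm_eq_abs]
  calc _ ≤ ‖P‖ * ‖M (H10.toL4 p) (H10.toL4 r)‖ * ‖coordL _ j q.grad‖ := h1
    _ ≤ ‖P‖ * (‖M‖ * ‖H10.toL4 p‖ * ‖H10.toL4 r‖)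
        * ((∑ j, ‖coordL (volume.restrict Ω) j‖) * ‖q.grad‖) := by
      gcongr
      exact h3.trans (by gcongr)
    _ = _ := by ring

/-- The function χ need not vanish on the boundary of Ω: the functions approximating p do, and both
sides are continuous in p. -/
lemma integral_mul_pd_eq {χ : Euc 2 → ℝ} (hχ : IsTestFunction univ χ) (j : Fin 2) (p : H10 Ω) :
    ∫ x in Ω, p.val x * pd j χ x = - ∫ x in Ω, p.grad x j * χ x := by
  have sχ : HasCompactSupport (pd j χ) := hχ.2.1.fderiv_apply (𝕜 := ℝ) _
  have m1 : MemLp (pd j χ) 2 (volume.restrict Ω) :=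
    ((continuous_pd hχ.1 j).memLp_of_hasCompactSupport sχ).restrict _
  have m2 : MemLp χ 2 (volume.restrict Ω) :=
    (hχ.1.continuous.memLp_of_hasCompactSupport hχ.2.1).restrict _
  have e1 : ∀ p : H10 Ω, ∫ x in Ω, p.val x * pd j χ x
      = (ContinuousLinearMap.mul ℝ ℝ).lpPairing (volume.restrict Ω) 2 2 (H10.valL p) m1.toLp := by
    intro p
    rw [ContinuousLinearMap.lpPairing_eq_integral]
    refine integral_congr_ae ?_
    filter_upwards [m1.coeFn_toLp] with x hx
    rw [hx]; rfl
  have e2 : ∀ p : H10 Ω, ∫ x in Ω, p.grad x j * χ x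
      = (ContinuousLinearMap.mul ℝ ℝ).lpPairing (volume.restrict Ω) 2 2
        (coordL _ j (H10.gradL p)) m2.toLp := by
    intro p
    rw [ContinuousLinearMap.lpPairing_eq_integral]
    refine integral_congr_ae ?_
    filter_upwards [m2.coeFn_toLp, coordL_ae _ j (H10.gradL p)] with x hx h2
    rw [hx, h2]; rfl
  refine H10.induction (P := fun p => ∫ x in Ω, p.val x * pd j χ x
    = - ∫ x in Ω, p.grad x j * χ x) ?_ ?_ p
  · simp_rw [e1, e2]
    exact isClosed_eq (by fun_prop) (by fun_prop)
  · intro u φ hφ h1 h2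
    have sφ : HasCompactSupport (pd j φ) := hφ.2.1.fderiv_apply (𝕜 := ℝ) _
    have ibp := integral_mul_fderiv_eq_neg_fderiv_mul_of_integrable
      (μ := (volume : Measure (Euc 2))) (f := φ) (g := χ) (v := EuclideanSpace.single j (1 : ℝ))
      (((continuous_pd hφ.1 j).mul hχ.1.continuous).integrable_of_hasCompactSupport
        (HasCompactSupport.mul_right sφ))
      ((hφ.1.continuous.mul (continuous_pd hχ.1 j)).integrable_of_hasCompactSupport
        (HasCompactSupport.mul_right hφ.2.1))
      ((hφ.1.continuous.mul hχ.1.continuous).integrable_of_hasCompactSupport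
        (HasCompactSupport.mul_right hφ.2.1))
      (fun x _ => (hφ.1.differentiable (by simp)) x) (fun x _ => (hχ.1.differentiable (by simp)) x)
    have z : ∀ x ∉ Ω, φ x = 0 ∧ pd j φ x = 0 := fun x hx => by
      have hx' : x ∉ tsupport φ := fun h => hx (hφ.2.2 h)
      refine ⟨image_eq_zero_of_notMem_tsupport hx', ?_⟩
      have h0 : fderiv ℝ φ x = 0 := by
        by_contra h2
        exact hx' (support_fderiv_subset ℝ h2)
      simp [pd, h0]
    calc ∫ x in Ω, u.val x * pd j χ x = ∫ x in Ω, φ x * pd j χ x :=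
          integral_congr_ae (by filter_upwards [h1] with x hx; rw [hx])
      _ = ∫ x, φ x * pd j χ x :=
          setIntegral_eq_integral_of_forall_compl_eq_zero fun x hx => by simp [(z x hx).1]
      _ = - ∫ x, pd j φ x * χ x := ibp
      _ = - ∫ x in Ω, pd j φ x * χ x := by
          rw [setIntegral_eq_integral_of_forall_compl_eq_zero fun x hx => by simp [(z x hx).2]]
      _ = _ := by
          congr 1
          exact integral_congr_ae (by filter_upwards [h2] with x hx; rw [hx]; rfl)

/-- For test functions φ, ψ the sum is ∫ u·∇(φψ) = -∫ (div u) φψ = 0. The L⁴ embedding makes the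
expression continuous in q and in r, so density extends it in each variable in turn. -/
lemma sum_tri_add_swap_eq_zero (u : V Ω) (q r : H10 Ω) :
    ∑ j, (tri j (V.compL j u) q r + tri j (V.compL j u) r q) = 0 := by
  have cl : ∀ r : H10 Ω, IsClosed {q : H10 Ω |
      ∑ j, (tri j (V.compL j u) q r + tri j (V.compL j u) r q) = 0} := fun r => by
    refine isClosed_eq ?_ continuous_const
    unfold tri
    fun_prop
  refine H10.induction (P := fun q : H10 Ω =>
    ∑ j, (tri j (V.compL j u) q r + tri j (V.compL j u) r q) = 0) (cl r) ?_ q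
  intro q φ hφ q1 q2
  -- The expression is symmetric in q and r, so the closedness used for q also serves for r.
  have := H10.induction (P := fun r : H10 Ω =>
    ∑ j, (tri j (V.compL j u) r q + tri j (V.compL j u) q r) = 0) (cl q) ?_ r
  · simpa only [add_comm] using this
  intro r ψ hψ r1 r2
  have tχ : IsTestFunction univ fun x => φ x * ψ x :=
    ⟨hφ.1.mul hψ.1, HasCompactSupport.mul_right hφ.2.1, subset_univ _⟩
  have it : ∀ j (p q r : H10 Ω), Integrable (fun x => p.val x * q.grad x j * r.val x)
      (volume.restrict Ω) := fun j p q r => by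
    refine (integrable_bilin (ContinuousLinearMap.mul ℝ ℝ) (Lp.memLp (prodL Ω p r))
      (Lp.memLp (coordL _ j q.grad))).congr ?_
    filter_upwards [prodL_ae p r, coordL_ae _ j q.grad] with x h1 h2
    rw [h1, h2]
    simp only [ContinuousLinearMap.mul_apply']
    ring
  have e : ∀ j, tri j (V.compL j u) r q + tri j (V.compL j u) q r
      = - ∫ x in Ω, (u.grad j) x j * (φ x * ψ x) := fun j => by
    rw [tri_eq_integral, tri_eq_integral, ← integral_add (it _ _ _ _) (it _ _ _ _)]
    refine Eq.trans (integral_congr_ae ?_) (integral_mul_pd_eq tχ j (V.compL j u))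
    filter_upwards [q1, q2, r1, r2] with x h1 h2 h3 h4
    have d : pd j (fun x => φ x * ψ x) x = φ x * pd j ψ x + pd j φ x * ψ x := by
      have d1 := (hφ.1.differentiable (by simp)) x
      have d2 := (hψ.1.differentiable (by simp)) x
      simp only [pd]
      rw [fderiv_fun_mul d1 d2]
      simp [mul_comm]
    rw [h1, h2, h3, h4, d]
    simp only [gradVec]
    ring
  simp_rw [e]
  rw [Finset.sum_neg_distrib, neg_eq_zero]
  have m2 : MemLp (fun x => φ x * ψ x) 2 (volume.restrict Ω) :=
    (tχ.1.continuous.memLp_of_hasCompactSupport tχ.2.1).restrict _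
  rw [← integral_finsetSum]
  · refine integral_eq_zero_of_ae ?_
    filter_upwards [u.2] with x hx
    rw [← Finset.sum_mul]
    have : ∑ i, (u.grad i) x i = 0 := hx
    rw [this, zero_mul]; rfl
  · intro j _
    refine (integrable_bilin (ContinuousLinearMap.mul ℝ ℝ) (Lp.memLp (coordL _ j (u.grad j)))
      m2).congr ?_
    filter_upwards [coordL_ae _ j (u.grad j)] with x hx
    rw [hx]; rfl

/-- The antisymmetry of the convective term. -/
lemma b_antisymm (u v w : V Ω) : b u v w = - b u w v := by
  rw [eq_neg_iff_add_eq_zero, b_eq_sum_tri, b_eq_sum_tri, ← Finset.sum_add_distrib]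
  refine Finset.sum_eq_zero fun k _ => ?_
  rw [← Finset.sum_add_distrib]
  exact sum_tri_add_swap_eq_zero u _ _

lemma b_self_eq_zero (u v : V Ω) : b u v v = 0 := by
  have := b_antisymm u v v
  linarith

/-- With z = u - w, b(u,u,z) - b(w,w,z) = b(z,u,z) + b(w,z,z), and the last term vanishes. -/
lemma b_sub_b (u w : V Ω) : b u u (u - w) - b w w (u - w) = b (u - w) u (u - w) := by
  have h0 := b_self_eq_zero w (u - w)
  have e : b (u - w) u (u - w) + b w (u - w) (u - w) = b u u (u - w) - b w w (u - w) := by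
    simp only [b_eq_sum_tri, tri, map_sub, sub_apply,
      Finset.sum_sub_distrib]
    ring
  linarith

lemma continuous_b : Continuous fun x : V Ω × V Ω × V Ω => b x.1 x.2.1 x.2.2 := by
  simp only [b_eq_sum_tri, tri]
  fun_prop

end Trilinear

/-! ### Grönwall's lemma with an integrable kernel -/

section Gronwall

/-- At a maximum point c of y on [0,b] beyond a, y(c) ≤ ∫_a^c k y ≤ y(c)/2, because y vanishes
before a; hence y(c) ≤ 0. -/
lemma eq_zero_of_le_setIntegral_mul_step {k y : ℝ → ℝ} {T a b : ℝ} (ha : 0 ≤ a) (hb : b < T)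
    (hk : IntegrableOn k (Ioo 0 T)) (hk0 : ∀ t, 0 ≤ k t) (hy : ContinuousOn y (Icc 0 T))
    (hy0 : ∀ t ∈ Icc 0 T, 0 ≤ y t)
    (h : ∀ s ∈ Ioo 0 T, y s ≤ ∫ t in Ioo 0 s, k t * y t)
    (hza : ∀ t ∈ Icc 0 a, y t = 0) (hab : a ≤ b) (hsmall : ∫ t in Ioo a b, k t ≤ 1 / 2) :
    ∀ t ∈ Icc 0 b, y t = 0 := by
  obtain ⟨c, hc, hmax⟩ := isCompact_Icc.exists_isMaxOn (nonempty_Icc.2 (ha.trans hab))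
    (hy.mono (Icc_subset_Icc_right hb.le))
  suffices hyc : y c ≤ 0 from fun t ht =>
    le_antisymm ((hmax ht).trans hyc) (hy0 t ⟨ht.1, ht.2.trans hb.le⟩)
  rcases le_or_gt c a with hca | hca
  · exact (hza c ⟨hc.1, hca⟩).le
  have hc0 : 0 ≤ y c := hy0 c ⟨hc.1, hc.2.trans hb.le⟩
  have hsub : Ioo a c ⊆ Ioo 0 T := fun t ht => ⟨ha.trans_lt ht.1, ht.2.trans_le (hc.2.trans hb.le)⟩
  have hsub' : Ioo a b ⊆ Ioo 0 T := fun t ht => ⟨ha.trans_lt ht.1, ht.2.trans hb⟩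
  have hsplit : ∫ t in Ioo 0 c, k t * y t = ∫ t in Ioo a c, k t * y t := by
    refine setIntegral_eq_of_subset_of_forall_sdiff_eq_zero measurableSet_Ioo
      (fun t ht => ⟨ha.trans_lt ht.1, ht.2⟩) fun t ht => ?_
    have hta : t ≤ a := by
      by_contra! hlt
      exact ht.2 ⟨hlt, ht.1.2⟩
    rw [hza t ⟨ht.1.1.le, hta⟩, mul_zero]
  have hbound : ∫ t in Ioo a c, k t * y t ≤ ∫ t in Ioo a c, k t * y c := by
    refine setIntegral_mono_on ?_ ((hk.mono_set hsub).mul_const _) measurableSet_Ioo fun t ht => ?_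
    · have hi : IntegrableOn (fun t => k t * y t) (Ioo 0 T) :=
        hk.mul_continuousOn_of_subset hy measurableSet_Ioo isCompact_Icc Ioo_subset_Icc_self
      exact hi.mono_set hsub
    · exact mul_le_mul_of_nonneg_left (hmax ⟨ha.trans ht.1.le, ht.2.le.trans hc.2⟩) (hk0 t)
  have hle : ∫ t in Ioo a c, k t ≤ ∫ t in Ioo a b, k t :=
    setIntegral_mono_set (hk.mono_set hsub') (Eventually.of_forall hk0)
      (Ioo_subset_Ioo_right hc.2).eventuallyLE
  have := h c ⟨ha.trans_lt hca, hc.2.trans_lt hb⟩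
  rw [hsplit] at this
  rw [integral_mul_const] at hbound
  nlinarith

/-- Grönwall's lemma in integral form, with an integrable kernel and zero initial value. -/
lemma eq_zero_of_le_setIntegral_mul {k y : ℝ → ℝ} {T : ℝ}
    (hk : IntegrableOn k (Ioo 0 T)) (hk0 : ∀ t, 0 ≤ k t) (hy : ContinuousOn y (Icc 0 T))
    (hy0 : ∀ t ∈ Icc 0 T, 0 ≤ y t) (hz : y 0 = 0)
    (h : ∀ s ∈ Ioo 0 T, y s ≤ ∫ t in Ioo 0 s, k t * y t) :
    ∀ t ∈ Ico 0 T, y t = 0 := by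
  intro t₁ ht₁
  have hT : 0 ≤ T := ht₁.1.trans ht₁.2.le
  have hprim : ContinuousOn (fun s => ∫ t in Ioc 0 s, k t) (Icc 0 T) := by
    refine intervalIntegral.continuousOn_primitive ?_
    exact (integrableOn_Icc_iff_integrableOn_Ioo).2 hk
  -- Uniform continuity of the primitive of k makes its mass at most 1/2 on every interval shorter
  -- than δ.
  obtain ⟨δ, hδ, hu⟩ := Metric.uniformContinuousOn_iff.1
    (isCompact_Icc.uniformContinuousOn_of_continuous hprim) (1 / 2) (by norm_num)
  have hsmall : ∀ a b, 0 ≤ a → a ≤ b → b < T → b - a < δ → ∫ t in Ioo a b, k t ≤ 1 / 2 := by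
    intro a b ha hab hb hd
    have h1 := hu b ⟨ha.trans hab, hb.le⟩ a ⟨ha, hab.trans hb.le⟩
      (by rw [Real.dist_eq, abs_of_nonneg (sub_nonneg.2 hab)]; exact hd)
    have hk' : IntegrableOn k (Ioc 0 b) :=
      ((integrableOn_Icc_iff_integrableOn_Ioo).2 hk).mono_set
        fun t ht => ⟨ht.1.le, ht.2.trans hb.le⟩
    have h2 : ∫ t in Ioc 0 b, k t = (∫ t in Ioc 0 a, k t) + ∫ t in Ioc a b, k t := by
      rw [← Ioc_union_Ioc_eq_Ioc ha hab, setIntegral_union (Ioc_disjoint_Ioc_of_le le_rfl)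
        measurableSet_Ioc (hk'.mono_set (Ioc_subset_Ioc_right hab))
        (hk'.mono_set (Ioc_subset_Ioc_left ha))]
    rw [Real.dist_eq, h2, add_sub_cancel_left, integral_Ioc_eq_integral_Ioo] at h1
    exact ((le_abs_self _).trans_lt h1).le
  -- [0,t₁] is covered by n steps of length t₁/n < δ, each extending the vanishing of y.
  obtain ⟨n, hn⟩ := exists_nat_gt (t₁ / δ)
  have hnpos : (0 : ℝ) < n := (div_nonneg ht₁.1 hδ.le).trans_lt hn
  have hstep : ∀ m : ℕ, m ≤ n → ∀ t ∈ Icc 0 (m * (t₁ / n)), y t = 0 := by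
    intro m
    induction m with
    | zero =>
      intro _ t ht
      have : t = 0 := by simpa using ht
      rw [this, hz]
    | succ m ih =>
      intro hm
      have hd : 0 ≤ t₁ / n := div_nonneg ht₁.1 hnpos.le
      have hm' : ((m + 1 : ℕ) : ℝ) ≤ n := by exact_mod_cast hm
      have hb : ((m + 1 : ℕ) : ℝ) * (t₁ / n) < T := by
        refine lt_of_le_of_lt (mul_le_mul_of_nonneg_right hm' hd) ?_
        rw [mul_div_cancel₀ _ hnpos.ne']
        exact ht₁.2
      have hab : (m : ℝ) * (t₁ / n) ≤ ((m + 1 : ℕ) : ℝ) * (t₁ / n) :=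
        mul_le_mul_of_nonneg_right (by push_cast; linarith) hd
      refine eq_zero_of_le_setIntegral_mul_step (by positivity) hb hk hk0 hy hy0 h
        (ih (Nat.le_of_succ_le hm)) hab (hsmall _ _ (by positivity) hab hb ?_)
      push_cast
      rw [add_mul, one_mul, add_sub_cancel_left, div_lt_iff₀ hnpos]
      rwa [div_lt_iff₀ hδ, mul_comm] at hn
  refine hstep n le_rfl t₁ ⟨ht₁.1, ?_⟩
  rw [mul_div_cancel₀ _ hnpos.ne']

end Gronwall

/-! ### Value and gradient maps on V, and the bound on b -/

section VMaps

variable {N : ℕ} {Ω : Set (Euc N)}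

/-- The embedding of `V` in `L²(Ω)^N`. -/
noncomputable def V.valPi : V Ω →L[ℝ] PiLp 2 (fun _ : Fin N => Lp ℝ 2 (volume.restrict Ω)) :=
  (PiLp.continuousLinearEquiv 2 ℝ
    (fun _ : Fin N => Lp ℝ 2 (volume.restrict Ω))).symm.toContinuousLinearMap.comp
    (ContinuousLinearMap.pi fun k => H10.valL.comp (V.compL k))

/-- The gradient on `V`. -/
noncomputable def V.gradPi :
    V Ω →L[ℝ] PiLp 2 (fun _ : Fin N => Lp (Euc N) 2 (volume.restrict Ω)) :=
  (PiLp.continuousLinearEquiv 2 ℝ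
    (fun _ : Fin N => Lp (Euc N) 2 (volume.restrict Ω))).symm.toContinuousLinearMap.comp
    (ContinuousLinearMap.pi fun k => H10.gradL.comp (V.compL k))

lemma V.valPi_eq (u : V Ω) : V.valPi u = WithLp.toLp 2 u.val := rfl

lemma V.valPi_apply (u : V Ω) (k : Fin N) : V.valPi u k = u.val k := rfl

lemma innerL2_eq_inner (u v : V Ω) : innerL2 u v = inner ℝ (V.valPi u) (V.valPi v) := by
  rw [PiLp.inner_apply]
  refine Finset.sum_congr rfl fun k _ => ?_
  rw [L2.inner_def]
  simp only [V.valPi_apply, RCLike.inner_apply, conj_trivial, mul_comm]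

lemma V.norm_gradPi_sq (u : V Ω) : ‖V.gradPi u‖ ^ 2 = ∑ k, ‖u.grad k‖ ^ 2 :=
  PiLp.norm_sq_eq_of_L2 _ _

lemma V.eq_zero_of_val_of_grad {u : V Ω} (hv : V.valPi u = 0) (hg : V.gradPi u = 0) : u = 0 := by
  refine Subtype.ext (PiLp.ext fun k => Subtype.ext ?_)
  refine WithLp.ofLp_injective 2 (Prod.ext ?_ ?_)
  · exact congrArg (fun p : PiLp 2 (fun _ : Fin N => Lp ℝ 2 (volume.restrict Ω)) => p k) hv
  · exact congrArg (fun p : PiLp 2 (fun _ : Fin N => Lp (Euc N) 2 (volume.restrict Ω)) => p k) hg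

/-- The two-dimensional estimate of the convective term. -/
lemma exists_abs_b_le (Ω : Set (Euc 2)) : ∃ K : ℝ, 0 ≤ K ∧ ∀ p q : V Ω,
    |b p q p| ≤ K * (‖V.valPi p‖ * ‖V.gradPi p‖ * ‖V.gradPi q‖) := by
  obtain ⟨K, hK, h⟩ := exists_abs_tri_le Ω
  -- The factor 4 counts the index pairs (k, j) in dimension two.
  refine ⟨K * (4 * ladyConst), mul_nonneg hK (mul_nonneg (by norm_num) ladyConst_nonneg),
    fun p q => ?_⟩
  set J := fun k => ‖H10.toL4 (V.compL k p)‖ with hJ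
  have hJ2 : ∀ k, J k ^ 2 ≤ ladyConst * (‖V.valPi p‖ * ‖V.gradPi p‖) := fun k =>
    (norm_toL4_sq_le _).trans <| mul_le_mul_of_nonneg_left
      (mul_le_mul (PiLp.norm_apply_le (V.valPi p) k) (PiLp.norm_apply_le (V.gradPi p) k)
        (norm_nonneg _) (norm_nonneg _)) ladyConst_nonneg
  have hb : ∀ k j, |tri j (V.compL j p) (V.compL k q) (V.compL k p)|
      ≤ K * (ladyConst * (‖V.valPi p‖ * ‖V.gradPi p‖) * ‖V.gradPi q‖) := fun k j => by
    refine (h _ _ _ _).trans (mul_le_mul_of_nonneg_left ?_ hK)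
    refine mul_le_mul ?_ (PiLp.norm_apply_le (V.gradPi q) k) (norm_nonneg _)
      (mul_nonneg ladyConst_nonneg (by positivity))
    have h1 := hJ2 k
    have h2 := hJ2 j
    change J j * J k ≤ _
    -- J_j J_k ≤ (J_j² + J_k²)/2, and Ladyzhenskaya's inequality bounds each square.
    nlinarith [sq_nonneg (J j - J k)]
  rw [b_eq_sum_tri]
  calc |∑ k, ∑ j, tri j (V.compL j p) (V.compL k q) (V.compL k p)|
      ≤ ∑ k : Fin 2, ∑ j : Fin 2, |tri j (V.compL j p) (V.compL k q) (V.compL k p)| :=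
        (Finset.abs_sum_le_sum_abs _ _).trans
          (Finset.sum_le_sum fun k _ => Finset.abs_sum_le_sum_abs _ _)
    _ ≤ ∑ k : Fin 2, ∑ j : Fin 2,
          K * (ladyConst * (‖V.valPi p‖ * ‖V.gradPi p‖) * ‖V.gradPi q‖) :=
        Finset.sum_le_sum fun k _ => Finset.sum_le_sum fun j _ => hb k j
    _ = K * (4 * ladyConst) * (‖V.valPi p‖ * ‖V.gradPi p‖ * ‖V.gradPi q‖) := by
        simp only [Finset.sum_const, Finset.card_univ, Fintype.card_fin, nsmul_eq_mul]
        push_cast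
        ring

end VMaps

/-! ### Time slices of functions on the cylinder -/

section Slices

variable {α β X : Type*} [MeasurableSpace α] [MeasurableSpace β] [NormedAddCommGroup X]
  {μ : Measure α} {ν : Measure β} [SFinite μ] [SFinite ν]

lemma ae_ae_swap_of_ae_prod {p : α × β → Prop} (h : ∀ᵐ z ∂μ.prod ν, p z) :
    ∀ᵐ t ∂ν, ∀ᵐ x ∂μ, p (x, t) :=
  Measure.ae_ae_of_ae_prod
    ((Measure.measurePreserving_swap (μ := ν) (ν := μ)).quasiMeasurePreserving.ae h)

lemma Lp_prod_ext {F G : Lp X 2 (μ.prod ν)} (h : ∀ᵐ t ∂ν, ∀ᵐ x ∂μ, F (x, t) = G (x, t)) :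
    F = G := by
  refine Lp.ext ?_
  have hm : MeasurableSet {z : α × β | F z = G z} :=
    (Lp.stronglyMeasurable F).measurableSet_eq_fun (Lp.stronglyMeasurable G)
  exact (Measure.ae_prod_iff_ae_ae hm).2
    ((Measure.ae_ae_comm (p := fun x t => F (x, t) = G (x, t)) hm).2 h)

/-- Serves to localise each term of the equation after the test function is cut off in time. -/
lemma setIntegral_eq_of_ae_eq_indicator {T s : ℝ} (hs : s ≤ T) {F G : ℝ → ℝ}
    (h : ∀ᵐ t ∂volume.restrict (Ioo 0 T), F t = (Ioo 0 s).indicator G t) :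
    ∫ t in Ioo 0 T, F t = ∫ t in Ioo 0 s, G t := by
  rw [integral_congr_ae h, setIntegral_indicator measurableSet_Ioo,
    inter_eq_self_of_subset_right (Ioo_subset_Ioo_right hs)]

end Slices

/-! ### The variational equation restricted to ]0,s[ -/

section LocalEquation

variable {N : ℕ} {Ω : Set (Euc N)} {T : ℝ}

lemma b_zero_right (u v : V Ω) : b u v 0 = 0 := by
  have h : ∀ k, ∀ᵐ x ∂volume.restrict Ω, (0 : V Ω).val k x = 0 := fun k =>
    Lp.coeFn_zero ℝ 2 (volume.restrict Ω)
  refine Finset.sum_eq_zero fun k _ => Finset.sum_eq_zero fun j _ => ?_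
  refine integral_eq_zero_of_ae ?_
  filter_upwards [h k] with x hx
  rw [hx, mul_zero, Pi.zero_apply]

lemma volume_restrict_cylinder (Ω : Set (Euc N)) (T : ℝ) :
    (volume : Measure (Euc N × ℝ)).restrict (Ω ×ˢ Ioo 0 T)
      = (volume.restrict Ω).prod (volume.restrict (Ioo 0 T)) := by
  rw [Measure.volume_eq_prod, Measure.prod_restrict]

lemma exists_curry_cylinder (F : Lp (L2perZ N) 2 (volume.restrict (Ω ×ˢ Ioo 0 T))) :
    ∃ C : ℝ → Lp (L2perZ N) 2 (volume.restrict Ω), MemLp C 2 (timeMeas T) ∧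
      ∀ᵐ t ∂timeMeas T, ∀ᵐ x ∂volume.restrict Ω, C t x = F (x, t) := by
  have e := volume_restrict_cylinder Ω T
  -- The type of F depends on the measure, so the measure is made a variable before being replaced
  -- by the product.
  generalize (volume : Measure (Euc N × ℝ)).restrict (Ω ×ˢ Ioo 0 T) = ρ at e F
  subst e
  exact exists_curry_memLp F

lemma Lp_cylinder_ext {F G : Lp (L2perZ N) 2 (volume.restrict (Ω ×ˢ Ioo 0 T))}
    (h : ∀ᵐ t ∂timeMeas T, ∀ᵐ x ∂volume.restrict Ω, F (x, t) = G (x, t)) : F = G := by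
  have e := volume_restrict_cylinder Ω T
  generalize (volume : Measure (Euc N × ℝ)).restrict (Ω ×ˢ Ioo 0 T) = ρ at e F G h
  subst e
  exact Lp_prod_ext h

lemma ae_ae_of_ae_cylinder {p : Euc N × ℝ → Prop}
    (h : ∀ᵐ z ∂volume.restrict (Ω ×ˢ Ioo 0 T), p z) :
    ∀ᵐ t ∂timeMeas T, ∀ᵐ x ∂volume.restrict Ω, p (x, t) := by
  rw [volume_restrict_cylinder] at h
  exact ae_ae_swap_of_ae_prod h

/-- The variational equation on `]0,s[`, in terms of the bounded form `twoScaleForm`. -/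
lemma local_equation {a : Fin N → Fin N → Euc N → ℝ}
    {A : Fin N → Fin N → Lp ℝ ⊤ (volume.restrict (Y N))}
    (hA : ∀ i j, ∀ᵐ y ∂volume.restrict (Y N), A i j y = a i j y)
    {f : Lp (HNeg1N Ω) 2 (timeMeas T)} {u : F01 Ω T}
    {g : Lp (StrongDual ℝ (V Ω)) 2 (timeMeas T)}
    (heq : ∀ v : F01 Ω T, (∫ t in Ioo 0 T, g t (v.1 t))
        + (∫ t in Ioo 0 T,
            aHat a (u.1 t) (fun x => u.2 (x, t)) (v.1 t) (fun x => v.2 (x, t)))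
        + (∫ t in Ioo 0 T, b (u.1 t) (u.1 t) (v.1 t))
      = ∫ t in Ioo 0 T, pairing (f t) (v.1 t))
    {U₁ : ℝ → Lp (L2perZ N) 2 (volume.restrict Ω)}
    (hU : ∀ᵐ t ∂timeMeas T, ∀ᵐ x ∂volume.restrict Ω, U₁ t x = u.2 (x, t))
    (z : F01 Ω T) {Z₁ : ℝ → Lp (L2perZ N) 2 (volume.restrict Ω)}
    (hZ : ∀ᵐ t ∂timeMeas T, ∀ᵐ x ∂volume.restrict Ω, Z₁ t x = z.2 (x, t))
    {s : ℝ} (hs : s ≤ T) :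
    (∫ t in Ioo 0 s, g t (z.1 t))
        + (∫ t in Ioo 0 s, twoScaleForm Ω A (u.1 t, U₁ t) (z.1 t, Z₁ t))
        + (∫ t in Ioo 0 s, b (u.1 t) (u.1 t) (z.1 t))
      = ∫ t in Ioo 0 s, pairing (f t) (z.1 t) := by
  -- Multiplying by the indicator of ]0,s[ keeps the pair in 𝔽₀¹, since test functions need no
  -- regularity in time.
  have m0 : MemLp ((Ioo 0 s).indicator z.1) 2 (timeMeas T) :=
    (Lp.memLp z.1).indicator measurableSet_Ioo
  have m1 : MemLp ((univ ×ˢ Ioo 0 s : Set (Euc N × ℝ)).indicator z.2) 2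
      (volume.restrict (Ω ×ˢ Ioo 0 T)) :=
    (Lp.memLp z.2).indicator (MeasurableSet.univ.prod measurableSet_Ioo)
  have e0 := m0.coeFn_toLp
  have e1 := ae_ae_of_ae_cylinder (p := fun q => m1.toLp _ q = _) m1.coeFn_toLp
  have key := heq (m0.toLp _, m1.toLp _)
  simp only at key
  rw [setIntegral_eq_of_ae_eq_indicator hs (G := fun t => g t (z.1 t)),
    setIntegral_eq_of_ae_eq_indicator hs
      (G := fun t => twoScaleForm Ω A (u.1 t, U₁ t) (z.1 t, Z₁ t)),
    setIntegral_eq_of_ae_eq_indicator hs (G := fun t => b (u.1 t) (u.1 t) (z.1 t)),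
    setIntegral_eq_of_ae_eq_indicator hs (G := fun t => pairing (f t) (z.1 t))] at key
  · exact key
  · filter_upwards [e0] with t h
    rw [h]
    by_cases ht : t ∈ Ioo 0 s
    · simp only [indicator_of_mem ht]
    · simp only [indicator_of_notMem ht, pairing]
      exact Finset.sum_eq_zero fun k _ => map_zero (f t k)
  · filter_upwards [e0] with t h
    rw [h]
    by_cases ht : t ∈ Ioo 0 s
    · simp only [indicator_of_mem ht]
    · simp only [indicator_of_notMem ht]
      have := b_zero_right (u.1 t) (u.1 t)
      exact this
  · filter_upwards [e0, e1, hU, hZ] with t h h1 hu hz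
    rw [h]
    by_cases ht : t ∈ Ioo 0 s
    · simp only [indicator_of_mem ht]
      refine aHat_eq_twoScaleForm hA _ _ hu ?_
      filter_upwards [hz, h1] with x hx hx1
      rw [hx, hx1, indicator_of_mem (mk_mem_prod (mem_univ _) ht)]
    · simp only [indicator_of_notMem ht]
      -- For t outside ]0,s[ both components of the cut-off pair vanish, and so does the form, by
      -- linearity in its second argument.
      have : twoScaleForm Ω A (u.1 t, U₁ t) ((0 : V Ω), (0 : Lp (L2perZ N) 2 (volume.restrict Ω))) = 0 :=
        map_zero (twoScaleForm Ω A (u.1 t, U₁ t))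
      refine Eq.trans ?_ this
      refine aHat_eq_twoScaleForm hA _ _ hu ?_
      filter_upwards [Lp.coeFn_zero (L2perZ N) 2 (volume.restrict Ω), h1] with x hx hx1
      rw [hx, hx1, indicator_of_notMem fun hm => ht hm.2]
      rfl
  · filter_upwards [e0] with t h
    rw [h]
    by_cases ht : t ∈ Ioo 0 s
    · simp only [indicator_of_mem ht]
    · simp only [indicator_of_notMem ht, map_zero]

end LocalEquation

/-! ### Differences of solutions and integrability in time -/

section Evolution

lemma L2perZ.eq_zero_of_gradL_eq_zero {N : ℕ} (w : L2perZ N) (h : ∀ k, L2perZ.gradL k w = 0) :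
    w = 0 := by
  refine Lp.ext ?_
  have h1 : ∀ k, ∀ᵐ τ ∂volume.restrict Z, VY.gradL k (w τ) = 0 := fun k => by
    have e : (VY.gradL k).compLpL 2 (volume.restrict Z) w = 0 := h k
    filter_upwards [(VY.gradL k).coeFn_compLpL w, Lp.coeFn_zero
      (Lp (Euc N) 2 (volume.restrict (Y N))) 2 (volume.restrict Z)] with τ h2 h3
    rw [← h2, e, h3]
    rfl
  filter_upwards [ae_all_iff.2 h1, Lp.coeFn_zero (VY N) 2 (volume.restrict Z)] with τ h2 h3
  rw [h3]
  exact VY.eq_zero_of_grad_eq_zero _ h2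

lemma eq_zero_of_cellGradL_eq_zero {N : ℕ} {Ω : Set (Euc N)}
    (w : Lp (L2perZ N) 2 (volume.restrict Ω)) (h : ∀ k, cellGradL Ω k w = 0) : w = 0 := by
  refine Lp.ext ?_
  have h1 : ∀ k, ∀ᵐ x ∂volume.restrict Ω, L2perZ.gradL k (w x) = 0 := fun k => by
    have e : (L2perZ.gradL k).compLpL 2 (volume.restrict Ω) w = 0 := h k
    filter_upwards [(L2perZ.gradL k).coeFn_compLpL w,
      Lp.coeFn_zero (PeriodField N) 2 (volume.restrict Ω)] with x h2 h3
    rw [← h2, e, h3]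
    rfl
  filter_upwards [ae_all_iff.2 h1, Lp.coeFn_zero (L2perZ N) 2 (volume.restrict Ω)] with x h2 h3
  rw [h3]
  exact L2perZ.eq_zero_of_gradL_eq_zero _ h2

variable {N : ℕ} {Ω : Set (Euc N)} {T : ℝ}

lemma InitZero.exists_continuousOn {u : Lp (V Ω) 2 (timeMeas T)} (h : InitZero u) :
    ∃ w : ℝ → PiLp 2 (fun _ : Fin N => Lp ℝ 2 (volume.restrict Ω)),
      ContinuousOn w (Icc 0 T) ∧ (∀ᵐ t ∂timeMeas T, w t = V.valPi (u t)) ∧ w 0 = 0 := by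
  obtain ⟨w, hw, he, h0⟩ := h
  refine ⟨fun t => WithLp.toLp 2 (w t), (PiLp.continuous_toLp 2 _).comp_continuousOn hw, ?_, ?_⟩
  · filter_upwards [he] with t ht
    rw [ht, V.valPi_eq]
  · simp only [h0, WithLp.toLp_zero]

/-- The continuous representative is bounded on the compact [0,T]. This L^∞(0,T; L²) bound makes the
convective terms integrable in time. -/
lemma InitZero.exists_norm_valPi_le {u : Lp (V Ω) 2 (timeMeas T)} (h : InitZero u) :
    ∃ M : ℝ, 0 ≤ M ∧ ∀ᵐ t ∂timeMeas T, ‖V.valPi (u t)‖ ≤ M := by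
  obtain ⟨w, hw, he, -⟩ := h.exists_continuousOn
  obtain ⟨M, hM⟩ := isCompact_Icc.exists_bound_of_continuousOn hw
  refine ⟨max M 0, le_max_right _ _, ?_⟩
  filter_upwards [he, ae_restrict_mem measurableSet_Ioo] with t ht hm
  rw [← ht]
  exact (hM t (Ioo_subset_Icc_self hm)).trans (le_max_left _ _)

lemma InitZero.sub {u w : Lp (V Ω) 2 (timeMeas T)} (hu : InitZero u) (hw : InitZero w) :
    InitZero (u - w) := by
  obtain ⟨U, hU, eU, U0⟩ := hu
  obtain ⟨W, hW, eW, W0⟩ := hw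
  refine ⟨fun t => U t - W t, hU.sub hW, ?_, ?_⟩
  · filter_upwards [eU, eW, Lp.coeFn_sub u w] with t h1 h2 h3
    rw [h1, h2, h3]
    rfl
  · simp only [U0, W0, sub_zero]

lemma IsTimeDeriv.sub {u w : Lp (V Ω) 2 (timeMeas T)}
    {g h : Lp (StrongDual ℝ (V Ω)) 2 (timeMeas T)}
    (hu : IsTimeDeriv u g) (hw : IsTimeDeriv w h) : IsTimeDeriv (u - w) (g - h) := by
  intro φ hφ v
  have i1 : ∀ u : Lp (V Ω) 2 (timeMeas T),
      Integrable (fun t => innerL2 (u t) v * deriv φ t) (timeMeas T) := fun u => by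
    have hi : IntegrableOn (fun t => innerL2 (u t) v) (Ioo 0 T) := by
      simp only [innerL2_eq_inner]
      exact Integrable.inner_const (V.valPi.integrable_comp
        ((Lp.memLp u).integrable (by norm_num))) _
    exact hi.mul_continuousOn_of_subset (hφ.1.continuous_deriv (by simp)).continuousOn
      measurableSet_Ioo isCompact_Icc Ioo_subset_Icc_self
  have i2 : ∀ g : Lp (StrongDual ℝ (V Ω)) 2 (timeMeas T),
      Integrable (fun t => g t v * φ t) (timeMeas T) := fun g => by
    have hi : IntegrableOn (fun t => g t v) (Ioo 0 T) :=
      (ContinuousLinearMap.apply ℝ ℝ v).integrable_comp ((Lp.memLp g).integrable (by norm_num))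
    exact hi.mul_continuousOn_of_subset hφ.1.continuous.continuousOn
      measurableSet_Ioo isCompact_Icc Ioo_subset_Icc_self
  have e1 : ∫ t in Ioo 0 T, innerL2 ((u - w) t) v * deriv φ t
      = ∫ t in Ioo 0 T, (innerL2 (u t) v * deriv φ t - innerL2 (w t) v * deriv φ t) := by
    refine integral_congr_ae ?_
    filter_upwards [Lp.coeFn_sub u w] with t ht
    rw [ht, Pi.sub_apply, innerL2_eq_inner, innerL2_eq_inner, innerL2_eq_inner, map_sub,
      inner_sub_left, sub_mul]
  have e2 : ∫ t in Ioo 0 T, (g - h) t v * φ t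
      = ∫ t in Ioo 0 T, (g t v * φ t - h t v * φ t) := by
    refine integral_congr_ae ?_
    filter_upwards [Lp.coeFn_sub g h] with t ht
    rw [ht, Pi.sub_apply, sub_apply, sub_mul]
  rw [e1, e2, integral_sub (i1 u) (i1 w), integral_sub (i2 g) (i2 h), hu φ hφ v, hw φ hφ v]
  ring

lemma IsTimeDeriv.norm_sq_eq {u : Lp (V Ω) 2 (timeMeas T)}
    {g : Lp (StrongDual ℝ (V Ω)) 2 (timeMeas T)} (hu : IsTimeDeriv u g)
    {w : ℝ → PiLp 2 (fun _ : Fin N => Lp ℝ 2 (volume.restrict Ω))}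
    (hw : ContinuousOn w (Icc 0 T)) (he : ∀ᵐ t ∂timeMeas T, w t = V.valPi (u t)) (h0 : w 0 = 0)
    {s : ℝ} (hs : s ∈ Ioo 0 T) : ‖w s‖ ^ 2 = 2 * ∫ t in Ioo 0 s, g t (u t) := by
  refine norm_sq_eq_integral_of_weak_deriv V.valPi (Lp.memLp u) (Lp.memLp g) hw he h0 ?_ hs
  intro φ hφ v
  simp only [← innerL2_eq_inner]
  exact hu φ hφ v

lemma integrable_of_abs_b_le {Ω : Set (Euc 2)} {p q r : ℝ → V Ω}
    {μ : Measure ℝ} (hp : AEStronglyMeasurable p μ) (hq : MemLp q 2 μ) (hr : MemLp r 2 μ)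
    {K : ℝ} (h : ∀ᵐ t ∂μ, |b (p t) (q t) (r t)| ≤ K * (‖V.gradPi (q t)‖ * ‖V.gradPi (r t)‖)) :
    Integrable (fun t => b (p t) (q t) (r t)) μ := by
  have hm : AEStronglyMeasurable (fun t => b (p t) (q t) (r t)) μ :=
    Continuous.comp_aestronglyMeasurable (g := fun x : V Ω × V Ω × V Ω => b x.1 x.2.1 x.2.2)
      (f := fun t => (p t, q t, r t)) continuous_b
      (hp.prodMk (hq.aestronglyMeasurable.prodMk hr.aestronglyMeasurable))
  have hq' : MemLp (fun t => ‖V.gradPi (q t)‖) 2 μ := (V.gradPi.comp_memLp' hq).norm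
  have hr' : MemLp (fun t => ‖V.gradPi (r t)‖) 2 μ := (V.gradPi.comp_memLp' hr).norm
  have hqr : Integrable (fun t => ‖V.gradPi (q t)‖ * ‖V.gradPi (r t)‖) μ := hq'.integrable_mul hr'
  refine Integrable.mono' (hqr.const_mul K) hm ?_
  filter_upwards [h] with t ht
  exact ht

end Evolution

/-! ### The energy estimate and uniqueness -/

section Uniqueness

variable {Ω : Set (Euc 2)} {T : ℝ}

/-- Antisymmetry turns b(u,u,z) into -b(u,z,u), bounded by |u| ‖∇u‖ ‖∇z‖; the first factor is
bounded in time and the other two are square integrable. -/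
lemma integrable_b_self_left {u z : Lp (V Ω) 2 (timeMeas T)} {M : ℝ}
    (hM : ∀ᵐ t ∂timeMeas T, ‖V.valPi (u t)‖ ≤ M) :
    Integrable (fun t => b (u t) (u t) (z t)) (timeMeas T) := by
  obtain ⟨K, hK, hb⟩ := exists_abs_b_le Ω
  refine integrable_of_abs_b_le (K := K * M) (Lp.memLp u).1 (Lp.memLp u) (Lp.memLp z) ?_
  filter_upwards [hM] with t ht
  rw [b_antisymm, abs_neg]
  refine (hb _ _).trans ?_
  rw [mul_assoc K M]
  refine mul_le_mul_of_nonneg_left ?_ hK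
  rw [mul_assoc]
  exact mul_le_mul_of_nonneg_right ht (by positivity)

lemma integrable_b_self_outer {u z : Lp (V Ω) 2 (timeMeas T)} {M : ℝ}
    (hM : ∀ᵐ t ∂timeMeas T, ‖V.valPi (z t)‖ ≤ M) :
    Integrable (fun t => b (z t) (u t) (z t)) (timeMeas T) := by
  obtain ⟨K, hK, hb⟩ := exists_abs_b_le Ω
  refine integrable_of_abs_b_le (K := K * M) (Lp.memLp z).1 (Lp.memLp u) (Lp.memLp z) ?_
  filter_upwards [hM] with t ht
  refine (hb _ _).trans ?_
  rw [mul_assoc K M]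
  refine mul_le_mul_of_nonneg_left ?_ hK
  rw [mul_assoc, mul_comm ‖V.gradPi (u t)‖]
  exact mul_le_mul_of_nonneg_right ht (by positivity)

/-- The equation satisfied by the difference of two solutions, tested with that difference. -/
lemma difference_equation {a : Fin 2 → Fin 2 → Euc 2 → ℝ}
    {A : Fin 2 → Fin 2 → Lp ℝ ⊤ (volume.restrict (Y 2))}
    (hA : ∀ i j, ∀ᵐ y ∂volume.restrict (Y 2), A i j y = a i j y)
    {f : Lp (HNeg1N Ω) 2 (timeMeas T)} {u w : F01 Ω T}
    {g h : Lp (StrongDual ℝ (V Ω)) 2 (timeMeas T)}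
    (hu0 : InitZero u.1) (hw0 : InitZero w.1)
    (hu : ∀ v : F01 Ω T, (∫ t in Ioo 0 T, g t (v.1 t))
        + (∫ t in Ioo 0 T,
            aHat a (u.1 t) (fun x => u.2 (x, t)) (v.1 t) (fun x => v.2 (x, t)))
        + (∫ t in Ioo 0 T, b (u.1 t) (u.1 t) (v.1 t))
      = ∫ t in Ioo 0 T, pairing (f t) (v.1 t))
    (hw : ∀ v : F01 Ω T, (∫ t in Ioo 0 T, h t (v.1 t))
        + (∫ t in Ioo 0 T,
            aHat a (w.1 t) (fun x => w.2 (x, t)) (v.1 t) (fun x => v.2 (x, t)))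
        + (∫ t in Ioo 0 T, b (w.1 t) (w.1 t) (v.1 t))
      = ∫ t in Ioo 0 T, pairing (f t) (v.1 t))
    {U₁ W₁ : ℝ → Lp (L2perZ 2) 2 (volume.restrict Ω)}
    (mU : MemLp U₁ 2 (timeMeas T)) (mW : MemLp W₁ 2 (timeMeas T))
    (eU : ∀ᵐ t ∂timeMeas T, ∀ᵐ x ∂volume.restrict Ω, U₁ t x = u.2 (x, t))
    (eW : ∀ᵐ t ∂timeMeas T, ∀ᵐ x ∂volume.restrict Ω, W₁ t x = w.2 (x, t))
    {s : ℝ} (hs : s ≤ T) :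
    (∫ t in Ioo 0 s, (g - h) t ((u.1 - w.1) t))
        + (∫ t in Ioo 0 s, twoScaleForm Ω A ((u.1 - w.1) t, U₁ t - W₁ t)
            ((u.1 - w.1) t, U₁ t - W₁ t))
        + (∫ t in Ioo 0 s, b ((u.1 - w.1) t) (u.1 t) ((u.1 - w.1) t)) = 0 := by
  have hst : Ioo 0 s ⊆ Ioo 0 T := Ioo_subset_Ioo_right hs
  have hle : volume.restrict (Ioo 0 s) ≤ timeMeas T := Measure.restrict_mono hst le_rfl
  have eZ : ∀ᵐ t ∂timeMeas T, ∀ᵐ x ∂volume.restrict Ω, (U₁ t - W₁ t) x = (u - w).2 (x, t) := by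
    filter_upwards [eU, eW, ae_ae_of_ae_cylinder (Lp.coeFn_sub u.2 w.2)] with t h1 h2 h3
    filter_upwards [h1, h2, h3, Lp.coeFn_sub (U₁ t) (W₁ t)] with x a1 a2 a3 a4
    rw [a4, Pi.sub_apply, a1, a2]
    exact a3.symm
  have ku := local_equation hA hu eU (u - w) eZ hs
  have kw := local_equation hA hw eW (u - w) eZ hs
  have pair : ∀ (p : Lp (V Ω) 2 (timeMeas T)) (P : ℝ → Lp (L2perZ 2) 2 (volume.restrict Ω)),
      MemLp P 2 (timeMeas T) → MemLp (fun t => (p t, P t)) 2 (timeMeas T) := fun p P hP =>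
    MemLp.of_fst_snd ⟨Lp.memLp p, hP⟩
  have iG : ∀ g : Lp (StrongDual ℝ (V Ω)) 2 (timeMeas T),
      Integrable (fun t => g t ((u - w).1 t)) (volume.restrict (Ioo 0 s)) := fun g =>
    (integrable_bilin (.id ℝ (StrongDual ℝ (V Ω))) (Lp.memLp g) (Lp.memLp (u - w).1)).mono_measure
      hle
  have iA : ∀ (p : Lp (V Ω) 2 (timeMeas T)) (P : ℝ → Lp (L2perZ 2) 2 (volume.restrict Ω)),
      MemLp P 2 (timeMeas T) → Integrable (fun t => twoScaleForm Ω A (p t, P t)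
        ((u - w).1 t, U₁ t - W₁ t)) (volume.restrict (Ioo 0 s)) := fun p P hP =>
    (integrable_bilin (twoScaleForm Ω A) (pair p P hP)
      (pair (u - w).1 (fun t => U₁ t - W₁ t) (mU.sub mW))).mono_measure hle
  have iB : ∀ p : Lp (V Ω) 2 (timeMeas T), InitZero p →
      Integrable (fun t => b (p t) (p t) ((u - w).1 t)) (volume.restrict (Ioo 0 s)) :=
    fun p hp => by
      obtain ⟨M, -, hM⟩ := hp.exists_norm_valPi_le
      exact (integrable_b_self_left hM).mono_measure hle
  have aez : ∀ᵐ t ∂volume.restrict (Ioo 0 s), (u.1 - w.1) t = u.1 t - w.1 t :=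
    ae_mono hle (Lp.coeFn_sub u.1 w.1)
  have aeg : ∀ᵐ t ∂volume.restrict (Ioo 0 s), (g - h) t = g t - h t :=
    ae_mono hle (Lp.coeFn_sub g h)
  have e1 : ∫ t in Ioo 0 s, (g - h) t ((u.1 - w.1) t)
      = (∫ t in Ioo 0 s, g t ((u - w).1 t)) - ∫ t in Ioo 0 s, h t ((u - w).1 t) := by
    rw [← integral_sub (iG g) (iG h)]
    refine integral_congr_ae ?_
    filter_upwards [aeg] with t ht
    rw [ht]
    rfl
  have e2 : ∫ t in Ioo 0 s, twoScaleForm Ω A ((u.1 - w.1) t, U₁ t - W₁ t)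
            ((u.1 - w.1) t, U₁ t - W₁ t)
      = (∫ t in Ioo 0 s, twoScaleForm Ω A (u.1 t, U₁ t) ((u - w).1 t, U₁ t - W₁ t))
        - ∫ t in Ioo 0 s, twoScaleForm Ω A (w.1 t, W₁ t) ((u - w).1 t, U₁ t - W₁ t) := by
    rw [← integral_sub (iA u.1 U₁ mU) (iA w.1 W₁ mW)]
    refine integral_congr_ae ?_
    filter_upwards [aez] with t ht
    have : ((u.1 - w.1) t, U₁ t - W₁ t) = (u.1 t, U₁ t) - (w.1 t, W₁ t) := by
      rw [Prod.mk_sub_mk, ht]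
    rw [← sub_apply, ← map_sub, ← this]
    rfl
  have e3 : ∫ t in Ioo 0 s, b ((u.1 - w.1) t) (u.1 t) ((u.1 - w.1) t)
      = (∫ t in Ioo 0 s, b (u.1 t) (u.1 t) ((u - w).1 t))
        - ∫ t in Ioo 0 s, b (w.1 t) (w.1 t) ((u - w).1 t) := by
    rw [← integral_sub (iB u.1 hu0) (iB w.1 hw0)]
    refine integral_congr_ae ?_
    filter_upwards [aez] with t ht
    rw [show (u - w).1 = u.1 - w.1 from rfl, ht, b_sub_b]
  -- Both equations have the same right-hand side, which cancels.
  rw [e1, e2, e3]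
  linarith

/-- A nonnegative function whose integrals over `]0,s[`, `s < T`, vanish is zero almost
everywhere. -/
lemma ae_eq_zero_of_setIntegral_Ioo_eq_zero {F : ℝ → ℝ} (hF : Integrable F (timeMeas T))
    (h0 : ∀ t, 0 ≤ F t) (h : ∀ s ∈ Ioo 0 T, ∫ t in Ioo 0 s, F t = 0) :
    ∀ᵐ t ∂timeMeas T, F t = 0 := by
  obtain ⟨r, -, hr, hlim⟩ := exists_seq_strictMono_tendsto T
  have hn : ∀ n, ∀ᵐ t ∂(volume : Measure ℝ), t ∈ Ioo 0 (r n) → F t = 0 := fun n => by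
    rcases le_or_gt (r n) 0 with hn | hn
    · exact Eventually.of_forall fun t ht => absurd (ht.1.trans ht.2) hn.not_gt
    · refine (ae_restrict_iff' measurableSet_Ioo).1 ?_
      exact (setIntegral_eq_zero_iff_of_nonneg_ae (Eventually.of_forall h0)
        (hF.mono_measure (Measure.restrict_mono (Ioo_subset_Ioo_right (hr n).le) le_rfl))).1
        (h _ ⟨hn, hr n⟩)
  refine (ae_restrict_iff' measurableSet_Ioo).2 ?_
  filter_upwards [ae_all_iff.2 hn] with t ht hm
  obtain ⟨n, hn⟩ := (hlim.eventually (lt_mem_nhds hm.2)).exists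
  exact ht n ⟨hm.1, hn⟩

/-- The energy estimate: a function of `𝒲(0,T)` with zero initial value whose energy is balanced
by a coercive form and by the convective term vanishes, as does the form along it. -/
lemma valPi_eq_zero_of_energy {z u : Lp (V Ω) 2 (timeMeas T)}
    {g : Lp (StrongDual ℝ (V Ω)) 2 (timeMeas T)} (hd : IsTimeDeriv z g) (hz0 : InitZero z)
    {F : ℝ → ℝ} (hF : Integrable F (timeMeas T)) {c : ℝ} (hc : 0 < c)
    (hcoer : ∀ t, c * ‖V.gradPi (z t)‖ ^ 2 ≤ F t)
    (heq : ∀ s ∈ Ioo 0 T, (∫ t in Ioo 0 s, g t (z t)) + (∫ t in Ioo 0 s, F t)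
      + (∫ t in Ioo 0 s, b (z t) (u t) (z t)) = 0) :
    (∀ᵐ t ∂timeMeas T, V.valPi (z t) = 0) ∧ ∀ᵐ t ∂timeMeas T, F t = 0 := by
  obtain ⟨w, hw, he, hw0⟩ := hz0.exists_continuousOn
  obtain ⟨M, -, hM⟩ := hz0.exists_norm_valPi_le
  obtain ⟨K, hK, hb⟩ := exists_abs_b_le Ω
  have iB := integrable_b_self_outer (u := u) hM
  have henergy := fun s hs => hd.norm_sq_eq hw he hw0 (s := s) hs
  -- K²/(2c) is what remains after maximising 2KAG - 2cG² over G = ‖∇z‖, with A = |z| ‖∇u‖.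
  set k : ℝ → ℝ := fun t => K ^ 2 / (2 * c) * ‖V.gradPi (u t)‖ ^ 2 with hk
  have ik : IntegrableOn k (Ioo 0 T) := by
    have h2 : MemLp (fun t => V.gradPi (u t)) 2 (timeMeas T) :=
      V.gradPi.comp_memLp' (Lp.memLp u)
    exact (h2.integrable_norm_pow (by norm_num)).const_mul _
  have hk0 : ∀ t, 0 ≤ k t := fun t => by positivity
  have hy : ContinuousOn (fun t => ‖w t‖ ^ 2) (Icc 0 T) := hw.norm.pow 2
  have iky : IntegrableOn (fun t => k t * ‖w t‖ ^ 2) (Ioo 0 T) :=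
    ik.mul_continuousOn_of_subset hy measurableSet_Ioo isCompact_Icc Ioo_subset_Icc_self
  have hzero : ∀ t ∈ Ico 0 T, ‖w t‖ ^ 2 = 0 := by
    refine eq_zero_of_le_setIntegral_mul ik hk0 hy (fun t _ => sq_nonneg _) (by simp [hw0])
      fun s hs => ?_
    have hle : volume.restrict (Ioo 0 s) ≤ timeMeas T :=
      Measure.restrict_mono (Ioo_subset_Ioo_right hs.2.le) le_rfl
    have hmono : ∫ t in Ioo 0 s, (-2 * F t + -2 * b (z t) (u t) (z t))
        ≤ ∫ t in Ioo 0 s, k t * ‖w t‖ ^ 2 := by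
      refine integral_mono_ae (((hF.const_mul _).add (iB.const_mul _)).mono_measure hle)
        (iky.mono_set (Ioo_subset_Ioo_right hs.2.le)) ?_
      filter_upwards [ae_mono hle he] with t ht
      have h1 := hb (z t) (u t)
      have h2 := neg_abs_le (b (z t) (u t) (z t))
      have h3 := hcoer t
      rw [ht]
      -- Young's inequality, written as completion of the square.
      have h4 : K ^ 2 / (2 * c) * ‖V.gradPi (u t)‖ ^ 2 * ‖V.valPi (z t)‖ ^ 2
          + 2 * (c * ‖V.gradPi (z t)‖ ^ 2)
          - 2 * (K * (‖V.valPi (z t)‖ * ‖V.gradPi (z t)‖ * ‖V.gradPi (u t)‖))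
          = (K * ‖V.gradPi (u t)‖ * ‖V.valPi (z t)‖ - 2 * c * ‖V.gradPi (z t)‖) ^ 2
            / (2 * c) := by
        field_simp
        ring
      have h5 : 0 ≤ (K * ‖V.gradPi (u t)‖ * ‖V.valPi (z t)‖ - 2 * c * ‖V.gradPi (z t)‖) ^ 2
            / (2 * c) := by positivity
      change -2 * F t + -2 * b (z t) (u t) (z t)
        ≤ K ^ 2 / (2 * c) * ‖V.gradPi (u t)‖ ^ 2 * ‖V.valPi (z t)‖ ^ 2
      linarith
    rw [integral_add ((hF.mono_measure hle).const_mul _) ((iB.mono_measure hle).const_mul _),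
      integral_const_mul, integral_const_mul] at hmono
    have h1 := heq s hs
    have h2 := henergy s hs
    linarith
  have hval : ∀ᵐ t ∂timeMeas T, V.valPi (z t) = 0 := by
    filter_upwards [he, ae_restrict_mem measurableSet_Ioo] with t ht hm
    rw [← ht, ← norm_eq_zero]
    exact pow_eq_zero_iff two_ne_zero |>.1 (hzero t (Ioo_subset_Ico_self hm))
  -- With z = 0 in L² the energy and convective terms vanish, so the balance leaves only the
  -- integral of F, which is nonnegative by coercivity.
  refine ⟨hval, ae_eq_zero_of_setIntegral_Ioo_eq_zero hF
    (fun t => (by positivity : (0 : ℝ) ≤ c * ‖V.gradPi (z t)‖ ^ 2).trans (hcoer t))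
    fun s hs => ?_⟩
  have hle : volume.restrict (Ioo 0 s) ≤ timeMeas T :=
    Measure.restrict_mono (Ioo_subset_Ioo_right hs.2.le) le_rfl
  have hB : ∫ t in Ioo 0 s, b (z t) (u t) (z t) = 0 := by
    refine integral_eq_zero_of_ae ?_
    filter_upwards [ae_mono hle hval] with t ht
    have := hb (z t) (u t)
    rw [ht, norm_zero, zero_mul, zero_mul, mul_zero] at this
    exact abs_nonpos_iff.1 this
  have h1 := heq s hs
  have h2 := henergy s hs
  rw [hzero s (Ioo_subset_Ico_self hs)] at h2
  linarith

/-- Uniqueness for the two-scale problem. -/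
theorem IsSolution.unique {a : Fin 2 → Fin 2 → Euc 2 → ℝ}
    (ha : ∀ i j, MemLp (a i j) ⊤ volume) {α : ℝ} (hα : 0 < α)
    (hell : ∀ᵐ y : Euc 2, ∀ ζ : Euc 2, α * ‖ζ‖ ^ 2 ≤ ∑ i, ∑ j, a i j y * ζ j * ζ i)
    {f : Lp (HNeg1N Ω) 2 (timeMeas T)} {u w : F01 Ω T}
    (hu : IsSolution a f u) (hw : IsSolution a f w) : u = w := by
  obtain ⟨g, hug, hu0, hue⟩ := hu
  obtain ⟨h, hwh, hw0, hwe⟩ := hw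
  obtain ⟨U₁, mU, eU⟩ := exists_curry_cylinder u.2
  obtain ⟨W₁, mW, eW⟩ := exists_curry_cylinder w.2
  let A : Fin 2 → Fin 2 → Lp ℝ ⊤ (volume.restrict (Y 2)) := fun i j =>
    ((ha i j).restrict (Y 2)).toLp _
  have hA : ∀ i j, ∀ᵐ y ∂volume.restrict (Y 2), A i j y = a i j y := fun i j =>
    ((ha i j).restrict (Y 2)).coeFn_toLp
  have hellA : ∀ᵐ y ∂volume.restrict (Y 2), ∀ ζ : Euc 2,
      α * ‖ζ‖ ^ 2 ≤ ∑ i, ∑ j, A i j y * ζ j * ζ i := by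
    filter_upwards [ae_restrict_of_ae hell, ae_all_iff.2 fun i => ae_all_iff.2 (hA i)]
      with y h1 h2 ζ
    simp only [h2]
    exact h1 ζ
  have hcoer : ∀ t, α * ∑ k, (cellMass 2 * ‖((u.1 - w.1) t).grad k‖ ^ 2
      + ‖cellGradL Ω k (U₁ t - W₁ t)‖ ^ 2)
      ≤ twoScaleForm Ω A ((u.1 - w.1) t, U₁ t - W₁ t) ((u.1 - w.1) t, U₁ t - W₁ t) := fun t =>
    twoScaleForm_coercive hellA _ _
  have mZ : MemLp (fun t => ((u.1 - w.1) t, U₁ t - W₁ t)) 2 (timeMeas T) :=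
    MemLp.of_fst_snd ⟨Lp.memLp (u.1 - w.1), mU.sub mW⟩
  have hm := cellMass_pos 2
  obtain ⟨hval, hform⟩ := valPi_eq_zero_of_energy (u := u.1) (hug.sub hwh) (hu0.sub hw0)
    (integrable_bilin (twoScaleForm Ω A) mZ mZ) (mul_pos hα hm)
    -- The microscopic gradient is dropped: c = α |Y×Z| is the coercivity constant in ∇z₀ alone.
    (fun t => by
      refine le_trans ?_ (hcoer t)
      rw [V.norm_gradPi_sq, mul_assoc, Finset.mul_sum (a := cellMass 2)]
      refine mul_le_mul_of_nonneg_left (Finset.sum_le_sum fun k _ => ?_) hα.le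
      exact le_add_of_nonneg_right (sq_nonneg _))
    (fun s hs => difference_equation hA hu0 hw0 hue hwe mU mW eU eW hs.2.le)
  -- The full coercivity bound is used here: once the form vanishes, every term of a sum of
  -- nonnegative squares vanishes, which brings in ∇_y z₁.
  have hgrad : ∀ᵐ t ∂timeMeas T, ∀ k, ((u.1 - w.1) t).grad k = 0 ∧
      cellGradL Ω k (U₁ t - W₁ t) = 0 := by
    filter_upwards [hform] with t ht k
    have h1 := hcoer t
    rw [ht] at h1
    have h2 : ∀ k ∈ Finset.univ, 0 ≤ cellMass 2 * ‖((u.1 - w.1) t).grad k‖ ^ 2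
      + ‖cellGradL Ω k (U₁ t - W₁ t)‖ ^ 2 := fun k _ => by positivity
    have h3 : ∑ k, (cellMass 2 * ‖((u.1 - w.1) t).grad k‖ ^ 2
      + ‖cellGradL Ω k (U₁ t - W₁ t)‖ ^ 2) = 0 :=
      le_antisymm (nonpos_of_mul_nonpos_right h1 hα) (Finset.sum_nonneg h2)
    have h4 := (Finset.sum_eq_zero_iff_of_nonneg h2).1 h3 k (Finset.mem_univ k)
    rw [add_eq_zero_iff_of_nonneg (by positivity) (by positivity)] at h4
    exact ⟨norm_eq_zero.1 (pow_eq_zero_iff two_ne_zero |>.1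
        ((mul_eq_zero.1 h4.1).resolve_left hm.ne')),
      norm_eq_zero.1 (pow_eq_zero_iff two_ne_zero |>.1 h4.2)⟩
  refine Prod.ext (sub_eq_zero.1 (Lp.ext ?_)) (Lp_cylinder_ext ?_)
  · filter_upwards [hval, hgrad, Lp.coeFn_zero (V Ω) 2 (timeMeas T)] with t h1 h2 h3
    rw [h3]
    exact V.eq_zero_of_val_of_grad h1 (PiLp.ext fun k => (h2 k).1)
  · filter_upwards [hgrad, eU, eW] with t h1 h2 h3
    have h4 : U₁ t = W₁ t := sub_eq_zero.1 (eq_zero_of_cellGradL_eq_zero _ fun k => (h1 k).2)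
    rw [h4] at h2
    filter_upwards [h2, h3] with x h5 h6
    rw [← h5, h6]

end Uniqueness

end TwoScale

theorem lemma2p3 (Ω : Set (TwoScale.Euc 2)) (hΩo : IsOpen Ω) (hΩb : Bornology.IsBounded Ω)
    (T : ℝ) (hT : 0 < T)
    (a : Fin 2 → Fin 2 → TwoScale.Euc 2 → ℝ)
    (ha : ∀ i j, MemLp (a i j) ⊤ volume)
    (hsymm : ∀ i j, ∀ᵐ y : TwoScale.Euc 2, a i j y = a j i y)
    (α : ℝ) (hα : 0 < α)
    (hell : ∀ᵐ y : TwoScale.Euc 2, ∀ ζ : TwoScale.Euc 2,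
      α * ‖ζ‖ ^ 2 ≤ ∑ i, ∑ j, a i j y * ζ j * ζ i)
    (f : Lp (TwoScale.HNeg1N Ω) 2 (TwoScale.timeMeas T))
    (u w : TwoScale.F01 Ω T)
    (hu : TwoScale.IsSolution a f u) (hw : TwoScale.IsSolution a f w) :
    u = w :=
  hu.unique ha hα hell hw
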